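/- Let $M$ be a smooth manifold of even dimension $n$, and let $F$ be a closed $2$-form and $H$ a $3$-form on $M$ with $dH=-F\wedge F$. Let $E=TM\oplus T^*M\oplus\mathbb{R}$ with scalar product $\langle X+\xi+\lambda,Y+\eta+\mu\rangle=\frac12(\eta(X)+\xi(Y))+\lambda\mu$, anchor the projection to $TM$, and Dorfman bracket $$[X+\xi+\lambda,Y+\eta+\mu]=\mathcal{L}_XY+\mathcal{L}_X\eta-i_Yd\xi+2\mu\,d\lambda+i_Xi_YH-2(\mu\,i_XF-\lambda\,i_YF)+X(\mu)-Y(\lambda)+F(X,Y).$$ A generalized metric $\mathcal{G}$ on $E$ is a rank $n$ subbundle $E_-\subset E$ on which $\langle\cdot,\cdot\rangle$ is non-degenerate and which the anchor maps isomorphically onto $TM$; put $E_+=E_-^\perp$ and $\mathcal{G}^{\mathrm{end}}|_{E_\pm}=\pm\mathrm{Id}$. A $B_n$-generalized almost complex structure is an endomorphism $\mathcal{F}$ of $E$ whose $i$-eigenbundle $L\subset E_{\mathbb{C}}$ is isotropic of complex rank $n$ and which vanishes on $(L\oplus\bar L)^\perp$; it is a $B_n$-generalized complex structure if $\Gamma(L)$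 is closed under the Dorfman bracket. A $B_n$-generalized almost pseudo-Hermitian structure is a pair $(\mathcal{G},\mathcal{F})$ as above with $\mathcal{G}^{\mathrm{end}}\mathcal{F}=\mathcal{F}\mathcal{G}^{\mathrm{end}}$; it is $B_n$-generalized pseudo-Kähler if $\mathcal{F}$ and $\mathcal{G}^{\mathrm{end}}\mathcal{F}$ are $B_n$-generalized complex structures. Let $(\mathcal{G},\mathcal{F})$ be a $B_n$-generalized almost pseudo-Hermitian structure on $E$ with $\mathcal{G}$ in the standard form $E_-=\{X-i_Xg\mid X\in TM\}$, where $g$ is a pseudo-Riemannian metric, and let $(g,J_+,J_-,X_+,X_-,c_+)$ be its components: for $X\in TM$, $J_-X$ and $J_+X$ are the $TM$-parts of $\mathcal{F}(X-i_Xg)$ and $\mathcal{F}(X+i_Xg)$, $X_-$ is the $TM$-part of $\mathcal{F}(1)$, and $X_+\in\mathfrak{X}(M)$, $c_+\in C^\infty(M)$ are such that $X_++i_{X_+}g+c_+$ is a section of $\mathrm{Ker}\,\mathcal{F}$ of norm $\langle\cdot,\cdot\rangle=1$. Assume that $X_+$ and $X_-$ are non-null at every point (equivalently, $c_+(p)^2\neq1$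 for all $p\in M$). Let $\nabla$ be the Levi-Civita connection of $g$. Denote by $F(X)$ and $H(X,Y)$ the vectors $g$-dual to $i_XF$ and $H(X,Y,\cdot)$ (similarly, $(i_ZH)(X)=H(Z,X)$), by $H(X)$ the endomorphism $Y\mapsto H(X,Y)$, by $A\otimes B$ the endomorphism $Y\mapsto g(A,Y)B$, and by $T^{(1,0)}_JM\subset T_{\mathbb{C}}M$ the $i$-eigenbundle of $J\in\Gamma(\mathrm{End}\,TM)$. Define $$D^-_X=\nabla_X+\tfrac12H(X),\qquad D^+_X=\nabla_X-\tfrac12H(X)+\frac{c_+}{1-c_+^2}F(X)\otimes X_+-\frac{1}{1-c_+^2}\,J_+F(X)\otimes X_-.$$ Then $(\mathcal{G},\mathcal{F})$ is $B_n$-generalized pseudo-Kähler if and only if the following conditions (i), (ii) and (iii) all hold: (i) $D^+$ preserves $T^{(1,0)}_{J_+}M$, $D^-$ preserves $T^{(1,0)}_{J_-}M$, $[X_+,X_-]=0$, and for all $X\in\mathfrak{X}(M)$ $$\nabla_XX_+=-\tfrac12(i_{X_+}H)(X)+c_+F(X),\qquad \nabla_XX_-=-\tfrac12(i_{X_-}H)(X)-J_+F(X);$$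 (ii) $F|_{\Lambda^2T^{(1,0)}_{J_-}M}=0$, $H|_{\Lambda^3T^{(1,0)}_{J_+}M}=0$, $H|_{\Lambda^3T^{(1,0)}_{J_-}M}=0$, $(i_{X_++ic_+X_-}H)|_{\Lambda^2T^{(1,0)}_{J_+}M}=0$, and $F|_{\Lambda^2T^{(1,0)}_{J_+}M}=-i\,(i_{X_-}H)|_{\Lambda^2T^{(1,0)}_{J_+}M}$; (iii) $dc_+=i_{X_+}F$. -/

import Mathlib

open scoped Manifold ContDiff

namespace BnGeometry

noncomputable section

set_option linter.unusedSectionVars false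

/-! ### Complexification of a real vector space and complex multilinear extension -/

/-- The complexification `V ⊕ i V` of a real vector space; `(a, b)` stands for `a + i b`. -/
def Cx (V : Type*) : Type _ := V × V

namespace Cx

variable {V W : Type*} [AddCommGroup V] [Module ℝ V] [AddCommGroup W] [Module ℝ W]

/-- The vector `a + i b`. -/
def mk (a b : V) : Cx V := (a, b)

/-- The real part of `a + i b`. -/
def re (z : Cx V) : V := z.1

/-- The imaginary part of `a + i b`. -/
def im (z : Cx V) : V := z.2

@[ext] theorem ext {z w : Cx V} (h₁ : z.re = w.re) (h₂ : z.im = w.im) : z = w :=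
  Prod.ext h₁ h₂

instance : AddCommGroup (Cx V) := inferInstanceAs (AddCommGroup (V × V))

instance : SMul ℂ (Cx V) :=
  ⟨fun s z => mk (s.re • z.re - s.im • z.im) (s.re • z.im + s.im • z.re)⟩

@[simp] theorem re_mk (a b : V) : (mk a b).re = a := rfl
@[simp] theorem im_mk (a b : V) : (mk a b).im = b := rfl
@[simp] theorem re_add (z w : Cx V) : (z + w).re = z.re + w.re := rfl
@[simp] theorem im_add (z w : Cx V) : (z + w).im = z.im + w.im := rfl
@[simp] theorem re_zero : (0 : Cx V).re = 0 := rfl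
@[simp] theorem im_zero : (0 : Cx V).im = 0 := rfl
@[simp] theorem re_smul (s : ℂ) (z : Cx V) : (s • z).re = s.re • z.re - s.im • z.im := rfl
@[simp] theorem im_smul (s : ℂ) (z : Cx V) : (s • z).im = s.re • z.im + s.im • z.re := rfl

instance : Module ℂ (Cx V) where
  one_smul z := by ext <;> simp
  mul_smul s t z := by ext <;> simp <;> module
  smul_zero s := by ext <;> simp
  smul_add s z w := by ext <;> simp <;> module
  add_smul s t z := by ext <;> simp <;> module
  zero_smul z := by ext <;> simp

/-- A real vector, seen in the complexification. -/
def ofReal (a : V) : Cx V := mk a 0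

/-- Complex conjugation `a + i b ↦ a - i b`. -/
def conj (z : Cx V) : Cx V := mk z.re (-z.im)

/-- The complex linear extension of a real linear map. -/
def map (f : V →ₗ[ℝ] W) : Cx V →ₗ[ℂ] Cx W where
  toFun z := mk (f z.re) (f z.im)
  map_add' z w := by ext <;> simp
  map_smul' s z := by ext <;> simp

/-- The `i`-eigenspace, in the complexification, of a real endomorphism. -/
def iEigenspace (f : V →ₗ[ℝ] V) : Submodule ℂ (Cx V) :=
  Module.End.eigenspace (map f) Complex.I

/-- The value at `z = a + i b` of the complex linear extension `f a + i f b` of a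
real linear function `f` with complex values. -/
def extend (f : V → ℂ) (z : Cx V) : ℂ := f z.re + Complex.I * f z.im

/-- The complex bilinear extension of a real bilinear form. -/
def bilin (B : V →ₗ[ℝ] V →ₗ[ℝ] ℝ) (z w : Cx V) : ℂ :=
  extend (fun a => extend (fun b => (B a b : ℂ)) w) z

/-- The complex trilinear extension of a real trilinear form. -/
def trilin (T : V →ₗ[ℝ] V →ₗ[ℝ] V →ₗ[ℝ] ℝ) (z w t : Cx V) : ℂ :=
  extend (fun a => extend (fun b => extend (fun c => (T a b c : ℂ)) t) w) z

end Cx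

/-! ### Tensor fields on a manifold -/

variable (E : Type*) [NormedAddCommGroup E] [NormedSpace ℝ E]
  (M : Type*) [TopologicalSpace M] [ChartedSpace E M]

/-- The tangent space of `M` at `x`. -/
abbrev Tan {M : Type*} [TopologicalSpace M] [ChartedSpace E M] (x : M) : Type _ :=
  TangentSpace 𝓘(ℝ, E) x

instance [FiniteDimensional ℝ E] (x : M) : FiniteDimensional ℝ (TangentSpace 𝓘(ℝ, E) x) :=
  inferInstanceAs (FiniteDimensional ℝ E)

instance (x : M) : T2Space (TangentSpace 𝓘(ℝ, E) x) :=
  inferInstanceAs (T2Space E)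

/-- Smooth functions on `M`. -/
abbrev SmoothFun := ContMDiffMap 𝓘(ℝ, E) 𝓘(ℝ, ℝ) M ℝ ∞

variable [IsManifold 𝓘(ℝ, E) ∞ M]

/-- Smooth vector fields on `M`. -/
abbrev VField :=
  ContMDiffSection 𝓘(ℝ, E) E ∞ (fun x : M => TangentSpace 𝓘(ℝ, E) x)

/-- Smooth one-forms on `M`. -/
abbrev OneForm :=
  ContMDiffSection 𝓘(ℝ, E) (E →L[ℝ] ℝ) ∞ (fun x : M => TangentSpace 𝓘(ℝ, E) x →L[ℝ] ℝ)

/-- Smooth endomorphism fields of `TM`. -/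
abbrev EndField :=
  ContMDiffSection 𝓘(ℝ, E) (E →L[ℝ] E) ∞
    (fun x : M => TangentSpace 𝓘(ℝ, E) x →L[ℝ] TangentSpace 𝓘(ℝ, E) x)

/-- Smooth two-forms on `M`. -/
structure TwoForm where
  /-- The alternating bilinear form at each point. -/
  toFun : Π x : M, Tan E x →ₗ[ℝ] Tan E x →ₗ[ℝ] ℝ
  alternating : ∀ x v, toFun x v v = 0
  smooth : ∀ X Y : VField E M, ContMDiff 𝓘(ℝ, E) 𝓘(ℝ, ℝ) ∞ fun x => toFun x (X x) (Y x)

/-- Smooth three-forms on `M`. -/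
structure ThreeForm where
  /-- The alternating trilinear form at each point. -/
  toFun : Π x : M, Tan E x →ₗ[ℝ] Tan E x →ₗ[ℝ] Tan E x →ₗ[ℝ] ℝ
  alternating_left : ∀ x v w, toFun x v v w = 0
  alternating_right : ∀ x v w, toFun x v w w = 0
  smooth : ∀ X Y Z : VField E M,
    ContMDiff 𝓘(ℝ, E) 𝓘(ℝ, ℝ) ∞ fun x => toFun x (X x) (Y x) (Z x)

/-- Pseudo-Riemannian metrics on `M`, of arbitrary signature. -/
structure PseudoRiemMetric where
  /-- The metric as a smooth section of `T*M ⊗ T*M`. -/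
  toSection : ContMDiffSection 𝓘(ℝ, E) (E →L[ℝ] E →L[ℝ] ℝ) ∞
    (fun x : M => TangentSpace 𝓘(ℝ, E) x →L[ℝ] TangentSpace 𝓘(ℝ, E) x →L[ℝ] ℝ)
  symm : ∀ x v w, toSection x v w = toSection x w v
  nondegenerate : ∀ x v, (∀ w, toSection x v w = 0) → v = 0

variable {E M}

instance : CoeFun (TwoForm E M)
    (fun _ => Π x : M, Tan E x →ₗ[ℝ] Tan E x →ₗ[ℝ] ℝ) := ⟨TwoForm.toFun⟩

instance : CoeFun (ThreeForm E M)
    (fun _ => Π x : M, Tan E x →ₗ[ℝ] Tan E x →ₗ[ℝ] Tan E x →ₗ[ℝ] ℝ) := ⟨ThreeForm.toFun⟩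

instance : CoeFun (PseudoRiemMetric E M)
    (fun _ => Π x : M, Tan E x →L[ℝ] Tan E x →L[ℝ] ℝ) := ⟨fun g => g.toSection⟩

/-- The directional derivative `v(f)` of a real function. -/
def dirDeriv (f : M → ℝ) (x : M) (v : Tan E x) : ℝ := mvfderiv 𝓘(ℝ, E) f x v

/-- The Lie bracket of vector fields. -/
def lieB (X Y : Π x : M, Tan E x) (x : M) : Tan E x := VectorField.mlieBracket 𝓘(ℝ, E) X Y x

/-- `dF(X, Y, Z)`, by the invariant formula. -/
def TwoForm.d (F : TwoForm E M) (X Y Z : VField E M) (x : M) : ℝ :=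
  dirDeriv (fun y => F y (Y y) (Z y)) x (X x)
  - dirDeriv (fun y => F y (X y) (Z y)) x (Y x)
  + dirDeriv (fun y => F y (X y) (Y y)) x (Z x)
  - F x (lieB X Y x) (Z x) + F x (lieB X Z x) (Y x) - F x (lieB Y Z x) (X x)

/-- `dH(X, Y, Z, W)`, by the invariant formula. -/
def ThreeForm.d (H : ThreeForm E M) (X Y Z W : VField E M) (x : M) : ℝ :=
  dirDeriv (fun y => H y (Y y) (Z y) (W y)) x (X x)
  - dirDeriv (fun y => H y (X y) (Z y) (W y)) x (Y x)
  + dirDeriv (fun y => H y (X y) (Y y) (W y)) x (Z x)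
  - dirDeriv (fun y => H y (X y) (Y y) (Z y)) x (W x)
  - H x (lieB X Y x) (Z x) (W x) + H x (lieB X Z x) (Y x) (W x)
  - H x (lieB X W x) (Y x) (Z x) - H x (lieB Y Z x) (X x) (W x)
  + H x (lieB Y W x) (X x) (Z x) - H x (lieB Z W x) (X x) (Y x)

/-- `(F ∧ F)(X, Y, Z, W)`. -/
def TwoForm.wedgeSq (F : TwoForm E M) (X Y Z W : VField E M) (x : M) : ℝ :=
  2 * (F x (X x) (Y x) * F x (Z x) (W x) - F x (X x) (Z x) * F x (Y x) (W x)
    + F x (X x) (W x) * F x (Y x) (Z x))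

/-- The conditions `dF = 0`, `dH = - F ∧ F` on the twisting forms `(H, F)` of a Courant algebroid
of type `B_n`. -/
structure IsTwist (H : ThreeForm E M) (F : TwoForm E M) : Prop where
  closed : ∀ (X Y Z : VField E M) (x : M), F.d X Y Z x = 0
  d_eq : ∀ (X Y Z W : VField E M) (x : M), H.d X Y Z W x = - F.wedgeSq X Y Z W x

theorem mdifferentiableAt_oneForm_apply (ξ : OneForm E M) {X : Π x : M, TangentSpace 𝓘(ℝ, E) x}
    {x : M} (hX : MDiffAt (T% X) x) : MDiffAt (fun y => ξ y (X y)) x := by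
  have h := (ξ.contMDiff x).mdifferentiableAt (by simp)
  have h' := MDifferentiableAt.clm_bundle_apply (F₂ := ℝ) (E₂ := Bundle.Trivial M ℝ) h hX
  rw [mdifferentiableAt_totalSpace] at h'
  exact h'.2

theorem mdifferentiableAt_vField (X : VField E M) (x : M) :
    MDiffAt (T% (fun y => X y)) x :=
  (X.contMDiff x).mdifferentiableAt (by simp)

/-- The expression `X(η(W)) - η([X, W])`. -/
def lieDerivAux (X : VField E M) (η : OneForm E M) (x : M) (W : Π x : M, Tan E x) : ℝ :=
  dirDeriv (fun y => η y (W y)) x (X x) - η x (lieB X W x)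

/-- The expression `V(ξ(W)) - W(ξ(V)) - ξ([V, W])`. -/
def extDerivAux (ξ : OneForm E M) (x : M) (V W : Π x : M, Tan E x) : ℝ :=
  dirDeriv (fun y => ξ y (W y)) x (V x) - dirDeriv (fun y => ξ y (V y)) x (W x)
    - ξ x (lieB V W x)

section Tensoriality

variable [FiniteDimensional ℝ E]

theorem lieDerivAux_tensorial (X : VField E M) (η : OneForm E M) (x : M) :
    TensorialAt 𝓘(ℝ, E) E (lieDerivAux X η x) x := by
  have : CompleteSpace E := FiniteDimensional.complete ℝ E
  constructor
  · intro f W hf hW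
    have h₁ : (fun y => η y ((f • W) y)) = f * fun y => η y (W y) := by
      funext y; simp
    simp only [lieDerivAux, lieB, dirDeriv, h₁, mvfderiv_mul hf (mdifferentiableAt_oneForm_apply η hW),
      VectorField.mlieBracket_smul_right hf hW]
    simp
    ring
  · intro V W hV hW
    have h₁ : (fun y => η y ((V + W) y)) = (fun y => η y (V y)) + fun y => η y (W y) := by
      funext y; simp
    simp only [lieDerivAux, lieB, dirDeriv, h₁, mvfderiv_add
      (mdifferentiableAt_oneForm_apply η hV) (mdifferentiableAt_oneForm_apply η hW),
      VectorField.mlieBracket_add_right hV hW]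
    simp
    ring

theorem extDerivAux_tensorial_right (ξ : OneForm E M) (x : M)
    (V : Π x : M, TangentSpace 𝓘(ℝ, E) x) :
    TensorialAt 𝓘(ℝ, E) E (fun W => extDerivAux ξ x V W) x := by
  have : CompleteSpace E := FiniteDimensional.complete ℝ E
  constructor
  · intro f W hf hW
    have h₁ : (fun y => ξ y ((f • W) y)) = f * fun y => ξ y (W y) := by
      funext y; simp
    simp only [extDerivAux, lieB, dirDeriv, h₁, mvfderiv_mul hf (mdifferentiableAt_oneForm_apply ξ hW),
      VectorField.mlieBracket_smul_right hf hW]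
    simp
    ring
  · intro W W' hW hW'
    have h₁ : (fun y => ξ y ((W + W') y)) = (fun y => ξ y (W y)) + fun y => ξ y (W' y) := by
      funext y; simp
    simp only [extDerivAux, lieB, dirDeriv, h₁, mvfderiv_add
      (mdifferentiableAt_oneForm_apply ξ hW) (mdifferentiableAt_oneForm_apply ξ hW'),
      VectorField.mlieBracket_add_right hW hW']
    simp
    ring

theorem extDerivAux_swap (ξ : OneForm E M) (x : M) (V W : Π x : M, TangentSpace 𝓘(ℝ, E) x) :
    extDerivAux ξ x V W = - extDerivAux ξ x W V := by
  simp only [extDerivAux, lieB]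
  rw [VectorField.mlieBracket_swap_apply (V := V), map_neg]
  ring

theorem extDerivAux_tensorial_left (ξ : OneForm E M) (x : M)
    (W : Π x : M, TangentSpace 𝓘(ℝ, E) x) :
    TensorialAt 𝓘(ℝ, E) E (fun V => extDerivAux ξ x V W) x := by
  have h := extDerivAux_tensorial_right ξ x W
  simp only [extDerivAux_swap ξ x _ W]
  exact ⟨fun hf hV => by simp [h.smul hf hV], fun hV hV' => by rw [h.add hV hV']; ring⟩

/-- The Lie derivative `L_X η` of a one-form: `(L_X η)(W) = X(η(W)) - η([X, W])`. -/
def lieDeriv (X : VField E M) (η : OneForm E M) (x : M) : Tan E x →L[ℝ] ℝ :=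
  TensorialAt.mkHom (lieDerivAux X η x) x (lieDerivAux_tensorial X η x)

/-- The exterior derivative of a one-form: `dξ(V, W) = V(ξ(W)) - W(ξ(V)) - ξ([V, W])`. -/
def extDeriv (ξ : OneForm E M) (x : M) : Tan E x →L[ℝ] Tan E x →L[ℝ] ℝ :=
  TensorialAt.mkHom₂ (extDerivAux ξ x) x
    (fun W _ => extDerivAux_tensorial_left ξ x W) (fun V _ => extDerivAux_tensorial_right ξ x V)

end Tensoriality

/-! ### Courant algebroids of type `B_n` -/

variable (E) in
/-- The fibre of `TM ⊕ T*M ⊕ ℝ` at `x`. -/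
abbrev Fib {M : Type*} [TopologicalSpace M] [ChartedSpace E M] (x : M) : Type _ :=
  Tan E x × (Tan E x →L[ℝ] ℝ) × ℝ

variable (E M) in
/-- Smooth sections `X + ξ + λ` of `TM ⊕ T*M ⊕ ℝ`. -/
structure Sec where
  /-- The vector field `X`. -/
  vec : VField E M
  /-- The one-form `ξ`. -/
  form : OneForm E M
  /-- The function `λ`. -/
  fn : SmoothFun E M

/-- The value of a section at a point. -/
def Sec.val (u : Sec E M) (x : M) : Fib E x := (u.vec x, u.form x, u.fn x)

instance : CoeFun (Sec E M) (fun _ => Π x : M, Fib E x) := ⟨Sec.val⟩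

/-- The scalar product `⟨X + ξ + λ, Y + η + μ⟩ = (η(X) + ξ(Y)) / 2 + λ μ`. -/
def scalarProd (x : M) : LinearMap.BilinForm ℝ (Fib E x) :=
  LinearMap.mk₂ ℝ (fun u v => (1 / 2 : ℝ) * (v.2.1 u.1 + u.2.1 v.1) + u.2.2 * v.2.2)
    (by intro a b c; simp; ring) (by intro a b c; simp; ring)
    (by intro a b c; simp; ring) (by intro a b c; simp; ring)

section FiniteDim

variable [FiniteDimensional ℝ E]

/-- The Dorfman bracket twisted by `(H, F)`:
`[X + ξ + λ, Y + η + μ] = L_X Y + L_X η - i_Y dξ + 2 μ dλ + i_X i_Y H - 2 (μ i_X F - λ i_Y F)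
  + X(μ) - Y(λ) + F(X, Y)`. -/
def dorfman (H : ThreeForm E M) (F : TwoForm E M) (u v : Sec E M) (x : M) : Fib E x :=
  (lieB u.vec v.vec x,
   lieDeriv u.vec v.form x - extDeriv u.form x (v.vec x)
     + (2 * v.fn x) • mvfderiv 𝓘(ℝ, E) u.fn x
     + (H x (v.vec x) (u.vec x)).toContinuousLinearMap
     - (2 : ℝ) • (v.fn x • (F x (u.vec x)).toContinuousLinearMap
         - u.fn x • (F x (v.vec x)).toContinuousLinearMap),
   dirDeriv v.fn x (u.vec x) - dirDeriv u.fn x (v.vec x) + F x (u.vec x) (v.vec x))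

variable (E M) in
/-- Smooth sections `u + i v` of the complexification of `TM ⊕ T*M ⊕ ℝ`. -/
structure CSec where
  /-- The real part. -/
  re : Sec E M
  /-- The imaginary part. -/
  im : Sec E M

/-- The value of a complex section at a point. -/
def CSec.val (z : CSec E M) (x : M) : Cx (Fib E x) := Cx.mk (z.re x) (z.im x)

/-- The complex bilinear extension of the Dorfman bracket. -/
def dorfmanC (H : ThreeForm E M) (F : TwoForm E M) (z w : CSec E M) (x : M) :
    Cx (Fib E x) :=
  Cx.mk (dorfman H F z.re w.re x - dorfman H F z.im w.im x)
    (dorfman H F z.re w.im x + dorfman H F z.im w.re x)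

/-- Smoothness of a field `A` of endomorphisms of `TM ⊕ T*M ⊕ ℝ`: it maps smooth sections to
smooth sections. -/
def IsSmoothEnd (A : Π x : M, Fib E x →ₗ[ℝ] Fib E x) : Prop :=
  ∀ u : Sec E M, ∃ v : Sec E M, ∀ x, v x = A x (u x)

/-! ### Generalized metrics and generalized complex structures -/

variable (E M) in
/-- (Admissible) generalized metrics: smooth subbundles `E₋` of rank `n = dim M` on which the
scalar product is non-degenerate and the anchor `E₋ → TM` is an isomorphism. -/
structure GenMetric where
  /-- The fibre of `E₋` at each point. -/
  Eminus : Π x : M, Submodule ℝ (Fib E x)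
  rank : ∀ x, Module.finrank ℝ (Eminus x) = Module.finrank ℝ E
  smooth : ∀ x, ∀ e ∈ Eminus x, ∃ s : Sec E M, s x = e ∧ ∀ y, s y ∈ Eminus y
  nondegenerate : ∀ x, ∀ e ∈ Eminus x, (∀ e' ∈ Eminus x, scalarProd x e e' = 0) → e = 0
  admissible : ∀ x, Function.Bijective (fun e : Eminus x => (e : Fib E x).1)

/-- The bundle `E₊`, orthogonal to `E₋`. -/
def GenMetric.Eplus (G : GenMetric E M) (x : M) : Submodule ℝ (Fib E x) :=
  (scalarProd x).orthogonal (G.Eminus x)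

theorem GenMetric.isCompl (G : GenMetric E M) (x : M) : IsCompl (G.Eplus x) (G.Eminus x) := by
  have hs : ∀ u v : Fib E x, scalarProd x u v = scalarProd x v u := by
    intro u v; simp [scalarProd]; ring
  have hrefl : (scalarProd (E := E) x).IsRefl := fun u v h => by rw [hs, h]
  refine (((scalarProd x).isCompl_orthogonal_iff_disjoint hrefl).2 ?_).symm
  rw [Submodule.disjoint_def]
  intro e he he'
  exact G.nondegenerate x e he fun e' h => by rw [hs]; exact he' e' h

/-- The endomorphism `G^end`, equal to `Id` on `E₊` and to `-Id` on `E₋`. -/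
def GenMetric.Gend (G : GenMetric E M) (x : M) : Fib E x →ₗ[ℝ] Fib E x :=
  Submodule.projection _ _ (G.isCompl x) - Submodule.projection _ _ (G.isCompl x).symm

/-- The fibre at `x` of the `i`-eigenbundle `L` of `𝓕`. -/
def Lbundle (𝓕 : Π x : M, Fib E x →ₗ[ℝ] Fib E x) (x : M) :
    Submodule ℂ (Cx (Fib E x)) :=
  Cx.iEigenspace (𝓕 x)

/-- `B_n`-generalized almost complex structures, as endomorphisms `𝓕`: the `i`-eigenbundle `L`
is isotropic of complex rank `n` (and then the `(-i)`-eigenbundle is the conjugate of `L`, so that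
`L` and its conjugate meet in zero), and `𝓕` vanishes on the orthogonal complement of
the sum of `L` and its conjugate. -/
structure IsGenAlmostComplex (𝓕 : Π x : M, Fib E x →ₗ[ℝ] Fib E x) : Prop where
  smooth : IsSmoothEnd 𝓕
  rank : ∀ x, Module.finrank ℂ (Lbundle 𝓕 x) = Module.finrank ℝ E
  isotropic : ∀ x, ∀ z ∈ Lbundle 𝓕 x, ∀ w ∈ Lbundle 𝓕 x, Cx.bilin (scalarProd x) z w = 0
  ker : ∀ x, ∀ u : Fib E x,
    (∀ z ∈ Lbundle 𝓕 x, Cx.bilin (scalarProd x) (Cx.ofReal u) z = 0 ∧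
      Cx.bilin (scalarProd x) (Cx.ofReal u) z.conj = 0) → 𝓕 x u = 0

/-- `B_n`-generalized complex structures: the sections of `L` are closed under the
Dorfman bracket. -/
structure IsGenComplex (H : ThreeForm E M) (F : TwoForm E M)
    (𝓕 : Π x : M, Fib E x →ₗ[ℝ] Fib E x) : Prop extends IsGenAlmostComplex 𝓕 where
  integrable : ∀ z w : CSec E M, (∀ x, z.val x ∈ Lbundle 𝓕 x) → (∀ x, w.val x ∈ Lbundle 𝓕 x) →
    ∀ x, dorfmanC H F z w x ∈ Lbundle 𝓕 x

/-- `B_n`-generalized almost pseudo-Hermitian structures `(G, 𝓕)`. -/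
structure IsGenAlmostPseudoHermitian (G : GenMetric E M)
    (𝓕 : Π x : M, Fib E x →ₗ[ℝ] Fib E x) : Prop where
  almostComplex : IsGenAlmostComplex 𝓕
  commute : ∀ x, G.Gend x ∘ₗ 𝓕 x = 𝓕 x ∘ₗ G.Gend x

/-- `B_n`-generalized pseudo-Kähler structures `(G, 𝓕)`: both `𝓕` and `G^end 𝓕` are
`B_n`-generalized complex structures. -/
structure IsGenPseudoKahler (H : ThreeForm E M) (F : TwoForm E M) (G : GenMetric E M)
    (𝓕 : Π x : M, Fib E x →ₗ[ℝ] Fib E x) : Prop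
    extends IsGenAlmostPseudoHermitian G 𝓕 where
  first : IsGenComplex H F 𝓕
  second : IsGenComplex H F (fun x => G.Gend x ∘ₗ 𝓕 x)

/-- `(g, J₊, J₋, X₊, X₋, c₊)` are the components of the `B_n`-generalized almost pseudo-Hermitian
structure `(G, 𝓕)` (`n` even, `G` in the standard form): `E₋ = {X - gX}`,
`J₋` and `J₊` are `𝓕` on `E₋ ≅ TM`, respectively the `TM`-block of `𝓕` on
`E₊ = {X + gX + a} ≅ TM ⊕ ℝ`, `X₋` is the vector part of `𝓕 1`, and `X₊ + gX₊ + c₊` is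
a generator of the kernel of `𝓕` of norm one. -/
structure IsComponents (G : GenMetric E M) (𝓕 : Π x : M, Fib E x →ₗ[ℝ] Fib E x)
    (g : PseudoRiemMetric E M) (Jp Jm : EndField E M) (Xp Xm : VField E M) (c : SmoothFun E M) :
    Prop where
  standard : ∀ x, ∀ u : Fib E x, u ∈ G.Eminus x ↔ ∃ v : Tan E x, u = (v, - g x v, 0)
  Jminus : ∀ x, ∀ v : Tan E x, (𝓕 x (v, - g x v, 0)).1 = Jm x v
  Jplus : ∀ x, ∀ v : Tan E x, (𝓕 x (v, g x v, 0)).1 = Jp x v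
  Xminus : ∀ x, (𝓕 x (0, 0, 1)).1 = Xm x
  kernel : ∀ x, 𝓕 x (Xp x, g x (Xp x), c x) = 0
  norm_one : ∀ x, scalarProd x (Xp x, g x (Xp x), c x) (Xp x, g x (Xp x), c x) = 1

/-! ### Identifications by the metric, and connections -/

/-- The isomorphism `TM → T*M` given by the metric. -/
def PseudoRiemMetric.flat (g : PseudoRiemMetric E M) (x : M) : Tan E x ≃ₗ[ℝ] (Tan E x →ₗ[ℝ] ℝ) :=
  LinearMap.linearEquivOfInjective
    (LinearMap.mk₂ ℝ (fun v w => g x v w) (by simp) (by simp) (by simp) (by simp))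
    (by
      rw [injective_iff_map_eq_zero]
      intro v hv
      exact g.nondegenerate x v fun w => by simpa using LinearMap.congr_fun hv w)
    Subspace.dual_finrank_eq.symm

/-- The vector metrically dual to a covector. -/
def PseudoRiemMetric.sharp (g : PseudoRiemMetric E M) (x : M) (α : Tan E x →ₗ[ℝ] ℝ) : Tan E x :=
  (g.flat x).symm α

/-- `F(v)`, the vector metrically dual to `i_v F`. -/
def TwoForm.vec (F : TwoForm E M) (g : PseudoRiemMetric E M) (x : M) (v : Tan E x) : Tan E x :=
  g.sharp x (F x v)

/-- `H(v, w)`, the vector metrically dual to `i_w i_v H = H(v, w, ·)`. -/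
def ThreeForm.vec (H : ThreeForm E M) (g : PseudoRiemMetric E M) (x : M) (v w : Tan E x) : Tan E x :=
  g.sharp x (H x v w)

variable (E M) in
/-- Connections on `TM`; `D Y x v` stands for `D_v Y` at the point `x`. -/
abbrev Conn := CovariantDerivative 𝓘(ℝ, E) E (fun x : M => TangentSpace 𝓘(ℝ, E) x)

/-- `D` is the Levi-Civita connection of `g`: it is torsion-free and metric. -/
structure IsLeviCivita (g : PseudoRiemMetric E M) (D : Conn E M) : Prop where
  torsion_free : ∀ (X Y : Π x : M, TangentSpace 𝓘(ℝ, E) x) (x : M), MDiffAt (T% X) x → MDiffAt (T% Y) x →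
    D Y x (X x) - D X x (Y x) = lieB X Y x
  metric : ∀ (Y Z : Π x : M, TangentSpace 𝓘(ℝ, E) x) (x : M) (v : Tan E x),
    MDiffAt (T% Y) x → MDiffAt (T% Z) x →
    dirDeriv (fun y => g y (Y y) (Z y)) x v = g x (D Y x v) (Z x) + g x (Y x) (D Z x v)

/-- `D⁻_v = ∇_v + H(v) / 2`. -/
def Dminus (H : ThreeForm E M) (g : PseudoRiemMetric E M) (D : Conn E M)
    (Y : Π x : M, Tan E x) (x : M) (v : Tan E x) : Tan E x :=
  D Y x v + (1 / 2 : ℝ) • H.vec g x v (Y x)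

/-- `D⁺_v = ∇_v - H(v) / 2 + c₊ / (1 - c₊²) F(v) ⊗ X₊ - 1 / (1 - c₊²) J₊F(v) ⊗ X₋`, where `A ⊗ B`
is the endomorphism `Y ↦ g(A, Y) B`. -/
def Dplus (H : ThreeForm E M) (F : TwoForm E M) (g : PseudoRiemMetric E M) (Jp : EndField E M)
    (Xp Xm : VField E M) (c : SmoothFun E M) (D : Conn E M)
    (Y : Π x : M, Tan E x) (x : M) (v : Tan E x) : Tan E x :=
  D Y x v - (1 / 2 : ℝ) • H.vec g x v (Y x)
    + (c x / (1 - c x ^ 2) * g x (F.vec g x v) (Y x)) • Xp x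
    - (1 / (1 - c x ^ 2) * g x (Jp x (F.vec g x v)) (Y x)) • Xm x

/-- The fibre at `x` of the `i`-eigenbundle `T^{(1,0)}_J M` of `J`. -/
def T10 (J : EndField E M) (x : M) : Submodule ℂ (Cx (Tan E x)) :=
  Cx.iEigenspace (J x : Tan E x →ₗ[ℝ] Tan E x)

/-- A differentiation of vector fields `D` (extended complex linearly) preserves `T^{(1,0)}_J M`:
`D_v (A + i B) = D_v A + i D_v B` lies in `T^{(1,0)}_J M` for all its smooth
sections `A + i B` and all `v`. -/
def PreservesT10 (D : (Π x : M, Tan E x) → Π x : M, Tan E x → Tan E x) (J : EndField E M) : Prop :=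
  ∀ A B : VField E M, (∀ x, Cx.mk (A x) (B x) ∈ T10 J x) →
    ∀ (x : M) (v : Tan E x), Cx.mk (D A x v) (D B x v) ∈ T10 J x

end FiniteDim

end

end BnGeometry

open BnGeometry

open scoped Manifold ContDiff

set_option linter.unusedSectionVars false

/-! ### Smooth tensor operations and metric duality. -/

namespace BnGeometry

noncomputable section

variable {E : Type*} [NormedAddCommGroup E] [NormedSpace ℝ E]
  {M : Type*} [TopologicalSpace M] [ChartedSpace E M] [IsManifold 𝓘(ℝ, E) ∞ M]

/-! The metric splits the Courant algebroid as E₊ ⊕ E₋, with E₊ ≅ TM ⊕ ℝ through P + gP + a and E₋ ≅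
TM through N - gN. Since 𝓕 commutes with G^end, it consists of an endomorphism κ of E₊ (`kap`) and
of J₋ on E₋; G^end 𝓕 is the same with -J₋ in place of J₋. Linear algebra (`Cx.sq_eq_and_skew`) shows
that 𝓕 is skew with 𝓕² = -1 + ⟨·, u₀⟩ u₀, where u₀ = X₊ + gX₊ + c₊ spans Ker 𝓕, and this contains
every pointwise relation between the components (`IsComponents.isComponentsAt`).

The analytic core is `IsLeviCivita.scalarProd_dorfman`: ⟨[e₁, e₂], e₃⟩ equals ⟨∇₁e₂, e₃⟩ - ⟨∇₂e₁,
e₃⟩ + ⟨∇₃e₁, e₂⟩ plus a torsion term, for connections on E₊ and E₋ built from Levi-Civita, H and F.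
The torsion has only pure components, T = `plusTor` on E₊ and H on E₋, so mixed brackets are pure
derivatives. Integrability of both 𝓕 and G^end 𝓕 gives the mixed equations for both signs of J₋;
adding or subtracting them shows that κ on u₀^⊥ and J₋ are parallel. Once they are parallel, all
derivative terms cancel and only the vanishing of torsion types remains. This is `pseudoKahler_iff`.

The rest is a translation into components. Because 1 - c₊² ≠ 0, the complement of u₀ in E₊ is W ⊕ ℝV
⊕ ℝX₋, where W = X₊^⊥ ∩ X₋^⊥ is the kernel of J₊² + 1, V = 1 - c₊u₀ and κV = X₋. Parallelism on u₀
gives ∇X₊ and dc₊, on V it gives ∇X₋, on W it says that D⁺ preserves the (1,0) vectors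
(`plusParallel_iff`). Parallelism of J₋ gives D⁻ and the type of F (`minusParallel_iff`). The
torsion T evaluated on W, V and u₀ gives the conditions on H and F along J₊ and the equation [X₊,
X₋] = 0 (`plusType_eq_zero_iff`, `kahlerConditions_iff`). -/

/-- The product of a smooth function and a smooth vector field. -/
def smulField (f : SmoothFun E M) (X : VField E M) : VField E M :=
  ⟨fun x => f x • X x, f.contMDiff.smul_section X.contMDiff⟩

/-- The vector field `J X`. -/
def EndField.app (J : EndField E M) (X : VField E M) : VField E M :=
  ⟨fun x => J x (X x), J.contMDiff.clm_bundle_apply X.contMDiff⟩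

/-- The one-form `g(X, ·)`. -/
def PseudoRiemMetric.flatField (g : PseudoRiemMetric E M) (X : VField E M) : OneForm E M :=
  ⟨fun x => g x (X x), g.toSection.contMDiff.clm_bundle_apply X.contMDiff⟩

/-- The function `ξ(X)`. -/
def OneForm.app (ξ : OneForm E M) (X : VField E M) : SmoothFun E M :=
  ⟨fun x => ξ x (X x), by
    have h := ContMDiff.clm_bundle_apply (F₂ := ℝ) (E₂ := Bundle.Trivial M ℝ)
      ξ.contMDiff X.contMDiff
    intro x
    exact ((Bundle.contMDiffAt_totalSpace).1 (h x)).2⟩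

/-- The function `g(X, Y)`. -/
def PseudoRiemMetric.inner (g : PseudoRiemMetric E M) (X Y : VField E M) : SmoothFun E M :=
  (g.flatField X).app Y

@[simp] theorem smulField_apply (f : SmoothFun E M) (X : VField E M) (x : M) :
    smulField f X x = f x • X x := rfl

@[simp] theorem EndField.app_apply (J : EndField E M) (X : VField E M) (x : M) :
    J.app X x = J x (X x) := rfl

@[simp] theorem PseudoRiemMetric.flatField_apply (g : PseudoRiemMetric E M) (X : VField E M)
    (x : M) : g.flatField X x = g x (X x) := rfl

@[simp] theorem PseudoRiemMetric.inner_apply (g : PseudoRiemMetric E M) (X Y : VField E M)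
    (x : M) : g.inner X Y x = g x (X x) (Y x) := rfl

/-- A bump function supported in a trivialization cuts off the local extension of the vector. Tensor
identities can then be tested on global fields. -/
theorem exists_vField_apply_eq [FiniteDimensional ℝ E] [T2Space M] (x : M) (v : Tan E x) :
    ∃ X : VField E M, X x = v := by
  let e := trivializationAt E (TangentSpace 𝓘(ℝ, E) : M → Type _) x
  have hx : x ∈ e.baseSet := FiberBundle.mem_baseSet_trivializationAt' x
  obtain ⟨ψ, -, hψ⟩ := (SmoothBumpFunction.nhds_basis_tsupport (I := 𝓘(ℝ, E)) x).mem_iff.1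
    (e.open_baseSet.mem_nhds hx)
  have hs : ContMDiffOn 𝓘(ℝ, E) (𝓘(ℝ, E).prod 𝓘(ℝ, E)) ∞
      (fun y => Bundle.TotalSpace.mk' E y (FiberBundle.extend E v y)) e.baseSet := by
    have h := (e.contMDiffOn_symm (IB := 𝓘(ℝ, E)) (n := ∞)).comp
      (f := fun y => (y, (e ⟨x, v⟩).2)) (s := e.baseSet)
      (contMDiff_id.prodMk contMDiff_const).contMDiffOn
      (fun y hy => by simpa [e.mem_target] using hy)
    refine h.congr fun y hy => ?_
    exact e.mk_symm hy _
  refine ⟨⟨(ψ : M → ℝ) • FiberBundle.extend E v,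
    ContMDiffOn.smul_section_of_tsupport ψ.contMDiff.contMDiffOn e.open_baseSet hψ hs⟩, ?_⟩
  show ψ x • FiberBundle.extend E v x = v
  simp

/-- In a trivialization the dual field is A⁻¹β, with A the matrix of the metric, and inversion is
smooth at invertible maps. This is what allows every smooth section of TM ⊕ T*M ⊕ ℝ to be split
smoothly along E₊ ⊕ E₋. -/
theorem exists_sharp [FiniteDimensional ℝ E] (g : PseudoRiemMetric E M) (ξ : OneForm E M) :
    ∃ X : VField E M, ∀ x, g x (X x) = ξ x := by
  have hbij : ∀ x, ∃ v : Tan E x, g x v = ξ x := by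
    intro x
    refine ⟨g.sharp x (ξ x : Tan E x →ₗ[ℝ] ℝ), ?_⟩
    ext w
    exact LinearMap.congr_fun ((g.flat x).apply_symm_apply (ξ x : Tan E x →ₗ[ℝ] ℝ)) w
  choose X hX using hbij
  refine ⟨⟨X, fun x₀ => ?_⟩, hX⟩
  rw [Bundle.contMDiffAt_section]
  have h1 := ((contMDiffAt_hom_bundle _).1 (g.toSection.contMDiff x₀)).2
  have h2 := ((contMDiffAt_hom_bundle _).1 (ξ.contMDiff x₀)).2
  dsimp only at h1 h2
  set e := trivializationAt E (TangentSpace 𝓘(ℝ, E) : M → Type _) x₀ with he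
  set A : M → E →L[ℝ] E →L[ℝ] ℝ := fun y => ContinuousLinearMap.inCoordinates E
    (TangentSpace 𝓘(ℝ, E) : M → Type _) (E →L[ℝ] ℝ)
    (fun x : M => TangentSpace 𝓘(ℝ, E) x →L[ℝ] ℝ) x₀ y x₀ y (g.toSection y) with hA
  set β : M → E →L[ℝ] ℝ := fun y => ContinuousLinearMap.inCoordinates E
    (TangentSpace 𝓘(ℝ, E) : M → Type _) ℝ (Bundle.Trivial M ℝ) x₀ y x₀ y (ξ y) with hβ
  have hA' : ∀ y ∈ e.baseSet, ∀ v w, A y v w = g y (e.symm y v) (e.symm y w) := by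
    intro y hy v w
    have := inCoordinates_apply_eq₂ (F₃ := ℝ) (E₃ := Bundle.Trivial M ℝ)
      (ϕ := g.toSection y) (v := v) (w := w) hy hy (Set.mem_univ _ : y ∈ (trivializationAt ℝ (Bundle.Trivial M ℝ) x₀).baseSet)
    simpa using this
  have hβ' : ∀ y ∈ e.baseSet, ∀ w, β y w = ξ y (e.symm y w) := by
    intro y hy w
    simp only [hβ]
    rw [ContinuousLinearMap.inCoordinates_eq hy (Set.mem_univ _)]
    simp [he]
  have hA1 : ∀ y ∈ e.baseSet, (A y).IsInvertible := by
    intro y hy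
    have hinj : Function.Injective (A y) := by
      rw [injective_iff_map_eq_zero]
      intro v hv
      have : e.symm y v = 0 := by
        apply g.nondegenerate
        intro w
        have h3 := hA' y hy v (e ⟨y, w⟩).2
        rw [hv] at h3
        simpa [e.symm_apply_apply_mk hy] using h3.symm
      have h4 := e.apply_mk_symm hy v
      rw [this] at h4
      have h5 := (e.linear ℝ hy).map_zero
      rw [h4] at h5
      exact h5
    have hfin : Module.finrank ℝ E = Module.finrank ℝ (E →L[ℝ] ℝ) :=
      Subspace.dual_finrank_eq.symm.trans
        (LinearMap.toContinuousLinearMap (𝕜 := ℝ) (E := E) (F' := ℝ)).finrank_eq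
    exact ⟨(LinearMap.linearEquivOfInjective (A y : E →ₗ[ℝ] E →L[ℝ] ℝ) hinj
      hfin).toContinuousLinearEquiv, by ext; rfl⟩
  have hX' : (fun y => (e ⟨y, X y⟩).2) =ᶠ[nhds x₀] fun y => (A y).inverse (β y) := by
    filter_upwards [e.open_baseSet.mem_nhds (FiberBundle.mem_baseSet_trivializationAt' x₀)]
      with y hy
    have : A y (e ⟨y, X y⟩).2 = β y := by
      ext w
      rw [hA' y hy, hβ' y hy, e.symm_apply_apply_mk hy, hX]
    rw [← this, (hA1 y hy).inverse_apply_self]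
  refine ContMDiffAt.congr_of_eventuallyEq ?_ hX'
  have hx : x₀ ∈ e.baseSet := FiberBundle.mem_baseSet_trivializationAt' x₀
  refine ContMDiffAt.clm_apply ?_ h2
  exact ((hA1 x₀ hx).contDiffAt_map_inverse (n := ∞)).contMDiffAt.comp x₀ h1
end
end BnGeometry

/-! ### Linear algebra of the eigenspaces and the splitting of a fibre. -/

namespace BnGeometry

noncomputable section

namespace Cx

variable {V : Type*} [AddCommGroup V] [Module ℝ V]

theorem mem_iEigenspace {f : V →ₗ[ℝ] V} {z : Cx V} :
    z ∈ iEigenspace f ↔ f z.re = -z.im ∧ f z.im = z.re := by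
  rw [iEigenspace, Module.End.mem_eigenspace_iff, Cx.ext_iff]
  simp [map]

theorem mk_mem_iEigenspace {f : V →ₗ[ℝ] V} {a b : V} :
    mk a b ∈ iEigenspace f ↔ f a = -b ∧ f b = a := mem_iEigenspace

theorem bilin_mk (B : V →ₗ[ℝ] V →ₗ[ℝ] ℝ) (a b c d : V) :
    bilin B (mk a b) (mk c d) =
      ((B a c - B b d : ℝ) : ℂ) + Complex.I * ((B a d + B b c : ℝ) : ℂ) := by
  simp only [bilin, extend, re_mk, im_mk]
  push_cast
  linear_combination (B b d : ℂ) * Complex.I_sq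

theorem bilin_ofReal_left (B : V →ₗ[ℝ] V →ₗ[ℝ] ℝ) (u : V) (z : Cx V) :
    bilin B (ofReal u) z = ((B u z.re : ℝ) : ℂ) + Complex.I * ((B u z.im : ℝ) : ℂ) := by
  simp [bilin, extend, ofReal]

theorem ofReal_add_I_mul_eq_zero {a b : ℝ} : (a : ℂ) + Complex.I * (b : ℂ) = 0 ↔ a = 0 ∧ b = 0 := by
  rw [Complex.ext_iff]
  simp

/-- The kernel of `f² + 1`. -/
def sqNegOne (f : V →ₗ[ℝ] V) : Submodule ℝ V := LinearMap.ker (f ∘ₗ f + LinearMap.id)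

theorem mem_sqNegOne {f : V →ₗ[ℝ] V} {p : V} : p ∈ sqNegOne f ↔ f (f p) = -p := by
  simp [sqNegOne, LinearMap.mem_ker, add_eq_zero_iff_eq_neg]

theorem map_mem_sqNegOne {f : V →ₗ[ℝ] V} {p : V} (hp : p ∈ sqNegOne f) : f p ∈ sqNegOne f := by
  rw [mem_sqNegOne] at *
  rw [hp, map_neg]

theorem re_mem_sqNegOne {f : V →ₗ[ℝ] V} {z : Cx V} (hz : z ∈ iEigenspace f) :
    z.re ∈ sqNegOne f := by
  rw [mem_iEigenspace] at hz
  rw [mem_sqNegOne, hz.1, map_neg, hz.2]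

theorem im_mem_sqNegOne {f : V →ₗ[ℝ] V} {z : Cx V} (hz : z ∈ iEigenspace f) :
    z.im ∈ sqNegOne f := by
  rw [mem_iEigenspace] at hz
  rw [mem_sqNegOne, hz.2, hz.1]

theorem mk_neg_mem_iEigenspace {f : V →ₗ[ℝ] V} {p : V} (hp : p ∈ sqNegOne f) :
    mk p (-f p) ∈ iEigenspace f := by
  rw [mem_sqNegOne] at hp
  rw [mk_mem_iEigenspace, map_neg, hp]
  simp

/-- The map p ↦ p - i f(p) is a real isomorphism from the kernel of f² + 1 onto the i-eigenspace. -/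
theorem finrank_sqNegOne [FiniteDimensional ℝ V] (f : V →ₗ[ℝ] V) :
    Module.finrank ℝ (sqNegOne f) = 2 * Module.finrank ℂ (iEigenspace f) := by
  rw [← finrank_real_of_complex]
  let φ : sqNegOne f →ₗ[ℝ] iEigenspace f :=
    { toFun := fun p => ⟨mk p (-f p), mk_neg_mem_iEigenspace p.2⟩
      map_add' := fun p q => by
        apply Subtype.ext
        apply Cx.ext
        · simp
        · simp; abel
      map_smul' := fun r p => by
        apply Subtype.ext
        show (mk (r • (p : V)) (-f (r • (p : V))) : Cx V) = (r : ℂ) • mk (p : V) (-f p)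
        apply Cx.ext <;> simp [-Complex.coe_smul] }
  refine (LinearEquiv.ofBijective φ ⟨?_, ?_⟩).finrank_eq
  · intro p q h
    exact Subtype.ext (congrArg (fun z : iEigenspace f => (z : Cx V).re) h)
  · intro z
    refine ⟨⟨(z : Cx V).re, re_mem_sqNegOne z.2⟩, ?_⟩
    apply Subtype.ext
    apply Cx.ext
    · rfl
    · show -f (z : Cx V).re = (z : Cx V).im
      rw [(mem_iEigenspace.1 z.2).1, neg_neg]

/-- The space splits orthogonally as K ⊕ ℝu with K the kernel of f² + 1. On K the square is -1 and
skewness is the isotropy of the eigenspace; on u the map vanishes. -/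
theorem sq_eq_and_skew [FiniteDimensional ℝ V] (B : LinearMap.BilinForm ℝ V)
    (hs : ∀ u v, B u v = B v u) (hB : B.Nondegenerate) (f : V →ₗ[ℝ] V) (n : ℕ)
    (hV : Module.finrank ℝ V = 2 * n + 1) (hL : Module.finrank ℂ (iEigenspace f) = n)
    (hiso : ∀ z ∈ iEigenspace f, ∀ w ∈ iEigenspace f, bilin B z w = 0)
    (hker : ∀ u : V, (∀ z ∈ iEigenspace f, bilin B (ofReal u) z = 0 ∧
      bilin B (ofReal u) z.conj = 0) → f u = 0)
    (u : V) (hu : f u = 0) (hu1 : B u u = 1) :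
    (∀ e, f (f e) = -e + B e u • u) ∧ ∀ e e', B (f e) e' = -B e (f e') := by
  have hrefl : B.IsRefl := fun a b h => by rw [hs, h]
  set K := sqNegOne f with hK
  have hKn : Module.finrank ℝ K = 2 * n := by rw [hK, finrank_sqNegOne, hL]
  have hdim := LinearMap.BilinForm.finrank_orthogonal hB K
  have hsub : B.orthogonal K ≤ LinearMap.ker f := by
    intro v hv
    refine hker v fun z hz => ?_
    have h1 : B v z.re = 0 := by rw [hs]; exact hv _ (re_mem_sqNegOne hz)
    have h2 : B v z.im = 0 := by rw [hs]; exact hv _ (im_mem_sqNegOne hz)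
    simp [bilin_ofReal_left, h1, h2, conj]
  have hdisj : Disjoint K (LinearMap.ker f) := by
    rw [Submodule.disjoint_def]
    intro v hv hv'
    rw [hK, mem_sqNegOne, LinearMap.mem_ker.1 hv', map_zero] at hv
    simpa using hv.symm
  have hle := Submodule.finrank_add_finrank_le_of_disjoint hdisj
  -- The complement of K has dimension (2n + 1) - 2n = 1, while the kernel of f meets K trivially
  -- and so has dimension at most 1.
  have heq : B.orthogonal K = LinearMap.ker f :=
    Submodule.eq_of_le_of_finrank_le hsub (by omega)
  have hker1 : Module.finrank ℝ (LinearMap.ker f) = 1 := by rw [← heq]; omega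
  have hKu : ∀ k ∈ K, B k u = 0 := by
    have : u ∈ B.orthogonal K := by rw [heq]; exact hu
    exact this
  have hu0 : u ≠ 0 := by rintro rfl; simp at hu1
  have hspan : ∀ v, f v = 0 → ∃ t : ℝ, v = t • u := by
    intro v hv
    obtain ⟨t, ht⟩ := (finrank_eq_one_iff_of_nonzero' (⟨u, hu⟩ : LinearMap.ker f)
      (by simpa [Subtype.ext_iff] using hu0)).1 hker1 ⟨v, hv⟩
    exact ⟨t, by simpa using (congrArg Subtype.val ht).symm⟩
  have htop : K ⊔ LinearMap.ker f = ⊤ := by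
    apply Submodule.eq_top_of_finrank_eq
    have := Submodule.finrank_sup_add_finrank_inf_eq K (LinearMap.ker f)
    rw [disjoint_iff.1 hdisj, finrank_bot] at this
    omega
  have hdec : ∀ e, ∃ k ∈ K, ∃ t : ℝ, e = k + t • u := by
    intro e
    obtain ⟨k, hk, v, hv, rfl⟩ := Submodule.mem_sup.1 (htop ▸ Submodule.mem_top : e ∈ K ⊔ LinearMap.ker f)
    obtain ⟨t, rfl⟩ := hspan v hv
    exact ⟨k, hk, t, rfl⟩
  have hKK : ∀ k ∈ K, ∀ k' ∈ K, B (f k) k' = -B k (f k') := by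
    intro k hk k' hk'
    -- The imaginary part of ⟨k - i f(k), k' - i f(k')⟩ = 0 is the skewness of f.
    have h := hiso _ (mk_neg_mem_iEigenspace hk) _ (mk_neg_mem_iEigenspace hk')
    rw [bilin_mk, ofReal_add_I_mul_eq_zero] at h
    have := h.2
    simp at this
    linarith
  constructor
  · intro e
    obtain ⟨k, hk, t, rfl⟩ := hdec e
    rw [map_add, map_smul, hu, smul_zero, add_zero, mem_sqNegOne.1 hk, map_add, map_smul]
    simp [hKu k hk, hu1]
  · intro e e'
    obtain ⟨k, hk, t, rfl⟩ := hdec e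
    obtain ⟨k', hk', t', rfl⟩ := hdec e'
    simp [hu, hKK k hk k' hk', hKu _ (map_mem_sqNegOne hk), hs u, hKu _ (map_mem_sqNegOne hk')]

/-- A converse of `sq_eq_and_skew`, to be applied to f' = G^end 𝓕: since f'² = f², the two maps have
the same kernel of f² + 1, hence eigenspaces of the same rank, and skewness alone gives isotropy. -/
theorem eigenspace_of_skew [FiniteDimensional ℝ V] (B : LinearMap.BilinForm ℝ V)
    (hB : ∀ v, (∀ w, B v w = 0) → v = 0) (f f' : V →ₗ[ℝ] V) (u : V)
    (hf : ∀ e, f (f e) = -e + B e u • u) (hf' : ∀ e, f' (f' e) = f (f e))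
    (hu' : f' u = 0) (hskew : ∀ e e', B (f' e) e' = -B e (f' e')) :
    Module.finrank ℂ (iEigenspace f') = Module.finrank ℂ (iEigenspace f) ∧
    (∀ z ∈ iEigenspace f', ∀ w ∈ iEigenspace f', bilin B z w = 0) ∧
    (∀ v : V, (∀ z ∈ iEigenspace f', bilin B (ofReal v) z = 0 ∧
      bilin B (ofReal v) z.conj = 0) → f' v = 0) := by
  refine ⟨?_, ?_, ?_⟩
  · have h1 := finrank_sqNegOne f
    have h2 := finrank_sqNegOne f'
    have : sqNegOne f' = sqNegOne f := by
      ext p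
      rw [mem_sqNegOne, mem_sqNegOne, hf']
    rw [this] at h2
    omega
  · intro z hz w hw
    obtain ⟨hz1, hz2⟩ := mem_iEigenspace.1 hz
    obtain ⟨hw1, hw2⟩ := mem_iEigenspace.1 hw
    have h1 := hskew z.re w.im
    have h2 := hskew z.re w.re
    rw [hz1, hw2] at h1
    rw [hz1, hw1] at h2
    have := bilin_mk B z.re z.im w.re w.im
    refine this.trans ?_
    rw [ofReal_add_I_mul_eq_zero]
    simp only [map_neg, LinearMap.neg_apply] at h1 h2
    constructor <;> linarith
  · intro v hv
    apply hB
    intro e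
    rw [hskew]
    -- The image of f' is orthogonal to u, because f' is skew and kills u; there f'² = -1.
    have hmem : f' e ∈ sqNegOne f' := by
      rw [mem_sqNegOne, hf' (f' e), hf (f' e), hskew, hu']
      simp
    have := (hv _ (mk_neg_mem_iEigenspace hmem)).1
    rw [bilin_ofReal_left, ofReal_add_I_mul_eq_zero] at this
    simp only [re_mk] at this
    rw [this.1, neg_zero]

end Cx

/-- The pointwise algebraic relations between the components `(g, J₊, J₋, X₊, X₋, c₊)`. -/
structure IsComponentsAt {V : Type*} [AddCommGroup V] [Module ℝ V] [TopologicalSpace V]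
    (g : V →L[ℝ] V →L[ℝ] ℝ) (Jp Jm : V →L[ℝ] V) (Xp Xm : V) (c : ℝ) : Prop where
  symm : ∀ a b, g a b = g b a
  nondegenerate : ∀ a, (∀ b, g a b = 0) → a = 0
  Jm_skew : ∀ a b, g (Jm a) b = -g a (Jm b)
  Jm_sq : ∀ a, Jm (Jm a) = -a
  Jp_skew : ∀ a b, g (Jp a) b = -g a (Jp b)
  Jp_sq : ∀ a, Jp (Jp a) = -a + g Xp a • Xp + g Xm a • Xm
  Jp_Xp : Jp Xp = -c • Xm
  Jp_Xm : Jp Xm = c • Xp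
  Xm_Xp : g Xm Xp = 0
  Xp_Xp : g Xp Xp = 1 - c ^ 2
  Xm_Xm : g Xm Xm = 1 - c ^ 2

variable {E : Type*} [NormedAddCommGroup E] [NormedSpace ℝ E] [FiniteDimensional ℝ E]
  {M : Type*} [TopologicalSpace M] [ChartedSpace E M] [IsManifold 𝓘(ℝ, E) ∞ M]

/-- The element `(P + gP) + (N - gN) + a` of the fibre, with `P + gP + a` in `E₊` and `N - gN`
in `E₋`. -/
def fib (g : PseudoRiemMetric E M) {x : M} (P N : Tan E x) (a : ℝ) : Fib E x :=
  (P + N, g x (P - N), a)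

theorem scalarProd_fib (g : PseudoRiemMetric E M) {x : M} (P N P' N' : Tan E x) (a a' : ℝ) :
    scalarProd x (fib g P N a) (fib g P' N' a') = g x P P' - g x N N' + a * a' := by
  simp only [scalarProd, fib, LinearMap.mk₂_apply, map_add, map_sub,
    sub_apply]
  rw [g.symm x P' P, g.symm x P' N, g.symm x N' P, g.symm x N' N]
  ring

theorem exists_fib_eq (g : PseudoRiemMetric E M) {x : M} (e : Fib E x) :
    ∃ P N a, e = fib g P N a := by
  obtain ⟨v, ξ, a⟩ := e
  have hv : g x (g.sharp x (ξ : Tan E x →ₗ[ℝ] ℝ)) = ξ := by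
    ext w
    exact LinearMap.congr_fun ((g.flat x).apply_symm_apply (ξ : Tan E x →ₗ[ℝ] ℝ)) w
  refine ⟨(1 / 2 : ℝ) • (v + g.sharp x (ξ : Tan E x →ₗ[ℝ] ℝ)),
    (1 / 2 : ℝ) • (v - g.sharp x (ξ : Tan E x →ₗ[ℝ] ℝ)), a, ?_⟩
  refine Prod.ext ?_ (Prod.ext ?_ rfl)
  · simp only [fib]; module
  · simp only [fib]
    rw [← smul_sub, add_sub_sub_cancel, ← two_smul ℝ, smul_smul]
    norm_num [hv]

theorem fib_inj (g : PseudoRiemMetric E M) {x : M} {P N P' N' : Tan E x} {a a' : ℝ}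
    (h : fib g P N a = fib g P' N' a') : P = P' ∧ N = N' ∧ a = a' := by
  obtain ⟨h1, h2, h3⟩ : P + N = P' + N' ∧ g x (P - N) = g x (P' - N') ∧ a = a' := by
    simpa [fib] using h
  have h4 : P - N = P' - N' := by
    rw [← sub_eq_zero]
    apply g.nondegenerate x
    intro w
    rw [map_sub, h2]
    simp
  refine ⟨?_, ?_, h3⟩
  · have : (2 : ℝ) • P = (2 : ℝ) • P' := by
      calc (2 : ℝ) • P = (P + N) + (P - N) := by module
        _ = (P' + N') + (P' - N') := by rw [h1, h4]
        _ = (2 : ℝ) • P' := by module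
    exact smul_right_injective _ (two_ne_zero) this
  · have : (2 : ℝ) • N = (2 : ℝ) • N' := by
      calc (2 : ℝ) • N = (P + N) - (P - N) := by module
        _ = (P' + N') - (P' - N') := by rw [h1, h4]
        _ = (2 : ℝ) • N' := by module
    exact smul_right_injective _ (two_ne_zero) this

theorem fib_add (g : PseudoRiemMetric E M) {x : M} (P N P' N' : Tan E x) (a a' : ℝ) :
    fib g P N a + fib g P' N' a' = fib g (P + P') (N + N') (a + a') := by
  refine Prod.ext ?_ (Prod.ext ?_ rfl)
  · simp only [fib, Prod.fst_add]; abel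
  · simp only [fib, Prod.fst_add, Prod.snd_add, ← map_add]; congr 1; abel

theorem fib_smul (g : PseudoRiemMetric E M) {x : M} (r : ℝ) (P N : Tan E x) (a : ℝ) :
    r • fib g P N a = fib g (r • P) (r • N) (r * a) := by
  refine Prod.ext ?_ (Prod.ext ?_ rfl)
  · simp only [fib, Prod.smul_fst]; module
  · simp only [fib, Prod.smul_fst, Prod.smul_snd, ← map_smul]; congr 1; module

theorem fib_neg (g : PseudoRiemMetric E M) {x : M} (P N : Tan E x) (a : ℝ) :
    -fib g P N a = fib g (-P) (-N) (-a) := by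
  refine Prod.ext ?_ (Prod.ext ?_ rfl)
  · simp only [fib, Prod.fst_neg]; abel
  · simp only [fib, Prod.fst_neg, Prod.snd_neg, ← map_neg]; congr 1; abel

theorem scalarProd_comm {x : M} (e e' : Fib E x) : scalarProd x e e' = scalarProd x e' e := by
  simp [scalarProd]; ring

theorem scalarProd_nondegenerate (g : PseudoRiemMetric E M) {x : M} (e : Fib E x)
    (h : ∀ e', scalarProd x e e' = 0) : e = 0 := by
  obtain ⟨P, N, a, rfl⟩ := exists_fib_eq g e
  have h1 : P = 0 := g.nondegenerate x P fun w => by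
    simpa [scalarProd_fib] using h (fib g w 0 0)
  have h2 : N = 0 := g.nondegenerate x N fun w => by
    simpa [scalarProd_fib] using h (fib g 0 w 0)
  have h3 : a = 0 := by simpa [scalarProd_fib] using h (fib g 0 0 1)
  subst h1 h2 h3
  simp [fib]

end
end BnGeometry

/-! ### Block form of 𝓕 on E₊ ⊕ E₋. -/

namespace BnGeometry

noncomputable section

variable {E : Type*} [NormedAddCommGroup E] [NormedSpace ℝ E] [FiniteDimensional ℝ E]
  {M : Type*} [TopologicalSpace M] [ChartedSpace E M] [IsManifold 𝓘(ℝ, E) ∞ M]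
  {G : GenMetric E M} {𝓕 : Π x : M, Fib E x →ₗ[ℝ] Fib E x}
  {g : PseudoRiemMetric E M} {Jp Jm : EndField E M} {Xp Xm : VField E M} {c : SmoothFun E M}

instance (x : M) : IsAddTorsionFree (Tan E x) :=
  have : IsAddTorsionFree E := IsAddTorsionFree.of_isTorsionFree ℝ E
  inferInstanceAs (IsAddTorsionFree E)

theorem IsComponents.mem_Eminus (h : IsComponents G 𝓕 g Jp Jm Xp Xm c) {x : M} (N : Tan E x) :
    fib g 0 N 0 ∈ G.Eminus x := by
  rw [h.standard]
  exact ⟨N, by simp [fib]⟩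

theorem IsComponents.mem_Eplus (h : IsComponents G 𝓕 g Jp Jm Xp Xm c) {x : M} (P : Tan E x)
    (a : ℝ) : fib g P 0 a ∈ G.Eplus x := by
  intro e he
  obtain ⟨v, rfl⟩ := (h.standard x e).1 he
  have : ((v, -g x v, 0) : Fib E x) = fib g 0 v 0 := by simp [fib]
  show scalarProd x _ _ = 0
  rw [this, scalarProd_fib]
  simp

theorem IsComponents.Gend_fib (h : IsComponents G 𝓕 g Jp Jm Xp Xm c) {x : M} (P N : Tan E x)
    (a : ℝ) : G.Gend x (fib g P N a) = fib g P (-N) a := by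
  have h1 : fib g P N a = fib g P 0 a + fib g 0 N 0 := by simp [fib_add]
  have h2 : fib g P (-N) a = fib g P 0 a - fib g 0 N 0 := by
    rw [sub_eq_add_neg, fib_neg, fib_add]; simp
  rw [h1, h2, GenMetric.Gend, LinearMap.sub_apply, map_add, map_add,
    Submodule.projection_apply_of_mem_left _ (h.mem_Eplus P a),
    Submodule.projection_apply_of_mem_left _ (h.mem_Eminus N),
    (Submodule.projection_apply_eq_zero_iff _).2 (h.mem_Eminus N),
    (Submodule.projection_apply_eq_zero_iff _).2 (h.mem_Eplus P a)]
  simp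

theorem finrank_fib (x : M) : Module.finrank ℝ (Fib E x) = 2 * Module.finrank ℝ E + 1 := by
  have h : Module.finrank ℝ (Tan E x →L[ℝ] ℝ) = Module.finrank ℝ E :=
    (LinearMap.toContinuousLinearMap (𝕜 := ℝ) (E := E) (F' := ℝ)).finrank_eq.symm.trans
      Subspace.dual_finrank_eq
  have h' : Module.finrank ℝ (Tan E x) = Module.finrank ℝ E := rfl
  have : FiniteDimensional ℝ (Tan E x →L[ℝ] ℝ) :=
    inferInstanceAs (FiniteDimensional ℝ (E →L[ℝ] ℝ))
  rw [Module.finrank_prod, Module.finrank_prod, h, h', Module.finrank_self]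
  ring

/-- The square and the skew-symmetry of `𝓕`. -/
theorem IsComponents.sq_and_skew (h : IsComponents G 𝓕 g Jp Jm Xp Xm c)
    (h𝓕 : IsGenAlmostComplex 𝓕) (x : M) :
    (∀ e, 𝓕 x (𝓕 x e) = -e + scalarProd x e (fib g (Xp x) 0 (c x)) • fib g (Xp x) 0 (c x)) ∧
      ∀ e e', scalarProd x (𝓕 x e) e' = -scalarProd x e (𝓕 x e') := by
  have hu : fib g (Xp x) 0 (c x) = (Xp x, g x (Xp x), c x) := by simp [fib]
  have : FiniteDimensional ℝ (Tan E x →L[ℝ] ℝ) :=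
    inferInstanceAs (FiniteDimensional ℝ (E →L[ℝ] ℝ))
  refine Cx.sq_eq_and_skew (scalarProd x) scalarProd_comm ?_ (𝓕 x) _ (finrank_fib x)
    (h𝓕.rank x) (h𝓕.isotropic x) (h𝓕.ker x) _ ?_ ?_
  · refine ⟨fun e he => scalarProd_nondegenerate g e he, fun e he => ?_⟩
    exact scalarProd_nondegenerate g e fun e' => by rw [scalarProd_comm]; exact he e'
  · rw [hu]; exact h.kernel x
  · rw [hu]; exact h.norm_one x

/-- Commuting with G^end keeps the image in E₋, where an element is determined by its TM-part. -/
theorem IsComponents.apply_minus (h : IsComponents G 𝓕 g Jp Jm Xp Xm c)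
    (h𝓕 : IsGenAlmostPseudoHermitian G 𝓕) (x : M) (N : Tan E x) :
    𝓕 x (fib g 0 N 0) = fib g 0 (Jm x N) 0 := by
  have h1 := LinearMap.congr_fun (h𝓕.commute x) (fib g 0 N 0)
  obtain ⟨P', N', a', h2⟩ := exists_fib_eq g (𝓕 x (fib g 0 N 0))
  rw [LinearMap.comp_apply, LinearMap.comp_apply, h.Gend_fib, h2, h.Gend_fib] at h1
  have h3 : fib g 0 (-N) 0 = -fib g 0 N 0 := by simp [fib_neg]
  rw [h3, map_neg, h2, fib_neg] at h1
  obtain ⟨h4, -, h5⟩ := fib_inj g h1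
  have h6 := h.Jminus x N
  have h7 : ((N, -g x N, 0) : Fib E x) = fib g 0 N 0 := by simp [fib]
  rw [h7, h2] at h6
  have h8 : P' = 0 := self_eq_neg.1 h4
  have h9 : a' = 0 := self_eq_neg.1 h5
  subst h8 h9
  simp only [fib, zero_add] at h6
  rw [h2, h6]

/-- The TM-parts are the definitions of J₊ and X₋. The ℝ-parts come from skewness: ⟨𝓕1, 1⟩ = 0 and
⟨𝓕P, 1⟩ = -⟨P, 𝓕1⟩. -/
theorem IsComponents.apply_plus (h : IsComponents G 𝓕 g Jp Jm Xp Xm c)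
    (h𝓕 : IsGenAlmostPseudoHermitian G 𝓕) (x : M) (P : Tan E x) (a : ℝ) :
    𝓕 x (fib g P 0 a) = fib g (Jp x P + a • Xm x) 0 (-g x (Xm x) P) := by
  have hN : ∀ P a, ∃ P' a', 𝓕 x (fib g P 0 a) = fib g P' 0 a' := by
    intro P a
    have h1 := LinearMap.congr_fun (h𝓕.commute x) (fib g P 0 a)
    obtain ⟨P', N', a', h2⟩ := exists_fib_eq g (𝓕 x (fib g P 0 a))
    rw [LinearMap.comp_apply, LinearMap.comp_apply, h.Gend_fib, h2, h.Gend_fib, neg_zero, h2]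
      at h1
    have h3 : N' = 0 := self_eq_neg.1 (fib_inj g h1).2.1.symm
    exact ⟨P', a', by rw [h2, h3]⟩
  have hskew := (h.sq_and_skew h𝓕.almostComplex x).2
  have h1 : ∃ a₁, 𝓕 x (fib g 0 0 1) = fib g (Xm x) 0 a₁ := by
    obtain ⟨P', a', h2⟩ := hN 0 1
    have h3 := h.Xminus x
    have h4 : ((0, 0, 1) : Fib E x) = fib g 0 0 1 := by simp [fib]
    rw [h4, h2] at h3
    simp only [fib, add_zero] at h3
    exact ⟨a', by rw [h2, h3]⟩
  have h2 : ∃ a₁, 𝓕 x (fib g P 0 0) = fib g (Jp x P) 0 a₁ := by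
    obtain ⟨P', a', h2⟩ := hN P 0
    have h3 := h.Jplus x P
    have h4 : ((P, g x P, 0) : Fib E x) = fib g P 0 0 := by simp [fib]
    rw [h4, h2] at h3
    simp only [fib, add_zero] at h3
    exact ⟨a', by rw [h2, h3]⟩
  obtain ⟨a₁, h1⟩ := h1
  obtain ⟨a₂, h2⟩ := h2
  have h3 := hskew (fib g 0 0 1) (fib g 0 0 1)
  have h4 := hskew (fib g P 0 0) (fib g 0 0 1)
  rw [h1, scalarProd_fib, scalarProd_fib] at h3
  rw [h1, h2, scalarProd_fib, scalarProd_fib] at h4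
  simp only [map_zero, zero_apply, mul_one, one_mul, zero_mul, zero_add, add_zero, sub_zero] at h3 h4
  have h5 : fib g P 0 a = fib g P 0 0 + a • fib g 0 0 1 := by simp [fib_smul, fib_add]
  rw [h5, map_add, map_smul, h1, h2, fib_smul, fib_add]
  have h6 : a₁ = 0 := by linarith
  rw [h6, h4, g.symm]
  simp

theorem IsComponents.apply_fib (h : IsComponents G 𝓕 g Jp Jm Xp Xm c)
    (h𝓕 : IsGenAlmostPseudoHermitian G 𝓕) (x : M) (P N : Tan E x) (a : ℝ) :
    𝓕 x (fib g P N a) = fib g (Jp x P + a • Xm x) (Jm x N) (-g x (Xm x) P) := by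
  have h1 : fib g P N a = fib g P 0 a + fib g 0 N 0 := by simp [fib_add]
  rw [h1, map_add, h.apply_minus h𝓕, h.apply_plus h𝓕, fib_add]
  simp

/-- The relations are the block entries of four facts: 𝓕 is skew, 𝓕² = -1 + ⟨·, u₀⟩ u₀, 𝓕u₀ = 0 and
⟨u₀, u₀⟩ = 1. Evaluating 𝓕² on the section 1 gives J₊X₋ and g(X₋, X₋). -/
theorem IsComponents.isComponentsAt (h : IsComponents G 𝓕 g Jp Jm Xp Xm c)
    (h𝓕 : IsGenAlmostPseudoHermitian G 𝓕) (x : M) :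
    IsComponentsAt (g x) (Jp x) (Jm x) (Xp x) (Xm x) (c x) := by
  obtain ⟨hsq, hskew⟩ := h.sq_and_skew h𝓕.almostComplex x
  have hker : 𝓕 x (fib g (Xp x) 0 (c x)) = fib g 0 0 0 := by
    have := h.kernel x
    have h0 : fib g (0 : Tan E x) 0 0 = 0 := by simp [fib]
    rw [h0]
    simpa [fib] using this
  have hone : scalarProd x (fib g (Xp x) 0 (c x)) (fib g (Xp x) 0 (c x)) = 1 := by
    have := h.norm_one x
    simpa [fib] using this
  have hF := h.apply_fib h𝓕 x
  have hsq' : ∀ P N a, _ := fun P N a => hsq (fib g P N a)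
  simp only [hF, scalarProd_fib, fib_smul, fib_neg, fib_add] at hsq'
  rw [hF] at hker
  have hker1 := (fib_inj g hker).1
  have hker2 := (fib_inj g hker).2.2
  rw [scalarProd_fib] at hone
  simp only [map_zero, sub_zero] at hone
  have hXX : g x (Xp x) (Xp x) = 1 - c x ^ 2 := by linarith
  have h1 := hsq' 0 0 1
  have h1a := (fib_inj g h1).1
  have h1b := (fib_inj g h1).2.2
  refine ⟨g.symm x, g.nondegenerate x, ?_, ?_, ?_, ?_, ?_, ?_, ?_, hXX, ?_⟩
  · intro a b
    have := hskew (fib g 0 a 0) (fib g 0 b 0)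
    simp only [hF, scalarProd_fib] at this
    simp at this
    linarith
  · intro a
    have := (fib_inj g (hsq' 0 a 0)).2.1
    simpa using this
  · intro a b
    have := hskew (fib g a 0 0) (fib g b 0 0)
    simp only [hF, scalarProd_fib] at this
    simpa using this
  · intro a
    have := (fib_inj g (hsq' a 0 0)).1
    simp at this
    rw [g.symm x (Xp x) a, ← this]
    simp
  · rw [neg_smul]; exact eq_neg_of_add_eq_zero_left hker1
  · simpa using h1a
  · simpa using hker2
  · simp at h1b
    linarith

/-- `𝓖^end 𝓕` is a `B_n`-generalized almost complex structure. -/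
theorem IsComponents.isGenAlmostComplex_second (h : IsComponents G 𝓕 g Jp Jm Xp Xm c)
    (h𝓕 : IsGenAlmostPseudoHermitian G 𝓕) :
    IsGenAlmostComplex (fun x => G.Gend x ∘ₗ 𝓕 x) := by
  have key : ∀ x, _ := fun x => Cx.eigenspace_of_skew (scalarProd x)
    (scalarProd_nondegenerate g) (𝓕 x) (G.Gend x ∘ₗ 𝓕 x) (fib g (Xp x) 0 (c x))
    (h.sq_and_skew h𝓕.almostComplex x).1 (by
      intro e
      obtain ⟨P, N, a, rfl⟩ := exists_fib_eq g e
      simp [h.apply_fib h𝓕, h.Gend_fib]) (by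
      have := h.kernel x
      have h1 : 𝓕 x (fib g (Xp x) 0 (c x)) = 0 := by simpa [fib] using this
      simp [h1]) (by
      intro e e'
      obtain ⟨P, N, a, rfl⟩ := exists_fib_eq g e
      obtain ⟨P', N', a', rfl⟩ := exists_fib_eq g e'
      have := (h.sq_and_skew h𝓕.almostComplex x).2 (fib g P (-N) a) (fib g P' N' a')
      simpa [h.apply_fib h𝓕, h.Gend_fib, scalarProd_fib] using this)
  refine ⟨?_, fun x => ((key x).1).trans (h𝓕.almostComplex.rank x),
    fun x => (key x).2.1, fun x => (key x).2.2⟩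
  intro u
  obtain ⟨X, hX⟩ := exists_sharp g u.form
  -- With X dual to the form part of u, the E₊ and E₋ components of u are P = (u.vec + X)/2 and N =
  -- (u.vec - X)/2. The sign of J₋N is reversed by G^end, hence a difference in the vector part and
  -- a sum in the form part.
  refine ⟨⟨((1 / 2 : ℝ) • (Jp.app (u.vec + X)) + smulField u.fn Xm) - (1 / 2 : ℝ) • (Jm.app (u.vec - X)),
    g.flatField (((1 / 2 : ℝ) • (Jp.app (u.vec + X)) + smulField u.fn Xm) + (1 / 2 : ℝ) • (Jm.app (u.vec - X))),
    -(1 / 2 : ℝ) • g.inner Xm (u.vec + X)⟩, fun x => ?_⟩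
  have hu : u x = fib g ((1 / 2 : ℝ) • (u.vec x + X x)) ((1 / 2 : ℝ) • (u.vec x - X x)) (u.fn x) := by
    refine Prod.ext ?_ (Prod.ext ?_ rfl)
    · simp only [fib, Sec.val]; module
    · simp only [fib, Sec.val]
      rw [← smul_sub, add_sub_sub_cancel, ← two_smul ℝ, smul_smul]
      norm_num [hX]
  rw [hu]
  simp only [LinearMap.comp_apply, h.apply_fib h𝓕, h.Gend_fib]
  refine Prod.ext ?_ (Prod.ext ?_ ?_)
  · simp [fib, Sec.val]; abel
  · simp [fib, Sec.val]
  · simp [fib, Sec.val]; ring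

end
end BnGeometry

/-! ### The Dorfman bracket in terms of the Levi-Civita connection. -/

namespace BnGeometry

noncomputable section

variable {E : Type*} [NormedAddCommGroup E] [NormedSpace ℝ E] [FiniteDimensional ℝ E]
  {M : Type*} [TopologicalSpace M] [ChartedSpace E M] [IsManifold 𝓘(ℝ, E) ∞ M]
  {H : ThreeForm E M} {F : TwoForm E M} {g : PseudoRiemMetric E M} {D : Conn E M}

theorem TwoForm.swap (F : TwoForm E M) (x : M) (a b : Tan E x) : F x a b = -F x b a := by
  have := F.alternating x (a + b)
  simp only [map_add, LinearMap.add_apply, F.alternating] at this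
  linarith

theorem ThreeForm.swap_left (H : ThreeForm E M) (x : M) (a b d : Tan E x) :
    H x a b d = -H x b a d := by
  have := H.alternating_left x (a + b) d
  simp only [map_add, LinearMap.add_apply, H.alternating_left] at this
  linarith

theorem ThreeForm.swap_right (H : ThreeForm E M) (x : M) (a b d : Tan E x) :
    H x a b d = -H x a d b := by
  have := H.alternating_right x a (b + d)
  simp only [map_add, LinearMap.add_apply, H.alternating_right] at this
  linarith

theorem ThreeForm.rotate (H : ThreeForm E M) (x : M) (a b d : Tan E x) :
    H x a b d = H x b d a := by
  rw [H.swap_left, H.swap_right, neg_neg]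

theorem PseudoRiemMetric.apply_sharp (g : PseudoRiemMetric E M) (x : M) (α : Tan E x →ₗ[ℝ] ℝ)
    (v : Tan E x) : g x (g.sharp x α) v = α v :=
  LinearMap.congr_fun ((g.flat x).apply_symm_apply α) v

theorem TwoForm.apply_vec (F : TwoForm E M) (g : PseudoRiemMetric E M) (x : M) (v w : Tan E x) :
    g x (F.vec g x v) w = F x v w := g.apply_sharp x _ w

theorem ThreeForm.apply_vec (H : ThreeForm E M) (g : PseudoRiemMetric E M) (x : M)
    (u v w : Tan E x) : g x (H.vec g x u v) w = H x u v w := g.apply_sharp x _ w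

theorem PseudoRiemMetric.ext_left (g : PseudoRiemMetric E M) {x : M} {v w : Tan E x}
    (h : ∀ z, g x v z = g x w z) : v = w := by
  rw [← sub_eq_zero]
  exact g.nondegenerate x _ fun z => by simp [h]

theorem mdifferentiableAt_fn (f : SmoothFun E M) (x : M) : MDiffAt (fun y => f y) x :=
  (f.contMDiff x).mdifferentiableAt (by simp)

theorem IsLeviCivita.lieB_eq (hD : IsLeviCivita g D) (X Y : VField E M) (x : M) :
    lieB X Y x = D Y x (X x) - D X x (Y x) :=
  (hD.torsion_free X Y x (mdifferentiableAt_vField X x) (mdifferentiableAt_vField Y x)).symm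

theorem IsLeviCivita.dirDeriv_inner (hD : IsLeviCivita g D) (X Y : VField E M) (x : M)
    (v : Tan E x) : dirDeriv (fun y => g y (X y) (Y y)) x v = g x (D X x v) (Y x) + g x (X x) (D Y x v) :=
  hD.metric X Y x v (mdifferentiableAt_vField X x) (mdifferentiableAt_vField Y x)

theorem Conn.add_apply (D : Conn E M) (X Y : VField E M) (x : M) (v : Tan E x) :
    D (⇑(X + Y)) x v = D X x v + D Y x v := by
  rw [ContMDiffSection.coe_add, D.isCovariantDerivativeOn.add (s := Set.univ)
    (mdifferentiableAt_vField X x) (mdifferentiableAt_vField Y x)]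
  rfl

theorem Conn.smul_apply (D : Conn E M) (f : SmoothFun E M) (X : VField E M) (x : M)
    (v : Tan E x) :
    D (⇑(smulField f X)) x v = f x • D X x v + dirDeriv f x v • X x := by
  have : ⇑(smulField f X) = (⇑f) • ⇑X := rfl
  rw [this, D.isCovariantDerivativeOn.leibniz (s := Set.univ)
    (mdifferentiableAt_vField X x) (mdifferentiableAt_fn f x)]
  rfl

theorem Conn.const_smul_apply (D : Conn E M) (r : ℝ) (X : VField E M) (x : M)
    (v : Tan E x) :
    D (⇑(r • X)) x v = r • D X x v := by
  rw [ContMDiffSection.coe_smul, D.isCovariantDerivativeOn.smul_const (s := Set.univ) r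
    (mdifferentiableAt_vField X x)]
  rfl

theorem Conn.neg_apply (D : Conn E M) (X : VField E M) (x : M) (v : Tan E x) :
    D (⇑(-X)) x v = - D X x v := by
  have : -X = (-1 : ℝ) • X := by simp
  rw [this, Conn.const_smul_apply]; simp

theorem Conn.sub_apply (D : Conn E M) (X Y : VField E M) (x : M) (v : Tan E x) :
    D (⇑(X - Y)) x v = D X x v - D Y x v := by
  rw [sub_eq_add_neg, Conn.add_apply, Conn.neg_apply, sub_eq_add_neg]

/-- With W extending w, metricity expands X(g(Y, W)) and torsion-freeness expands [X, W]; the two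
terms in ∇_X W cancel. -/
theorem IsLeviCivita.lieDeriv_flatField [T2Space M] (hD : IsLeviCivita g D) (X Y : VField E M)
    (x : M) (w : Tan E x) :
    lieDeriv X (g.flatField Y) x w = g x (D Y x (X x)) w + g x (Y x) (D X x w) := by
  obtain ⟨W, rfl⟩ := exists_vField_apply_eq x w
  rw [lieDeriv, TensorialAt.mkHom_apply _ (mdifferentiableAt_vField W x), lieDerivAux,
    hD.lieB_eq]
  simp only [PseudoRiemMetric.flatField_apply]
  rw [hD.dirDeriv_inner, map_sub]
  ring

theorem IsLeviCivita.extDeriv_flatField [T2Space M] (hD : IsLeviCivita g D) (X : VField E M)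
    (x : M) (v w : Tan E x) :
    extDeriv (g.flatField X) x v w = g x (D X x v) w - g x (D X x w) v := by
  obtain ⟨V, rfl⟩ := exists_vField_apply_eq x v
  obtain ⟨W, rfl⟩ := exists_vField_apply_eq x w
  rw [extDeriv, TensorialAt.mkHom₂_apply _ _ (mdifferentiableAt_vField V x)
    (mdifferentiableAt_vField W x), extDerivAux, hD.lieB_eq]
  simp only [PseudoRiemMetric.flatField_apply]
  rw [hD.dirDeriv_inner, hD.dirDeriv_inner, map_sub]
  ring

/-- The section `(P + gP) + (N - gN) + a`. -/
def fibSec (g : PseudoRiemMetric E M) (P N : VField E M) (a : SmoothFun E M) : Sec E M :=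
  ⟨P + N, g.flatField (P - N), a⟩

@[simp] theorem fibSec_apply (g : PseudoRiemMetric E M) (P N : VField E M) (a : SmoothFun E M)
    (x : M) : fibSec g P N a x = fib g (P x) (N x) (a x) := by
  simp [fibSec, fib, Sec.val]

theorem Sec.ext_val {u v : Sec E M} (h : ∀ x, u x = v x) : u = v := by
  obtain ⟨u1, u2, u3⟩ := u
  obtain ⟨v1, v2, v3⟩ := v
  have h1 : u1 = v1 := ContMDiffSection.ext fun x => congrArg Prod.fst (h x)
  have h2 : u2 = v2 := ContMDiffSection.ext fun x => congrArg (fun e => e.2.1) (h x)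
  have h3 : u3 = v3 := DFunLike.ext _ _ fun x => congrArg (fun e => e.2.2) (h x)
  rw [h1, h2, h3]

theorem exists_fibSec_eq (g : PseudoRiemMetric E M) (u : Sec E M) :
    ∃ P N a, u = fibSec g P N a := by
  obtain ⟨X, hX⟩ := exists_sharp g u.form
  refine ⟨(1 / 2 : ℝ) • (u.vec + X), (1 / 2 : ℝ) • (u.vec - X), u.fn,
    Sec.ext_val fun x => ?_⟩
  rw [fibSec_apply]
  refine Prod.ext ?_ (Prod.ext ?_ rfl)
  · simp only [fib, Sec.val, ContMDiffSection.coe_smul, ContMDiffSection.coe_add,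
      ContMDiffSection.coe_sub, Pi.smul_apply, Pi.add_apply, Pi.sub_apply]; module
  · simp only [fib, Sec.val, ContMDiffSection.coe_smul, ContMDiffSection.coe_add,
      ContMDiffSection.coe_sub, Pi.smul_apply, Pi.add_apply, Pi.sub_apply]
    rw [← smul_sub, add_sub_sub_cancel, ← two_smul ℝ, smul_smul]
    norm_num [hX]

/-- The value at `x` of the section `P + gP + a` of `E₊ ≅ TM ⊕ ℝ`. -/
def plusVal (U : VField E M × SmoothFun E M) (x : M) : Tan E x × ℝ := (U.1 x, U.2 x)

/-- The scalar product of `E₊ ≅ TM ⊕ ℝ`. -/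
def plusProd (g : PseudoRiemMetric E M) (x : M) : LinearMap.BilinForm ℝ (Tan E x × ℝ) :=
  LinearMap.mk₂ ℝ (fun u v => g x u.1 v.1 + u.2 * v.2)
    (by intro a b c; simp; ring) (by intro a b c; simp; ring)
    (by intro a b c; simp; ring) (by intro a b c; simp; ring)

/-- The derivative of the section `U = P + gP + a` of `E₊` along `v`. -/
def plusD (H : ThreeForm E M) (F : TwoForm E M) (g : PseudoRiemMetric E M) (D : Conn E M)
    (U : VField E M × SmoothFun E M) (x : M) (v : Tan E x) : Tan E x × ℝ :=
  (D U.1 x v - (1 / 2 : ℝ) • H.vec g x v (U.1 x) - U.2 x • F.vec g x v,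
    dirDeriv U.2 x v + F x v (U.1 x))

/-- The derivative of the section `N - gN` of `E₋` along `v + gv + b`. -/
def minusD (H : ThreeForm E M) (F : TwoForm E M) (g : PseudoRiemMetric E M) (D : Conn E M)
    (N : VField E M) (x : M) (v : Tan E x) (b : ℝ) : Tan E x :=
  D N x v + (1 / 2 : ℝ) • H.vec g x v (N x) - b • F.vec g x (N x)

/-- The torsion of the connection on `E₊`. -/
def plusTor (H : ThreeForm E M) (F : TwoForm E M) {x : M} (u₁ u₂ u₃ : Tan E x × ℝ) : ℝ :=
  H x u₁.1 u₂.1 u₃.1 - (u₃.2 * F x u₁.1 u₂.1 + u₁.2 * F x u₂.1 u₃.1 + u₂.2 * F x u₃.1 u₁.1)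

/-- H and F are absorbed into the connections `plusD` and `minusD` so that the mixed components of
the bracket carry no torsion. On the pure components the three derivative terms contribute H with
total coefficient -3/2 where the bracket has -1/2, and the torsion supplies the missing H. -/
theorem IsLeviCivita.scalarProd_dorfman [T2Space M] (hD : IsLeviCivita g D)
    (U₁ U₂ : VField E M × SmoothFun E M) (N₁ N₂ : VField E M) (x : M) (u : Tan E x × ℝ)
    (n : Tan E x) :
    scalarProd x (dorfman H F (fibSec g U₁.1 N₁ U₁.2) (fibSec g U₂.1 N₂ U₂.2) x)
        (fib g u.1 n u.2) =
      plusProd g x (plusD H F g D U₂ x (U₁.1 x + N₁ x)) u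
      - plusProd g x (plusD H F g D U₁ x (U₂.1 x + N₂ x)) u
      + plusProd g x (plusD H F g D U₁ x (u.1 + n)) (plusVal U₂ x)
      + plusTor H F (plusVal U₁ x) (plusVal U₂ x) u
      - (g x (minusD H F g D N₂ x (U₁.1 x + N₁ x) (U₁.2 x)) n
        - g x (minusD H F g D N₁ x (U₂.1 x + N₂ x) (U₂.2 x)) n
        + g x (minusD H F g D N₁ x (u.1 + n) u.2) (N₂ x))
      + H x (N₁ x) (N₂ x) n := by
  obtain ⟨P₁, a₁⟩ := U₁
  obtain ⟨P₂, a₂⟩ := U₂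
  obtain ⟨p, a⟩ := u
  -- The symmetries of H, F and g bring each term to one normal form, after which both sides agree
  -- by linear arithmetic.
  have e1 : ∀ (u v : Tan E x), H x p u v = H x u v p := fun u v => H.rotate x _ _ _
  have e2 : ∀ (u v : Tan E x), H x n u v = H x u v n := fun u v => H.rotate x _ _ _
  have e3 : ∀ (u : Tan E x), F x p u = -F x u p := F.swap x p
  have e4 : ∀ (u : Tan E x), F x n u = -F x u n := F.swap x n
  have e5 : ∀ (u : Tan E x) (X : VField E M) (v : Tan E x), g x u (D X x v) = g x (D X x v) u :=
    fun u X v => g.symm x u _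
  have d2 : ∀ (a : SmoothFun E M) (v w : Tan E x),
      dirDeriv a x (v + w) = dirDeriv a x v + dirDeriv a x w := fun a v w => map_add _ v w
  have d1 : ∀ f (v : Tan E x), mvfderiv 𝓘(ℝ, E) f x v = dirDeriv f x v := fun _ _ => rfl
  simp only [dorfman, scalarProd, fib, fibSec, LinearMap.mk₂_apply,
    hD.lieB_eq, Conn.add_apply, Conn.sub_apply, hD.lieDeriv_flatField, hD.extDeriv_flatField,
    add_apply, sub_apply, smul_apply, LinearMap.coe_toContinuousLinearMap', d1]
  simp only [plusD, plusVal, plusProd, minusD, plusTor, LinearMap.mk₂_apply, map_sub, map_add, map_smul, smul_eq_mul,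
    H.apply_vec, F.apply_vec, ContMDiffSection.coe_add, ContMDiffSection.coe_sub, Pi.add_apply,
    Pi.sub_apply, LinearMap.add_apply, add_apply, sub_apply, smul_apply, d2]
  simp only [e1, e2, e3, e4, e5, H.swap_left x (P₂ x), H.swap_left x (N₂ x),
    F.swap x (P₂ x) (P₁ x), F.swap x (N₂ x) (P₁ x)]
  ring

end
end BnGeometry

namespace BnGeometry

noncomputable section

variable {E : Type*} [NormedAddCommGroup E] [NormedSpace ℝ E] [FiniteDimensional ℝ E]
  {M : Type*} [TopologicalSpace M] [ChartedSpace E M] [IsManifold 𝓘(ℝ, E) ∞ M]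
  {H : ThreeForm E M} {F : TwoForm E M} {g : PseudoRiemMetric E M} {D : Conn E M}

/-! ### Rules of differentiation -/

theorem dirDeriv_add (a b : SmoothFun E M) (x : M) (v : Tan E x) :
    dirDeriv (⇑(a + b)) x v = dirDeriv a x v + dirDeriv b x v := by
  have h := mvfderiv_add (mdifferentiableAt_fn a x) (mdifferentiableAt_fn b x)
  exact DFunLike.congr_fun h v

theorem dirDeriv_mul (a b : SmoothFun E M) (x : M) (v : Tan E x) :
    dirDeriv (⇑(a * b)) x v = a x * dirDeriv b x v + b x * dirDeriv a x v := by
  have h := mvfderiv_mul (mdifferentiableAt_fn a x) (mdifferentiableAt_fn b x)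
  exact DFunLike.congr_fun h v

theorem dirDeriv_const (r : ℝ) (x : M) (v : Tan E x) :
    dirDeriv (fun _ : M => r) x v = 0 := by
  have h : mvfderiv 𝓘(ℝ, E) (fun _ : M => r) x = 0 := mvfderiv_const r
  exact DFunLike.congr_fun h v

@[simp] theorem plusVal_add (U W : VField E M × SmoothFun E M) (x : M) :
    plusVal (U + W) x = plusVal U x + plusVal W x := rfl

@[simp] theorem plusVal_neg (U : VField E M × SmoothFun E M) (x : M) :
    plusVal (-U) x = -plusVal U x := rfl

@[simp] theorem plusVal_zero (x : M) : plusVal (0 : VField E M × SmoothFun E M) x = 0 := rfl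

theorem plusVal_ext {U W : VField E M × SmoothFun E M} (h : ∀ x, plusVal U x = plusVal W x) :
    U = W :=
  Prod.ext (ContMDiffSection.ext fun x => congrArg Prod.fst (h x))
    (DFunLike.ext _ _ fun x => congrArg Prod.snd (h x))

theorem TwoForm.vec_smul (F : TwoForm E M) (g : PseudoRiemMetric E M) (x : M) (r : ℝ)
    (v : Tan E x) : F.vec g x (r • v) = r • F.vec g x v := by
  simp [TwoForm.vec, PseudoRiemMetric.sharp]

theorem ThreeForm.vec_add (H : ThreeForm E M) (g : PseudoRiemMetric E M) (x : M)
    (u v w : Tan E x) : H.vec g x u (v + w) = H.vec g x u v + H.vec g x u w := by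
  simp [ThreeForm.vec, PseudoRiemMetric.sharp]

theorem ThreeForm.vec_smul (H : ThreeForm E M) (g : PseudoRiemMetric E M) (x : M) (r : ℝ)
    (u v : Tan E x) : H.vec g x u (r • v) = r • H.vec g x u v := by
  simp [ThreeForm.vec, PseudoRiemMetric.sharp]

theorem plusD_add (U W : VField E M × SmoothFun E M) (x : M) (v : Tan E x) :
    plusD H F g D (U + W) x v = plusD H F g D U x v + plusD H F g D W x v := by
  refine Prod.ext ?_ ?_
  · simp only [plusD, Prod.fst_add, Prod.snd_add, Conn.add_apply]
    rw [ContMDiffSection.coe_add, Pi.add_apply, ContMDiffMap.coe_add, Pi.add_apply,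
      ThreeForm.vec_add]
    module
  · simp only [plusD, Prod.fst_add, Prod.snd_add, dirDeriv_add]
    rw [ContMDiffSection.coe_add, Pi.add_apply, map_add]
    ring

/-- The product of a function and a section of `E₊`. -/
def smulPlus (f : SmoothFun E M) (U : VField E M × SmoothFun E M) :
    VField E M × SmoothFun E M := (smulField f U.1, f * U.2)

@[simp] theorem plusVal_smulPlus (f : SmoothFun E M) (U : VField E M × SmoothFun E M) (x : M) :
    plusVal (smulPlus f U) x = f x • plusVal U x := rfl

theorem plusD_smul (f : SmoothFun E M) (U : VField E M × SmoothFun E M) (x : M) (v : Tan E x) :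
    plusD H F g D (smulPlus f U) x v =
      f x • plusD H F g D U x v + dirDeriv f x v • plusVal U x := by
  refine Prod.ext ?_ ?_
  · simp only [plusD, smulPlus, Conn.smul_apply, plusVal, Prod.fst_add, Prod.smul_fst]
    rw [smulField_apply, ThreeForm.vec_smul, ContMDiffMap.coe_mul, Pi.mul_apply]
    module
  · simp only [plusD, smulPlus, plusVal, Prod.snd_add, Prod.smul_snd, dirDeriv_mul]
    rw [smulField_apply, map_smul]
    simp only [smul_eq_mul]
    ring

theorem plusD_neg (U : VField E M × SmoothFun E M) (x : M) (v : Tan E x) :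
    plusD H F g D (-U) x v = -plusD H F g D U x v := by
  have h := plusD_add (H := H) (F := F) (g := g) (D := D) U (-U) x v
  have h0 := plusD_add (H := H) (F := F) (g := g) (D := D) 0 0 x v
  rw [add_zero, left_eq_add] at h0
  rw [add_neg_cancel, h0] at h
  exact (neg_eq_of_add_eq_zero_right h.symm).symm

theorem plusD_zero (x : M) (v : Tan E x) :
    plusD H F g D (0 : VField E M × SmoothFun E M) x v = 0 := by
  have h0 := plusD_add (H := H) (F := F) (g := g) (D := D) 0 0 x v
  rwa [add_zero, left_eq_add] at h0

theorem plusProd_comm (x : M) (u w : Tan E x × ℝ) : plusProd g x u w = plusProd g x w u := by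
  simp only [plusProd, LinearMap.mk₂_apply]
  rw [g.symm x u.1 w.1, mul_comm]

theorem plusProd_ext {x : M} {u w : Tan E x × ℝ}
    (h : ∀ r, plusProd g x u r = plusProd g x w r) : u = w := by
  refine Prod.ext (g.ext_left fun z => ?_) ?_
  · simpa [plusProd] using h (z, 0)
  · simpa [plusProd] using h (0, 1)

/-- The connection on `E₊` is metric. -/
theorem IsLeviCivita.dirDeriv_plusProd (hD : IsLeviCivita g D) (U W : VField E M × SmoothFun E M)
    (x : M) (v : Tan E x) :
    dirDeriv (fun y => plusProd g y (plusVal U y) (plusVal W y)) x v =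
      plusProd g x (plusD H F g D U x v) (plusVal W x)
        + plusProd g x (plusVal U x) (plusD H F g D W x v) := by
  have h1 : (fun y => plusProd g y (plusVal U y) (plusVal W y)) =
      ⇑(g.inner U.1 W.1 + U.2 * W.2) := rfl
  have h2 : dirDeriv (⇑(g.inner U.1 W.1)) x v = _ := hD.dirDeriv_inner U.1 W.1 x v
  rw [h1, dirDeriv_add, dirDeriv_mul, h2]
  simp only [plusProd, plusD, plusVal, LinearMap.mk₂_apply, map_sub, map_smul, sub_apply,
    smul_apply, smul_eq_mul, H.apply_vec, F.apply_vec, g.symm x (U.1 x) (H.vec g x _ _),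
    g.symm x (U.1 x) (F.vec g x _)]
  rw [H.swap_right x v (W.1 x) (U.1 x)]
  ring

theorem minusD_smul_const (r : ℝ) (N : VField E M) (x : M) (v : Tan E x) (b : ℝ) :
    minusD H F g D (r • N) x v b = r • minusD H F g D N x v b := by
  simp only [minusD, Conn.const_smul_apply]
  rw [ContMDiffSection.coe_smul, Pi.smul_apply, ThreeForm.vec_smul, TwoForm.vec_smul]
  module

theorem minusD_neg (N : VField E M) (x : M) (v : Tan E x) (b : ℝ) :
    minusD H F g D (-N) x v b = -minusD H F g D N x v b := by
  have := minusD_smul_const (H := H) (F := F) (g := g) (D := D) (-1) N x v b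
  simpa using this

theorem minusD_zero (x : M) (v : Tan E x) (b : ℝ) :
    minusD H F g D (0 : VField E M) x v b = 0 := by
  have := minusD_smul_const (H := H) (F := F) (g := g) (D := D) 0 0 x v b
  simpa using this

/-- The type of sections carries no linear structure here, so compatibility of the bracket with
signs is read off from its scalar products. -/
theorem IsLeviCivita.dorfman_neg_right [T2Space M] (hD : IsLeviCivita g D) {u v w : Sec E M}
    (h : ∀ x, w x = -v x) (x : M) : dorfman H F u w x = -dorfman H F u v x := by
  obtain ⟨P, N, a, rfl⟩ := exists_fibSec_eq g u
  obtain ⟨P', N', a', rfl⟩ := exists_fibSec_eq g v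
  have hw : w = fibSec g (-P') (-N') (-a') := Sec.ext_val fun y => by
    rw [h, fibSec_apply, fibSec_apply, fib_neg]; rfl
  rw [hw, ← sub_eq_zero, sub_neg_eq_add]
  apply scalarProd_nondegenerate g
  intro e
  obtain ⟨p, n, b, rfl⟩ := exists_fib_eq g e
  have h1 := hD.scalarProd_dorfman (H := H) (F := F) (P, a) (-(P', a')) N (-N') x (p, b) n
  have h2 := hD.scalarProd_dorfman (H := H) (F := F) (P, a) (P', a') N N' x (p, b) n
  dsimp only [Prod.fst_neg, Prod.snd_neg] at h1 h2
  rw [map_add, LinearMap.add_apply, h1, h2, plusD_neg, minusD_neg, plusVal_neg]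
  rw [ContMDiffSection.coe_neg, ContMDiffSection.coe_neg, Pi.neg_apply, Pi.neg_apply]
  have h3 : ((-a' : SmoothFun E M) x) = -a' x := rfl
  simp only [h3, plusD, plusProd, plusVal, minusD, plusTor, LinearMap.mk₂_apply, map_add, map_sub,
    map_neg, map_smul, add_apply, sub_apply, smul_apply, neg_apply, LinearMap.neg_apply,
    LinearMap.add_apply, smul_eq_mul, Prod.fst_neg, Prod.snd_neg, H.apply_vec, F.apply_vec]
  have h4 : ∀ v : Tan E x, dirDeriv a x (-v) = - dirDeriv a x v := fun v => map_neg _ v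
  have h5 : ∀ v w : Tan E x, dirDeriv a x (v + w) = dirDeriv a x v + dirDeriv a x w :=
    fun v w => map_add _ v w
  simp only [h4, h5]
  ring

/-! ### Closedness of the eigenbundle in terms of scalar products -/

/-- Sections of L are exactly Qu + iu with u orthogonal to e₀, because 𝓕² = -1 there. For a bracket
to lie in L amounts to a real and an imaginary equation; the displayed identity is one of them
paired with e, with 𝓕 moved across by skewness. -/
theorem integrable_iff [T2Space M] (hD : IsLeviCivita g D)
    {𝓕 : Π x : M, Fib E x →ₗ[ℝ] Fib E x} {e₀ : Π x : M, Fib E x}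
    (hsq : ∀ x e, 𝓕 x (𝓕 x e) = -e + scalarProd x e (e₀ x) • e₀ x)
    (hskew : ∀ x e e', scalarProd x (𝓕 x e) e' = -scalarProd x e (𝓕 x e'))
    (h₀ : ∀ x, 𝓕 x (e₀ x) = 0)
    {Q : Sec E M → Sec E M} (hQ : ∀ u x, Q u x = 𝓕 x (u x)) :
    (∀ z w : CSec E M, (∀ x, z.val x ∈ Lbundle 𝓕 x) → (∀ x, w.val x ∈ Lbundle 𝓕 x) →
      ∀ x, dorfmanC H F z w x ∈ Lbundle 𝓕 x) ↔
    ∀ u v : Sec E M, (∀ x, scalarProd x (u x) (e₀ x) = 0) →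
      (∀ x, scalarProd x (v x) (e₀ x) = 0) → ∀ x e,
      scalarProd x (dorfman H F u v x) (𝓕 x e) - scalarProd x (dorfman H F (Q u) (Q v) x) (𝓕 x e)
        + scalarProd x (dorfman H F u (Q v) x) e + scalarProd x (dorfman H F (Q u) v x) e = 0 := by
  have hmem : ∀ u : Sec E M, (∀ x, scalarProd x (u x) (e₀ x) = 0) →
      ∀ x, (CSec.mk (Q u) u).val x ∈ Lbundle 𝓕 x := by
    intro u hu x
    rw [CSec.val, Lbundle, Cx.mk_mem_iEigenspace]
    exact ⟨by rw [hQ, hsq, hu, zero_smul, add_zero], (hQ u x).symm⟩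
  constructor
  · intro h u v hu hv x e
    have h1 := h _ _ (hmem u hu) (hmem v hv) x
    rw [dorfmanC, Lbundle, Cx.mk_mem_iEigenspace] at h1
    have h2 := congrArg (fun y => scalarProd x y e) h1.1
    simp only [hskew, map_sub, map_neg, map_add, LinearMap.sub_apply, LinearMap.neg_apply,
      LinearMap.add_apply] at h2
    linarith
  · intro h z w hz hw x
    have hsec : ∀ z : CSec E M, (∀ x, z.val x ∈ Lbundle 𝓕 x) →
        z = CSec.mk (Q z.im) z.im ∧ ∀ x, scalarProd x (z.im x) (e₀ x) = 0 := by
      intro z hz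
      obtain ⟨p, q⟩ := z
      have h1 : ∀ x, 𝓕 x (p x) = -q x ∧ 𝓕 x (q x) = p x := fun x => by
        have := hz x
        rwa [CSec.val, Lbundle, Cx.mk_mem_iEigenspace] at this
      have h2 : p = Q q := Sec.ext_val fun x => by rw [hQ, (h1 x).2]
      refine ⟨by rw [h2], fun x => ?_⟩
      have h3 : q x = -𝓕 x (p x) := by rw [(h1 x).1, neg_neg]
      show scalarProd x (q x) (e₀ x) = 0
      rw [h3, map_neg, LinearMap.neg_apply, hskew, h₀, map_zero, neg_zero, neg_zero]
    obtain ⟨hz1, hz2⟩ := hsec z hz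
    obtain ⟨hw1, hw2⟩ := hsec w hw
    generalize z.im = u at hz1 hz2
    generalize w.im = v at hw1 hw2
    subst hz1 hw1
    have key : ∀ v : Sec E M, (∀ x, scalarProd x (v x) (e₀ x) = 0) →
        𝓕 x (dorfman H F (Q u) (Q v) x - dorfman H F u v x) =
          -(dorfman H F (Q u) v x + dorfman H F u (Q v) x) := by
      intro v hv
      rw [← sub_eq_zero]
      apply scalarProd_nondegenerate g
      intro e
      have := h u v hz2 hv x e
      simp only [hskew, map_sub, map_neg, map_add, LinearMap.sub_apply, LinearMap.neg_apply,
        LinearMap.add_apply]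
      linarith
    rw [dorfmanC, Lbundle, Cx.mk_mem_iEigenspace]
    refine ⟨?_, ?_⟩
    · rw [key v hw2, add_comm]
    · have h1 : ∀ x, Q (Q v) x = -v x := fun x => by
        rw [hQ, hQ, hsq, hw2, zero_smul, add_zero]
      -- Replacing v by Qv multiplies Qv + iv by i, so the second equation is an instance of the
      -- first.
      have h2 := key (Q v) fun x => by
        rw [hQ, hskew, h₀, map_zero, neg_zero]
      rw [hD.dorfman_neg_right h1, hD.dorfman_neg_right h1, ← neg_inj] at h2
      rw [← map_neg] at h2
      simp only [neg_sub, neg_neg] at h2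
      rw [sub_neg_eq_add] at h2
      dsimp only
      rw [add_comm (dorfman H F (Q u) v x), h2, sub_eq_add_neg]

end
end BnGeometry

/-! ### Closedness of the eigenbundles as derivative terms plus torsion terms. -/

namespace BnGeometry

noncomputable section

variable {E : Type*} [NormedAddCommGroup E] [NormedSpace ℝ E] [FiniteDimensional ℝ E]
  {M : Type*} [TopologicalSpace M] [ChartedSpace E M] [IsManifold 𝓘(ℝ, E) ∞ M]
  {H : ThreeForm E M} {F : TwoForm E M} {g : PseudoRiemMetric E M} {D : Conn E M}
  {Jp Jm : EndField E M} {Xp Xm : VField E M} {c : SmoothFun E M}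

/-- The restriction of `𝓕` to `E₊ ≅ TM ⊕ ℝ`. -/
def kap (g : PseudoRiemMetric E M) (Jp : EndField E M) (Xm : VField E M) (x : M) :
    Tan E x × ℝ →ₗ[ℝ] Tan E x × ℝ where
  toFun u := (Jp x u.1 + u.2 • Xm x, -g x (Xm x) u.1)
  map_add' u v := by
    refine Prod.ext ?_ ?_
    · simp only [Prod.fst_add, Prod.snd_add, map_add]; module
    · simp only [Prod.fst_add, Prod.snd_add, map_add]; ring
  map_smul' r u := by
    refine Prod.ext ?_ ?_
    · simp only [Prod.smul_fst, Prod.smul_snd, map_smul, RingHom.id_apply]; module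
    · simp

/-- The action of `𝓕` on sections of `E₊`. -/
def kapSec (g : PseudoRiemMetric E M) (Jp : EndField E M) (Xm : VField E M)
    (U : VField E M × SmoothFun E M) : VField E M × SmoothFun E M :=
  (Jp.app U.1 + smulField U.2 Xm, -g.inner Xm U.1)

@[simp] theorem plusVal_kapSec (U : VField E M × SmoothFun E M) (x : M) :
    plusVal (kapSec g Jp Xm U) x = kap g Jp Xm x (plusVal U x) := rfl

theorem plusProd_kap
    (hc : ∀ x, IsComponentsAt (g x) (Jp x) (Jm x) (Xp x) (Xm x) (c x)) (x : M)
    (u w : Tan E x × ℝ) :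
    plusProd g x (kap g Jp Xm x u) w = -plusProd g x u (kap g Jp Xm x w) := by
  simp only [plusProd, kap, LinearMap.mk₂_apply, LinearMap.coe_mk, AddHom.coe_mk, map_add,
    map_smul, add_apply, smul_apply, (hc x).Jp_skew, smul_eq_mul]
  rw [g.symm x u.1 (Xm x)]
  ring

theorem kap_kap
    (hc : ∀ x, IsComponentsAt (g x) (Jp x) (Jm x) (Xp x) (Xm x) (c x)) (x : M)
    (u : Tan E x × ℝ) :
    kap g Jp Xm x (kap g Jp Xm x u) =
      -u + plusProd g x u (plusVal (Xp, c) x) • plusVal (Xp, c) x := by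
  have h := hc x
  refine Prod.ext ?_ ?_
  · simp only [plusProd, kap, plusVal, LinearMap.mk₂_apply, LinearMap.coe_mk, AddHom.coe_mk,
      map_add, map_smul, h.Jp_sq, h.Jp_Xm, Prod.fst_add, Prod.fst_neg, Prod.smul_fst,
      g.symm x u.1]
    module
  · simp only [plusProd, kap, plusVal, LinearMap.mk₂_apply, LinearMap.coe_mk, AddHom.coe_mk,
      map_add, map_smul, Prod.snd_add, Prod.snd_neg, Prod.smul_snd, h.Xm_Xm, smul_eq_mul,
      g.symm x u.1]
    have h1 := h.Jp_skew (Xm x) u.1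
    rw [h.Jp_Xm, map_smul, smul_apply, smul_eq_mul] at h1
    linear_combination -h1

theorem plusProd_self
    (hc : ∀ x, IsComponentsAt (g x) (Jp x) (Jm x) (Xp x) (Xm x) (c x)) (x : M) :
    plusProd g x (plusVal (Xp, c) x) (plusVal (Xp, c) x) = 1 := by
  simp only [plusProd, plusVal, LinearMap.mk₂_apply, (hc x).Xp_Xp]
  ring

theorem kap_generator
    (hc : ∀ x, IsComponentsAt (g x) (Jp x) (Jm x) (Xp x) (Xm x) (c x)) (x : M) :
    kap g Jp Xm x (plusVal (Xp, c) x) = 0 := by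
  refine Prod.ext ?_ ?_
  · simp [kap, plusVal, (hc x).Jp_Xp]
  · simp [kap, plusVal, (hc x).Xm_Xp]

/-- The derivative of `E₊` commutes with `𝓕` on sections orthogonal to `Ker 𝓕`. -/
def PlusParallel (H : ThreeForm E M) (F : TwoForm E M) (g : PseudoRiemMetric E M) (D : Conn E M)
    (Jp : EndField E M) (Xp Xm : VField E M) (c : SmoothFun E M) : Prop :=
  ∀ U : VField E M × SmoothFun E M,
    (∀ x, plusProd g x (plusVal U x) (plusVal (Xp, c) x) = 0) →
    ∀ x (v : Tan E x),
      plusD H F g D (kapSec g Jp Xm U) x v = kap g Jp Xm x (plusD H F g D U x v)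

/-- The derivative of `E₋` commutes with `𝓕`. -/
def MinusParallel (H : ThreeForm E M) (F : TwoForm E M) (g : PseudoRiemMetric E M) (D : Conn E M)
    (Jm : EndField E M) : Prop :=
  ∀ (N : VField E M) (x : M) (v : Tan E x) (b : ℝ),
    minusD H F g D (Jm.app N) x v b = Jm x (minusD H F g D N x v b)

/-- Up to sign, the imaginary part of `T` on `L₊`. -/
def plusType (H : ThreeForm E M) (F : TwoForm E M) (g : PseudoRiemMetric E M)
    (Jp : EndField E M) (Xm : VField E M) {x : M} (u₁ u₂ u₃ : Tan E x × ℝ) : ℝ :=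
  plusTor H F u₁ u₂ (kap g Jp Xm x u₃)
    - plusTor H F (kap g Jp Xm x u₁) (kap g Jp Xm x u₂) (kap g Jp Xm x u₃)
    + plusTor H F u₁ (kap g Jp Xm x u₂) u₃ + plusTor H F (kap g Jp Xm x u₁) u₂ u₃

/-- Up to sign, the imaginary part of `H` on the `i`-eigenbundle of `J`. -/
def formType (H : ThreeForm E M) (J : EndField E M) {x : M} (n₁ n₂ n₃ : Tan E x) : ℝ :=
  H x n₁ n₂ (J x n₃) - H x (J x n₁) (J x n₂) (J x n₃) + H x n₁ (J x n₂) n₃ + H x (J x n₁) n₂ n₃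

/-- On the complement of u₀ one has U = -κ(κU), so the derivative of U is -κ of a derivative, and
the image of κ is orthogonal to u₀. -/
theorem PlusParallel.orthogonal
    (hc : ∀ x, IsComponentsAt (g x) (Jp x) (Jm x) (Xp x) (Xm x) (c x))
    (hA : PlusParallel H F g D Jp Xp Xm c) {U : VField E M × SmoothFun E M}
    (hU : ∀ x, plusProd g x (plusVal U x) (plusVal (Xp, c) x) = 0) (x : M) (v : Tan E x) :
    plusProd g x (plusD H F g D U x v) (plusVal (Xp, c) x) = 0 := by
  have h1 : kapSec g Jp Xm (kapSec g Jp Xm U) = -U := plusVal_ext fun y => by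
    rw [plusVal_kapSec, plusVal_kapSec, kap_kap hc, hU, zero_smul, add_zero, plusVal_neg]
  have h2 := hA (kapSec g Jp Xm U) (fun y => by
    rw [plusVal_kapSec, plusProd_kap hc, kap_generator hc, map_zero, neg_zero]) x v
  have h3 := congrArg (fun u => plusProd g x u (plusVal (Xp, c) x)) h2
  simp only [plusProd_kap hc, kap_generator hc, map_zero, neg_zero, h1, plusD_neg] at h3
  simpa using h3

/-- Each of the six directions occurs in two terms. Moving κ through the derivative and across the
scalar product makes the two cancel, so the directions can be arbitrary. -/
theorem PlusParallel.combination_eq_zero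
    (hc : ∀ x, IsComponentsAt (g x) (Jp x) (Jm x) (Xp x) (Xm x) (c x))
    (hA : PlusParallel H F g D Jp Xp Xm c) {U₁ U₂ : VField E M × SmoothFun E M}
    (hU₁ : ∀ x, plusProd g x (plusVal U₁ x) (plusVal (Xp, c) x) = 0)
    (hU₂ : ∀ x, plusProd g x (plusVal U₂ x) (plusVal (Xp, c) x) = 0)
    {x : M} (α₁ α₂ α₃ β₁ β₂ β₃ : Tan E x) (u : Tan E x × ℝ) :
    (plusProd g x (plusD H F g D U₂ x α₁) (kap g Jp Xm x u)
        - plusProd g x (plusD H F g D U₁ x α₂) (kap g Jp Xm x u)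
        + plusProd g x (plusD H F g D U₁ x β₃) (plusVal U₂ x))
      - (plusProd g x (plusD H F g D (kapSec g Jp Xm U₂) x β₁) (kap g Jp Xm x u)
        - plusProd g x (plusD H F g D (kapSec g Jp Xm U₁) x β₂) (kap g Jp Xm x u)
        + plusProd g x (plusD H F g D (kapSec g Jp Xm U₁) x β₃) (plusVal (kapSec g Jp Xm U₂) x))
      + (plusProd g x (plusD H F g D (kapSec g Jp Xm U₂) x α₁) u
        - plusProd g x (plusD H F g D U₁ x β₂) u
        + plusProd g x (plusD H F g D U₁ x α₃) (plusVal (kapSec g Jp Xm U₂) x))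
      + (plusProd g x (plusD H F g D U₂ x β₁) u
        - plusProd g x (plusD H F g D (kapSec g Jp Xm U₁) x α₂) u
        + plusProd g x (plusD H F g D (kapSec g Jp Xm U₁) x α₃) (plusVal U₂ x)) = 0 := by
  simp only [hA U₁ hU₁, hA U₂ hU₂, plusVal_kapSec, plusProd_kap hc, kap_kap hc, hU₂, map_add,
    map_neg, map_smul, hA.orthogonal hc hU₁, hA.orthogonal hc hU₂, smul_zero, zero_smul, map_zero]
  ring

/-- The same pairwise cancellation on E₋, where (εJ₋)² = -1 because ε² = 1. -/
theorem MinusParallel.combination_eq_zero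
    (hc : ∀ x, IsComponentsAt (g x) (Jp x) (Jm x) (Xp x) (Xm x) (c x))
    (hB : MinusParallel H F g D Jm) {ε : ℝ} (hε : ε * ε = 1) (N₁ N₂ : VField E M)
    {x : M} (α₁ α₂ α₃ β₁ β₂ β₃ : Tan E x) (a₁ a₂ a₃ b₁ b₂ b₃ : ℝ) (n : Tan E x) :
    (g x (minusD H F g D N₂ x α₁ a₁) (ε • Jm x n)
        - g x (minusD H F g D N₁ x α₂ a₂) (ε • Jm x n)
        + g x (minusD H F g D N₁ x β₃ b₃) (N₂ x))
      - (g x (minusD H F g D (ε • Jm.app N₂) x β₁ b₁) (ε • Jm x n)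
        - g x (minusD H F g D (ε • Jm.app N₁) x β₂ b₂) (ε • Jm x n)
        + g x (minusD H F g D (ε • Jm.app N₁) x β₃ b₃) ((ε • Jm.app N₂) x))
      + (g x (minusD H F g D (ε • Jm.app N₂) x α₁ a₁) n
        - g x (minusD H F g D N₁ x β₂ b₂) n
        + g x (minusD H F g D N₁ x α₃ a₃) ((ε • Jm.app N₂) x))
      + (g x (minusD H F g D N₂ x β₁ b₁) n
        - g x (minusD H F g D (ε • Jm.app N₁) x α₂ a₂) n
        + g x (minusD H F g D (ε • Jm.app N₁) x α₃ a₃) (N₂ x)) = 0 := by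
  have h := hc x
  rw [ContMDiffSection.coe_smul]
  simp only [minusD_smul_const, hB N₁, hB N₂, Pi.smul_apply, EndField.app_apply, h.Jm_skew,
    h.Jm_sq, map_smul, map_neg, smul_apply, smul_eq_mul]
  linear_combination (-g x (minusD H F g D N₂ x β₁ b₁) n + g x (minusD H F g D N₁ x β₂ b₂) n
    - g x (minusD H F g D N₁ x β₃ b₃) (N₂ x)) * hε

/-- The scalar product `⟨[U₁ + N₁, U₂ + N₂], u + n⟩` for `U₁, U₂, u` in `E₊` and `N₁, N₂, n`
in `E₋`. -/
def brk (H : ThreeForm E M) (F : TwoForm E M) (g : PseudoRiemMetric E M)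
    (U₁ U₂ : VField E M × SmoothFun E M) (N₁ N₂ : VField E M) (x : M) (u : Tan E x × ℝ)
    (n : Tan E x) : ℝ :=
  scalarProd x (dorfman H F (fibSec g U₁.1 N₁ U₁.2) (fibSec g U₂.1 N₂ U₂.2) x) (fib g u.1 n u.2)

/-- Closedness of the eigenbundle of `𝓕` (for `ε = 1`) or of `𝓖^end 𝓕` (for `ε = -1`), as the
vanishing of a combination of scalar products. -/
def BracketClosed (H : ThreeForm E M) (F : TwoForm E M) (g : PseudoRiemMetric E M)
    (Jp Jm : EndField E M) (Xp Xm : VField E M) (c : SmoothFun E M) (ε : ℝ) : Prop :=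
  ∀ U₁ U₂ : VField E M × SmoothFun E M,
    (∀ x, plusProd g x (plusVal U₁ x) (plusVal (Xp, c) x) = 0) →
    (∀ x, plusProd g x (plusVal U₂ x) (plusVal (Xp, c) x) = 0) →
    ∀ (N₁ N₂ : VField E M) (x : M) (u : Tan E x × ℝ) (n : Tan E x),
    brk H F g U₁ U₂ N₁ N₂ x (kap g Jp Xm x u) (ε • Jm x n)
    - brk H F g (kapSec g Jp Xm U₁) (kapSec g Jp Xm U₂) (ε • Jm.app N₁) (ε • Jm.app N₂) x
        (kap g Jp Xm x u) (ε • Jm x n)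
    + brk H F g U₁ (kapSec g Jp Xm U₂) N₁ (ε • Jm.app N₂) x u n
    + brk H F g (kapSec g Jp Xm U₁) U₂ (ε • Jm.app N₁) N₂ x u n = 0

theorem scalarProd_fib_eq (x : M) (u w : Tan E x × ℝ) (n m : Tan E x) :
    scalarProd x (fib g u.1 n u.2) (fib g w.1 m w.2) = plusProd g x u w - g x n m := by
  rw [scalarProd_fib]
  simp only [plusProd, LinearMap.mk₂_apply]
  ring

theorem bracketClosed_iff [T2Space M] (hD : IsLeviCivita g D)
    (hc : ∀ x, IsComponentsAt (g x) (Jp x) (Jm x) (Xp x) (Xm x) (c x))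
    {𝓕 : Π x : M, Fib E x →ₗ[ℝ] Fib E x} {ε : ℝ} (hε : ε * ε = 1)
    (h𝓕 : ∀ (x : M) (u : Tan E x × ℝ) (n : Tan E x), 𝓕 x (fib g u.1 n u.2) =
      fib g (kap g Jp Xm x u).1 (ε • Jm x n) (kap g Jp Xm x u).2)
    (hsmooth : IsSmoothEnd 𝓕) :
    (∀ z w : CSec E M, (∀ x, z.val x ∈ Lbundle 𝓕 x) → (∀ x, w.val x ∈ Lbundle 𝓕 x) →
      ∀ x, dorfmanC H F z w x ∈ Lbundle 𝓕 x) ↔ BracketClosed H F g Jp Jm Xp Xm c ε := by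
  choose Q hQ using hsmooth
  have hrep : ∀ (x : M) (e : Fib E x), ∃ (u : Tan E x × ℝ) (n : Tan E x),
      e = fib g u.1 n u.2 := fun x e => by
    obtain ⟨p, n, a, rfl⟩ := exists_fib_eq g e
    exact ⟨(p, a), n, rfl⟩
  have hQ' : ∀ (U : VField E M × SmoothFun E M) (N : VField E M),
      Q (fibSec g U.1 N U.2) =
        fibSec g (kapSec g Jp Xm U).1 (ε • Jm.app N) (kapSec g Jp Xm U).2 := by
    intro U N
    refine Sec.ext_val fun x => ?_
    rw [hQ, fibSec_apply, fibSec_apply]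
    exact h𝓕 x (plusVal U x) (N x)
  have hperp : ∀ (U : VField E M × SmoothFun E M) (N : VField E M) (x : M),
      scalarProd x (fibSec g U.1 N U.2 x) (fib g (plusVal (Xp, c) x).1 0 (plusVal (Xp, c) x).2) =
        plusProd g x (plusVal U x) (plusVal (Xp, c) x) := by
    intro U N x
    rw [fibSec_apply]
    have := scalarProd_fib_eq (g := g) x (plusVal U x) (plusVal (Xp, c) x) (N x) 0
    rw [map_zero, sub_zero] at this
    exact this
  rw [integrable_iff (H := H) (F := F)
    (e₀ := fun x => fib g (plusVal (Xp, c) x).1 0 (plusVal (Xp, c) x).2) hD ?_ ?_ ?_ hQ]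
  · constructor
    · intro h U₁ U₂ hU₁ hU₂ N₁ N₂ x u n
      have := h (fibSec g U₁.1 N₁ U₁.2) (fibSec g U₂.1 N₂ U₂.2)
        (fun x => by rw [hperp, hU₁]) (fun x => by rw [hperp, hU₂]) x (fib g u.1 n u.2)
      rwa [h𝓕, hQ', hQ'] at this
    · intro h v w hv hw x e
      obtain ⟨P₁, N₁, a₁, rfl⟩ := exists_fibSec_eq g v
      obtain ⟨P₂, N₂, a₂, rfl⟩ := exists_fibSec_eq g w
      obtain ⟨u, n, rfl⟩ := hrep x e
      have h1 := hQ' (P₁, a₁) N₁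
      have h2 := hQ' (P₂, a₂) N₂
      dsimp only at h1 h2
      rw [h𝓕, h1, h2]
      exact h (P₁, a₁) (P₂, a₂) (fun x => by rw [← hperp _ N₁]; exact hv x)
        (fun x => by rw [← hperp _ N₂]; exact hw x) N₁ N₂ x u n
  · intro x e
    obtain ⟨u, n, rfl⟩ := hrep x e
    rw [h𝓕, h𝓕, scalarProd_fib_eq, kap_kap hc, map_zero, sub_zero, fib_neg, fib_smul, fib_add,
      map_smul, (hc x).Jm_sq, smul_smul, hε, one_smul, smul_zero, add_zero]
    rfl
  · intro x e e'
    obtain ⟨u, n, rfl⟩ := hrep x e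
    obtain ⟨u', n', rfl⟩ := hrep x e'
    rw [h𝓕, h𝓕, scalarProd_fib_eq, scalarProd_fib_eq, plusProd_kap hc, map_smul, map_smul,
      smul_apply, (hc x).Jm_skew]
    simp only [smul_eq_mul]
    ring
  · intro x
    rw [h𝓕, kap_generator hc]
    simp [fib]

/-- Under parallelism the derivative terms of `IsLeviCivita.scalarProd_dorfman` disappear in this
combination. What is left is the torsion of E₊ and ε times that of E₋, as ε occurs there to an odd
power. -/
theorem bracketClosed_combination [T2Space M] (hD : IsLeviCivita g D)
    (hc : ∀ x, IsComponentsAt (g x) (Jp x) (Jm x) (Xp x) (Xm x) (c x))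
    (hA : PlusParallel H F g D Jp Xp Xm c) (hB : MinusParallel H F g D Jm)
    {ε : ℝ} (hε : ε * ε = 1) {U₁ U₂ : VField E M × SmoothFun E M}
    (hU₁ : ∀ x, plusProd g x (plusVal U₁ x) (plusVal (Xp, c) x) = 0)
    (hU₂ : ∀ x, plusProd g x (plusVal U₂ x) (plusVal (Xp, c) x) = 0)
    (N₁ N₂ : VField E M) (x : M) (u : Tan E x × ℝ) (n : Tan E x) :
    brk H F g U₁ U₂ N₁ N₂ x (kap g Jp Xm x u) (ε • Jm x n)
    - brk H F g (kapSec g Jp Xm U₁) (kapSec g Jp Xm U₂) (ε • Jm.app N₁) (ε • Jm.app N₂) x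
        (kap g Jp Xm x u) (ε • Jm x n)
    + brk H F g U₁ (kapSec g Jp Xm U₂) N₁ (ε • Jm.app N₂) x u n
    + brk H F g (kapSec g Jp Xm U₁) U₂ (ε • Jm.app N₁) N₂ x u n =
      plusType H F g Jp Xm (plusVal U₁ x) (plusVal U₂ x) u
        + ε * formType H Jm (N₁ x) (N₂ x) n := by
  have h1 := hA.combination_eq_zero hc hU₁ hU₂ (U₁.1 x + N₁ x) (U₂.1 x + N₂ x) (u.1 + n)
    ((kapSec g Jp Xm U₁).1 x + (ε • Jm.app N₁) x) ((kapSec g Jp Xm U₂).1 x + (ε • Jm.app N₂) x)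
    ((kap g Jp Xm x u).1 + ε • Jm x n) u
  have h2 := hB.combination_eq_zero hc hε N₁ N₂ (U₁.1 x + N₁ x) (U₂.1 x + N₂ x) (u.1 + n)
    ((kapSec g Jp Xm U₁).1 x + (ε • Jm.app N₁) x) ((kapSec g Jp Xm U₂).1 x + (ε • Jm.app N₂) x)
    ((kap g Jp Xm x u).1 + ε • Jm x n) (U₁.2 x) (U₂.2 x) u.2
    ((kapSec g Jp Xm U₁).2 x) ((kapSec g Jp Xm U₂).2 x) (kap g Jp Xm x u).2 n
  have h3 : H x ((ε • Jm.app N₁) x) ((ε • Jm.app N₂) x) (ε • Jm x n) =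
      ε * H x (Jm x (N₁ x)) (Jm x (N₂ x)) (Jm x n) := by
    rw [ContMDiffSection.coe_smul, ContMDiffSection.coe_smul]
    simp only [Pi.smul_apply, map_smul, LinearMap.smul_apply, smul_eq_mul, EndField.app_apply]
    linear_combination ε * H x (Jm x (N₁ x)) (Jm x (N₂ x)) (Jm x n) * hε
  have h4 : H x ((ε • Jm.app N₁) x) (N₂ x) n = ε * H x (Jm x (N₁ x)) (N₂ x) n := by
    rw [ContMDiffSection.coe_smul]
    simp
  have h5 : H x (N₁ x) ((ε • Jm.app N₂) x) n = ε * H x (N₁ x) (Jm x (N₂ x)) n := by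
    rw [ContMDiffSection.coe_smul]
    simp
  have h6 : H x (N₁ x) (N₂ x) (ε • Jm x n) = ε * H x (N₁ x) (N₂ x) (Jm x n) := by simp
  simp only [brk, hD.scalarProd_dorfman, plusType, formType, h3, h4, h5, h6,
    plusVal_kapSec] at h1 h2 ⊢
  linear_combination h1 - h2

end
end BnGeometry

/-! ### The pseudo-Kähler condition as parallelism and vanishing torsion types. -/

namespace BnGeometry

noncomputable section

variable {E : Type*} [NormedAddCommGroup E] [NormedSpace ℝ E] [FiniteDimensional ℝ E]
  {M : Type*} [TopologicalSpace M] [ChartedSpace E M] [IsManifold 𝓘(ℝ, E) ∞ M]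
  {H : ThreeForm E M} {F : TwoForm E M} {g : PseudoRiemMetric E M} {D : Conn E M}
  {Jp Jm : EndField E M} {Xp Xm : VField E M} {c : SmoothFun E M}

theorem exists_plusVal_eq [T2Space M] (x : M) (u : Tan E x × ℝ) :
    ∃ U : VField E M × SmoothFun E M, plusVal U x = u := by
  obtain ⟨P, hP⟩ := exists_vField_apply_eq x u.1
  exact ⟨(P, ⟨fun _ => u.2, contMDiff_const⟩), Prod.ext hP rfl⟩

theorem plusProd_kapSec_generator
    (hc : ∀ x, IsComponentsAt (g x) (Jp x) (Jm x) (Xp x) (Xm x) (c x))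
    (U : VField E M × SmoothFun E M) (x : M) :
    plusProd g x (plusVal (kapSec g Jp Xm U) x) (plusVal (Xp, c) x) = 0 := by
  rw [plusVal_kapSec, plusProd_kap hc, kap_generator hc, map_zero, neg_zero]

/-- Since -κ² is the orthogonal projection onto the complement of u₀, applying it to any extension
makes the extension orthogonal everywhere and leaves the value at x unchanged. -/
theorem exists_orthogonal_plusVal_eq [T2Space M]
    (hc : ∀ x, IsComponentsAt (g x) (Jp x) (Jm x) (Xp x) (Xm x) (c x)) (x : M)
    {u : Tan E x × ℝ} (hu : plusProd g x u (plusVal (Xp, c) x) = 0) :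
    ∃ U : VField E M × SmoothFun E M,
      (∀ y, plusProd g y (plusVal U y) (plusVal (Xp, c) y) = 0) ∧ plusVal U x = u := by
  obtain ⟨U, hU⟩ := exists_plusVal_eq x u
  refine ⟨kapSec g Jp Xm (kapSec g Jp Xm (-U)), plusProd_kapSec_generator hc _, ?_⟩
  rw [plusVal_kapSec, plusVal_kapSec, plusVal_neg, hU, map_neg, map_neg, kap_kap hc, hu]
  simp

theorem plusD_neg_vec (U : VField E M × SmoothFun E M) (x : M) (v : Tan E x) :
    plusD H F g D U x (-v) = -plusD H F g D U x v := by
  have h : dirDeriv U.2 x (-v) = -dirDeriv U.2 x v := map_neg _ v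
  refine Prod.ext ?_ ?_
  · simp only [plusD, map_neg, Prod.fst_neg, ThreeForm.vec, TwoForm.vec, PseudoRiemMetric.sharp,
      LinearMap.neg_apply]
    module
  · simp only [plusD, map_neg, Prod.snd_neg, LinearMap.neg_apply, h]
    ring

/-- A mixed bracket sees no torsion and only one derivative survives; this isolates the connection
on E₊ in the directions of E₋. The next lemma does the same for E₋ in the directions of E₊. -/
theorem IsLeviCivita.brk_plus_minus [T2Space M] (hD : IsLeviCivita g D)
    (U : VField E M × SmoothFun E M) (N : VField E M) (x : M) (u : Tan E x × ℝ) :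
    brk H F g U 0 0 N x u 0 = -plusProd g x (plusD H F g D U x (N x)) u := by
  have h := hD.scalarProd_dorfman (H := H) (F := F) U 0 0 N x u 0
  rw [brk, h]
  simp [plusD_zero, minusD_zero, plusTor]

theorem IsLeviCivita.brk_minus_minus [T2Space M] (hD : IsLeviCivita g D)
    (N₁ N₂ : VField E M) (x : M) (u : Tan E x × ℝ) :
    brk H F g 0 0 N₁ N₂ x u 0 = -g x (minusD H F g D N₁ x u.1 u.2) (N₂ x) := by
  have h := hD.scalarProd_dorfman (H := H) (F := F) 0 0 N₁ N₂ x u 0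
  rw [brk, h]
  simp [plusD_zero, plusTor]

theorem kapSec_zero : kapSec g Jp Xm 0 = 0 := plusVal_ext fun x => by simp

theorem EndField.app_zero (J : EndField E M) : J.app 0 = 0 :=
  ContMDiffSection.ext fun x => by simp

/-- In the mixed equation for (U, N), the terms differentiated along εJ₋N change sign with ε. Adding
the equations for ε = 1 and ε = -1 leaves those along N, which say that κ commutes with the
derivative. -/
theorem plusParallel_of_bracketClosed [T2Space M] (hD : IsLeviCivita g D)
    (hc : ∀ x, IsComponentsAt (g x) (Jp x) (Jm x) (Xp x) (Xm x) (c x))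
    (h₁ : BracketClosed H F g Jp Jm Xp Xm c 1) (h₂ : BracketClosed H F g Jp Jm Xp Xm c (-1)) :
    PlusParallel H F g D Jp Xp Xm c := by
  intro U hU x v
  apply plusProd_ext (g := g)
  intro u
  obtain ⟨N, rfl⟩ := exists_vField_apply_eq x v
  have e₁ := h₁ U 0 hU (by simp) 0 N x u 0
  have e₂ := h₂ U 0 hU (by simp) 0 N x u 0
  simp only [kapSec_zero, EndField.app_zero, smul_zero, map_zero, one_smul, neg_one_smul,
    hD.brk_plus_minus] at e₁ e₂
  rw [ContMDiffSection.coe_neg] at e₂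
  simp only [Pi.neg_apply, plusD_neg_vec, map_neg,
    LinearMap.neg_apply] at e₂
  rw [plusProd_kap hc]
  linarith

/-- Here the terms along u = (v, b) are the ones odd in ε, so the difference of the two equations
isolates them. -/
theorem minusParallel_of_bracketClosed [T2Space M] (hD : IsLeviCivita g D)
    (hc : ∀ x, IsComponentsAt (g x) (Jp x) (Jm x) (Xp x) (Xm x) (c x))
    (h₁ : BracketClosed H F g Jp Jm Xp Xm c 1) (h₂ : BracketClosed H F g Jp Jm Xp Xm c (-1)) :
    MinusParallel H F g D Jm := by
  intro N x v b
  apply g.ext_left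
  intro z
  obtain ⟨N₂, rfl⟩ := exists_vField_apply_eq x z
  have e₁ := h₁ 0 0 (by simp) (by simp) N N₂ x (v, b) 0
  have e₂ := h₂ 0 0 (by simp) (by simp) N N₂ x (v, b) 0
  simp only [kapSec_zero, map_zero, smul_zero, hD.brk_minus_minus, minusD_smul_const] at e₁ e₂
  rw [ContMDiffSection.coe_smul] at e₁ e₂
  simp only [map_smul, smul_apply, Pi.smul_apply, EndField.app_apply, smul_eq_mul] at e₁ e₂
  rw [(hc x).Jm_skew]
  linarith

/-- The argument u₃ is not restricted to the complement of u₀: membership of a bracket in L is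
tested against L^⊥ = L ⊕ ℂu₀, so the component of the torsion along u₀ matters as well. -/
theorem pseudoKahler_iff [T2Space M] (hD : IsLeviCivita g D)
    {G : GenMetric E M} {𝓕 : Π x : M, Fib E x →ₗ[ℝ] Fib E x}
    (h𝓕 : IsGenAlmostPseudoHermitian G 𝓕) (hcomp : IsComponents G 𝓕 g Jp Jm Xp Xm c) :
    IsGenPseudoKahler H F G 𝓕 ↔
      PlusParallel H F g D Jp Xp Xm c ∧ MinusParallel H F g D Jm ∧
      (∀ x (u₁ u₂ u₃ : Tan E x × ℝ), plusProd g x u₁ (plusVal (Xp, c) x) = 0 →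
        plusProd g x u₂ (plusVal (Xp, c) x) = 0 → plusType H F g Jp Xm u₁ u₂ u₃ = 0) ∧
      (∀ x (n₁ n₂ n₃ : Tan E x), formType H Jm n₁ n₂ n₃ = 0) := by
  have hc := hcomp.isComponentsAt h𝓕
  have hpk : IsGenPseudoKahler H F G 𝓕 ↔
      BracketClosed H F g Jp Jm Xp Xm c 1 ∧ BracketClosed H F g Jp Jm Xp Xm c (-1) := by
    have ha := h𝓕.almostComplex
    have hb := hcomp.isGenAlmostComplex_second h𝓕
    rw [← bracketClosed_iff (𝓕 := 𝓕) hD hc (by norm_num) (fun x u n => by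
        rw [one_smul]; exact hcomp.apply_fib h𝓕 x u.1 n u.2) ha.smooth,
      ← bracketClosed_iff (𝓕 := fun x => G.Gend x ∘ₗ 𝓕 x) hD hc (by norm_num) (fun x u n => by
        rw [LinearMap.comp_apply, hcomp.apply_fib h𝓕, hcomp.Gend_fib, neg_one_smul]; rfl)
        hb.smooth]
    exact ⟨fun h => ⟨h.first.integrable, h.second.integrable⟩,
      fun h => ⟨h𝓕, ⟨ha, h.1⟩, ⟨hb, h.2⟩⟩⟩
  rw [hpk]
  constructor
  · rintro ⟨h₁, h₂⟩
    have hA := plusParallel_of_bracketClosed hD hc h₁ h₂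
    have hB := minusParallel_of_bracketClosed hD hc h₁ h₂
    refine ⟨hA, hB, ?_, ?_⟩
    · intro x u₁ u₂ u₃ hu₁ hu₂
      obtain ⟨U₁, hU₁, rfl⟩ := exists_orthogonal_plusVal_eq hc x hu₁
      obtain ⟨U₂, hU₂, rfl⟩ := exists_orthogonal_plusVal_eq hc x hu₂
      -- Vanishing E₋ parts isolate the type of T; below, vanishing E₊ parts isolate the type of H.
      have := bracketClosed_combination hD hc hA hB (ε := 1) (by norm_num) hU₁ hU₂ 0 0 x u₃ 0
      rw [h₁ U₁ U₂ hU₁ hU₂] at this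
      simpa [formType] using this.symm
    · intro x n₁ n₂ n₃
      obtain ⟨N₁, rfl⟩ := exists_vField_apply_eq x n₁
      obtain ⟨N₂, rfl⟩ := exists_vField_apply_eq x n₂
      have h0 : ∀ x, plusProd g x (plusVal (0 : VField E M × SmoothFun E M) x)
        (plusVal (Xp, c) x) = 0 := by simp
      have := bracketClosed_combination hD hc hA hB (ε := 1) (by norm_num) h0 h0 N₁ N₂ x 0 n₃
      rw [h₁ 0 0 h0 h0] at this
      simpa [plusType, plusTor] using this.symm
  · rintro ⟨hA, hB, hC, hD'⟩
    constructor <;>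
    · intro U₁ U₂ hU₁ hU₂ N₁ N₂ x u n
      rw [bracketClosed_combination hD hc hA hB (by norm_num) hU₁ hU₂,
        hC x _ _ _ (hU₁ x) (hU₂ x), hD']
      norm_num

end
end BnGeometry

namespace BnGeometry

noncomputable section

/-! ### Forms on the eigenbundles -/

namespace Cx

variable {V : Type*} [AddCommGroup V] [Module ℝ V]

theorem trilin_mk_left (T : V →ₗ[ℝ] V →ₗ[ℝ] V →ₗ[ℝ] ℝ) (a b : V) (z w : Cx V) :
    trilin T (mk a b) z w = bilin (T a) z w + Complex.I * bilin (T b) z w := rfl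

theorem trilin_ofReal_left (T : V →ₗ[ℝ] V →ₗ[ℝ] V →ₗ[ℝ] ℝ) (u : V) (z w : Cx V) :
    trilin T (ofReal u) z w = bilin (T u) z w := by
  simp [ofReal, trilin_mk_left, bilin, extend]

/-- The real condition is the imaginary part at p - i f(p) and q - i f(q). The real part adds
nothing, since replacing q by f(q) multiplies the second vector by i. -/
theorem bilin_add_I_mul_bilin_eq_zero_iff (B B' : V →ₗ[ℝ] V →ₗ[ℝ] ℝ) (f : V →ₗ[ℝ] V) :
    (∀ z ∈ iEigenspace f, ∀ w ∈ iEigenspace f,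
      bilin B z w + Complex.I * bilin B' z w = 0) ↔
    ∀ p ∈ sqNegOne f, ∀ q ∈ sqNegOne f, B p (f q) + B (f p) q = B' p q - B' (f p) (f q) := by
  have hexp : ∀ a b c d : V, bilin B (mk a b) (mk c d) + Complex.I * bilin B' (mk a b) (mk c d) =
      ((B a c - B b d - (B' a d + B' b c) : ℝ) : ℂ)
        + Complex.I * ((B a d + B b c + (B' a c - B' b d) : ℝ) : ℂ) := by
    intro a b c d
    rw [bilin_mk, bilin_mk]
    push_cast
    linear_combination ((B' a d : ℂ) + B' b c) * Complex.I_sq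
  constructor
  · intro h p hp q hq
    have := h _ (mk_neg_mem_iEigenspace hp) _ (mk_neg_mem_iEigenspace hq)
    rw [hexp, ofReal_add_I_mul_eq_zero] at this
    have := this.2
    simp only [map_neg, LinearMap.neg_apply] at this
    linarith
  · intro h z hz w hw
    have hq := im_mem_sqNegOne hw
    have hp := im_mem_sqNegOne hz
    have hq' := re_mem_sqNegOne hw
    obtain ⟨hz1, hz2⟩ := mem_iEigenspace.1 hz
    obtain ⟨hw1, hw2⟩ := mem_iEigenspace.1 hw
    have h1 := h _ hp _ hq
    have h2 := h _ hp _ hq'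
    rw [hz2, hw2] at h1
    rw [hz2, hw1] at h2
    simp only [map_neg] at h2
    refine (hexp z.re z.im w.re w.im).trans ?_
    rw [ofReal_add_I_mul_eq_zero]
    constructor <;> linarith

theorem bilin_eq_zero_iff (B : V →ₗ[ℝ] V →ₗ[ℝ] ℝ) (f : V →ₗ[ℝ] V) :
    (∀ z ∈ iEigenspace f, ∀ w ∈ iEigenspace f, bilin B z w = 0) ↔
    ∀ p ∈ sqNegOne f, ∀ q ∈ sqNegOne f, B p (f q) + B (f p) q = 0 := by
  have := bilin_add_I_mul_bilin_eq_zero_iff B 0 f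
  have h0 : ∀ z w : Cx V, bilin (0 : V →ₗ[ℝ] V →ₗ[ℝ] ℝ) z w = 0 := fun z w => by
    simp [bilin, extend]
  simpa [h0] using this

/-- With the first vector fixed as p - i f(p), the trilinear form becomes T(p) - i T(f(p)), so the
bilinear case applies. -/
theorem trilin_eq_zero_iff (T : V →ₗ[ℝ] V →ₗ[ℝ] V →ₗ[ℝ] ℝ) (f : V →ₗ[ℝ] V) :
    (∀ z ∈ iEigenspace f, ∀ w ∈ iEigenspace f, ∀ t ∈ iEigenspace f, trilin T z w t = 0) ↔
    ∀ p ∈ sqNegOne f, ∀ q ∈ sqNegOne f, ∀ r ∈ sqNegOne f,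
      T p q (f r) - T (f p) (f q) (f r) + T p (f q) r + T (f p) q r = 0 := by
  have hkey : ∀ p : V, (∀ w ∈ iEigenspace f, ∀ t ∈ iEigenspace f,
      trilin T (mk p (-f p)) w t = 0) ↔ ∀ q ∈ sqNegOne f, ∀ r ∈ sqNegOne f,
      T p q (f r) - T (f p) (f q) (f r) + T p (f q) r + T (f p) q r = 0 := by
    intro p
    simp only [trilin_mk_left, bilin_add_I_mul_bilin_eq_zero_iff, map_neg, LinearMap.neg_apply]
    refine forall₄_congr fun q _ r _ => ⟨fun h => by linarith, fun h => by linarith⟩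
  constructor
  · intro h p hp
    exact (hkey p).1 (h _ (mk_neg_mem_iEigenspace hp))
  · intro h z hz
    have hz' : z = mk z.re (-f z.re) := Cx.ext rfl (by simp [(mem_iEigenspace.1 hz).1])
    rw [hz']
    exact (hkey z.re).2 (h _ (re_mem_sqNegOne hz))

end Cx

variable {E : Type*} [NormedAddCommGroup E] [NormedSpace ℝ E] [FiniteDimensional ℝ E]
  {M : Type*} [TopologicalSpace M] [ChartedSpace E M] [IsManifold 𝓘(ℝ, E) ∞ M]
  {H : ThreeForm E M} {F : TwoForm E M} {g : PseudoRiemMetric E M} {D : Conn E M}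
  {Jp Jm : EndField E M} {Xp Xm : VField E M} {c : SmoothFun E M}

/-- A section A + iB of the eigenbundle satisfies JA = -B and JB = A, so it is determined by the
real field A in the kernel of J² + 1. That kernel need not be all of TM, as for J₊. -/
theorem preservesT10_iff {𝒟 : (Π x : M, Tan E x) → Π x : M, Tan E x → Tan E x}
    {J : EndField E M} (hneg : ∀ (Y : VField E M) x v, 𝒟 (⇑(-Y)) x v = -𝒟 Y x v) :
    PreservesT10 𝒟 J ↔ ∀ Y : VField E M, (∀ x, J x (J x (Y x)) = -Y x) →
      ∀ x v, 𝒟 (J.app Y) x v = J x (𝒟 Y x v) := by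
  constructor
  · intro h Y hY x v
    have h1 := h Y (-J.app Y) (fun x => by
      rw [T10, Cx.mk_mem_iEigenspace, ContMDiffSection.coe_neg, Pi.neg_apply, EndField.app_apply]
      simp [hY]) x v
    rw [T10, Cx.mk_mem_iEigenspace, hneg, neg_neg] at h1
    exact h1.1.symm
  · intro h A B hAB x v
    have hA : ∀ x, J x (A x) = -B x ∧ J x (B x) = A x := fun x => by
      have := hAB x
      rwa [T10, Cx.mk_mem_iEigenspace] at this
    have e1 : J.app A = -B := ContMDiffSection.ext fun x => by
      rw [EndField.app_apply, (hA x).1, ContMDiffSection.coe_neg, Pi.neg_apply]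
    have e2 : J.app B = A := ContMDiffSection.ext fun x => by rw [EndField.app_apply, (hA x).2]
    have h1 := h A (fun x => by rw [(hA x).1, map_neg, (hA x).2]) x v
    have h2 := h B (fun x => by rw [(hA x).2, (hA x).1]) x v
    rw [e1, hneg] at h1
    rw [e2] at h2
    rw [T10, Cx.mk_mem_iEigenspace]
    exact ⟨h1.symm, h2.symm⟩

theorem Dminus_eq_minusD (N : VField E M) (x : M) (v : Tan E x) :
    Dminus H g D N x v = minusD H F g D N x v 0 := by
  rw [minusD, zero_smul, sub_zero]
  rfl

/-- The derivative along v + gv + b is D⁻_v N - b F(N), affine in b. The constant term gives the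
condition on D⁻, and the coefficient of b says that F commutes with J₋, i.e. that F vanishes on
pairs of (1,0) vectors. -/
theorem minusParallel_iff [T2Space M]
    (hc : ∀ x, IsComponentsAt (g x) (Jp x) (Jm x) (Xp x) (Xm x) (c x)) :
    MinusParallel H F g D Jm ↔ PreservesT10 (Dminus H g D) Jm ∧
      ∀ x, ∀ Z ∈ T10 Jm x, ∀ W ∈ T10 Jm x, Cx.bilin (F x) Z W = 0 := by
  have hmem : ∀ x (p : Tan E x), p ∈ Cx.sqNegOne (Jm x : Tan E x →ₗ[ℝ] Tan E x) := fun x p => by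
    rw [Cx.mem_sqNegOne]
    exact (hc x).Jm_sq p
  rw [preservesT10_iff fun Y x v => by
    rw [Dminus_eq_minusD (F := F), Dminus_eq_minusD (F := F), minusD_neg]]
  simp only [T10, Cx.bilin_eq_zero_iff, hmem, forall_true_left, (hc _).Jm_sq,
    Dminus_eq_minusD (F := F)]
  have hF : ∀ x (p q : Tan E x), F x p (Jm x q) + F x (Jm x p) q =
      g x (F.vec g x (Jm x p) - Jm x (F.vec g x p)) q := fun x p q => by
    rw [map_sub, sub_apply, (hc x).Jm_skew, F.apply_vec, F.apply_vec]
    ring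
  constructor
  · intro h
    refine ⟨fun Y _ x v => h Y x v 0, fun x p q => ?_⟩
    obtain ⟨N, rfl⟩ := exists_vField_apply_eq x p
    have h0 := h N x 0 0
    have h1 := h N x 0 1
    have h2 : F.vec g x (Jm x (N x)) = Jm x (F.vec g x (N x)) := by
      simp only [minusD, zero_smul, sub_zero, one_smul, map_sub, EndField.app_apply] at h0 h1
      rw [h0] at h1
      exact sub_right_injective h1
    refine (hF x (N x) q).trans ?_
    rw [h2, sub_self, map_zero]
    rfl
  · rintro ⟨h, h'⟩ N x v b
    have h1 := h N (fun _ => trivial) x v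
    have h2 : F.vec g x (Jm x (N x)) = Jm x (F.vec g x (N x)) := by
      rw [← sub_eq_zero]
      exact g.nondegenerate x _ fun q => (hF x (N x) q).symm.trans (h' x (N x) q)
    simp only [minusD, zero_smul, sub_zero, EndField.app_apply] at h1 ⊢
    rw [h1, h2, map_sub, map_smul]

theorem formType_eq_zero_iff
    (hc : ∀ x, IsComponentsAt (g x) (Jp x) (Jm x) (Xp x) (Xm x) (c x)) :
    (∀ x (n₁ n₂ n₃ : Tan E x), formType H Jm n₁ n₂ n₃ = 0) ↔
      ∀ x, ∀ Z ∈ T10 Jm x, ∀ W ∈ T10 Jm x, ∀ V ∈ T10 Jm x, Cx.trilin (H x) Z W V = 0 := by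
  have hmem : ∀ x (p : Tan E x), p ∈ Cx.sqNegOne (Jm x : Tan E x →ₗ[ℝ] Tan E x) := fun x p => by
    rw [Cx.mem_sqNegOne]
    exact (hc x).Jm_sq p
  simp only [T10, Cx.trilin_eq_zero_iff, hmem, forall_true_left]
  rfl

end
end BnGeometry

namespace BnGeometry

noncomputable section

variable {E : Type*} [NormedAddCommGroup E] [NormedSpace ℝ E] [FiniteDimensional ℝ E]
  {M : Type*} [TopologicalSpace M] [ChartedSpace E M] [IsManifold 𝓘(ℝ, E) ∞ M]
  {H : ThreeForm E M} {F : TwoForm E M} {g : PseudoRiemMetric E M} {D : Conn E M}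
  {Jp Jm : EndField E M} {Xp Xm : VField E M} {c : SmoothFun E M}

/-! ### Parallelism of `𝓕` on `E₊` -/

theorem ThreeForm.vec_swap (H : ThreeForm E M) (g : PseudoRiemMetric E M) (x : M)
    (v w : Tan E x) : H.vec g x v w = -H.vec g x w v :=
  g.ext_left fun z => by
    rw [map_neg, neg_apply, H.apply_vec, H.apply_vec, H.swap_left]

theorem TwoForm.apply_vec_right (F : TwoForm E M) (g : PseudoRiemMetric E M) (x : M)
    (v w : Tan E x) : g x w (F.vec g x v) = F x v w := by rw [g.symm, F.apply_vec]

theorem Conn.zero_apply (D : Conn E M) (x : M) (v : Tan E x) : D (⇑(0 : VField E M)) x v = 0 := by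
  simpa only [zero_smul] using Conn.const_smul_apply D 0 0 x v

/-- The constant section `1` of `E₊`. -/
def plusOne : VField E M × SmoothFun E M := (0, ⟨fun _ => 1, contMDiff_const⟩)

@[simp] theorem plusVal_plusOne (x : M) : plusVal (plusOne : VField E M × SmoothFun E M) x = (0, 1) :=
  rfl

theorem plusD_plusOne (x : M) (v : Tan E x) :
    plusD H F g D plusOne x v = (-F.vec g x v, 0) := by
  have h : dirDeriv (⇑(plusOne : VField E M × SmoothFun E M).2) x v = 0 := dirDeriv_const 1 x v
  refine Prod.ext ?_ ?_
  · simp only [plusD]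
    simp only [plusOne, Conn.zero_apply]
    rw [ContMDiffSection.coe_zero, Pi.zero_apply]
    simp [ThreeForm.vec, PseudoRiemMetric.sharp]
  · simp only [plusD, h]
    simp [plusOne]

theorem plusD_vec (Y : VField E M) (x : M) (v : Tan E x) :
    plusD H F g D (Y, 0) x v = (D Y x v - (1 / 2 : ℝ) • H.vec g x v (Y x), F x v (Y x)) := by
  have h : dirDeriv (⇑(0 : SmoothFun E M)) x v = 0 := dirDeriv_const 0 x v
  refine Prod.ext ?_ ?_
  · simp [plusD]
  · simp only [plusD, h, zero_add]

theorem plusVal_mk (P : VField E M) (a : SmoothFun E M) (x : M) : plusVal (P, a) x = (P x, a x) :=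
  rfl

theorem kapSec_plusOne : kapSec g Jp Xm plusOne = (Xm, 0) := plusVal_ext fun x => by
  simp [kap, plusVal_mk]

theorem kapSec_generator
    (hc : ∀ x, IsComponentsAt (g x) (Jp x) (Jm x) (Xp x) (Xm x) (c x)) :
    kapSec g Jp Xm (Xp, c) = 0 := plusVal_ext fun x => by
  rw [plusVal_kapSec, kap_generator hc, plusVal_zero]

theorem kapSec_add (U W : VField E M × SmoothFun E M) :
    kapSec g Jp Xm (U + W) = kapSec g Jp Xm U + kapSec g Jp Xm W := plusVal_ext fun x => by simp

theorem kapSec_smulPlus (f : SmoothFun E M) (U : VField E M × SmoothFun E M) :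
    kapSec g Jp Xm (smulPlus f U) = smulPlus f (kapSec g Jp Xm U) := plusVal_ext fun x => by simp

/-- The defect of J₊² from -1 is a combination of X₊ and X₋, which are orthogonal and non-null;
pairing with each of them recovers its coefficient. This identifies W with X₊^⊥ ∩ X₋^⊥. -/
theorem IsComponentsAt.mem_sqNegOne {V : Type*} [AddCommGroup V] [Module ℝ V]
    [TopologicalSpace V] {g : V →L[ℝ] V →L[ℝ] ℝ} {Jp Jm : V →L[ℝ] V} {Xp Xm : V} {c : ℝ}
    (h : IsComponentsAt g Jp Jm Xp Xm c) (hX : 1 - c ^ 2 ≠ 0) {p : V} :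
    Jp (Jp p) = -p ↔ g Xp p = 0 ∧ g Xm p = 0 := by
  rw [h.Jp_sq]
  constructor
  · intro hp
    have h0 : g Xp p • Xp + g Xm p • Xm = 0 := by
      rwa [add_assoc, add_eq_left] at hp
    have h1 := congrArg (g Xp) h0
    have h2 := congrArg (g Xm) h0
    simp only [map_add, map_smul, smul_eq_mul, map_zero, h.Xp_Xp, h.Xm_Xm, h.Xm_Xp,
      h.symm Xp Xm, mul_zero, add_zero, zero_add] at h1 h2
    exact ⟨(mul_eq_zero.1 h1).resolve_right hX, (mul_eq_zero.1 h2).resolve_right hX⟩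
  · rintro ⟨h1, h2⟩
    rw [h1, h2]
    simp

/-- The covariant derivative of `𝓕` on `E₊` vanishes on the section `U`. -/
def KapParallel (H : ThreeForm E M) (F : TwoForm E M) (g : PseudoRiemMetric E M) (D : Conn E M)
    (Jp : EndField E M) (Xm : VField E M) (U : VField E M × SmoothFun E M) : Prop :=
  ∀ x (v : Tan E x),
    plusD H F g D (kapSec g Jp Xm U) x v = kap g Jp Xm x (plusD H F g D U x v)

theorem KapParallel.add {U W : VField E M × SmoothFun E M} (hU : KapParallel H F g D Jp Xm U)
    (hW : KapParallel H F g D Jp Xm W) : KapParallel H F g D Jp Xm (U + W) := fun x v => by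
  rw [kapSec_add, plusD_add, plusD_add, map_add, hU, hW]

theorem KapParallel.smulPlus {U : VField E M × SmoothFun E M}
    (hU : KapParallel H F g D Jp Xm U) (f : SmoothFun E M) :
    KapParallel H F g D Jp Xm (smulPlus f U) := fun x v => by
  rw [kapSec_smulPlus, plusD_smul, plusD_smul, map_add, map_smul, map_smul, hU, plusVal_kapSec]

theorem KapParallel.of_smulPlus {U : VField E M × SmoothFun E M} {f : SmoothFun E M}
    (hf : ∀ x, f x ≠ 0) (hU : KapParallel H F g D Jp Xm (BnGeometry.smulPlus f U)) :
    KapParallel H F g D Jp Xm U := fun x v => by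
  have h := hU x v
  rw [kapSec_smulPlus, plusD_smul, plusD_smul, map_add, map_smul, map_smul, plusVal_kapSec,
    add_left_inj] at h
  exact smul_right_injective _ (hf x) h

/-- The derivative of u₀ is orthogonal to u₀ because u₀ has constant norm, and to the complement of
u₀ because differentiation preserves that complement and the connection is metric. -/
theorem PlusParallel.plusD_generator [T2Space M] (hD : IsLeviCivita g D)
    (hc : ∀ x, IsComponentsAt (g x) (Jp x) (Jm x) (Xp x) (Xm x) (c x))
    (hA : PlusParallel H F g D Jp Xp Xm c) (x : M) (v : Tan E x) :
    plusD H F g D (Xp, c) x v = 0 := by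
  have h1 : plusProd g x (plusVal (Xp, c) x) (plusD H F g D (Xp, c) x v) = 0 := by
    have h := hD.dirDeriv_plusProd (H := H) (F := F) (Xp, c) (Xp, c) x v
    simp only [plusProd_self hc] at h
    rw [dirDeriv_const, plusProd_comm] at h
    linarith
  apply plusProd_ext (g := g)
  intro r
  have hr : plusProd g x (r - plusProd g x r (plusVal (Xp, c) x) • plusVal (Xp, c) x)
      (plusVal (Xp, c) x) = 0 := by
    simp [plusProd_self hc]
  obtain ⟨U, hU, hUx⟩ := exists_orthogonal_plusVal_eq hc x hr
  have h2 := hD.dirDeriv_plusProd (H := H) (F := F) U (Xp, c) x v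
  simp only [hU] at h2
  rw [dirDeriv_const, hA.orthogonal hc hU, hUx, map_sub, LinearMap.sub_apply, map_smul,
    LinearMap.smul_apply, h1, smul_zero, sub_zero, zero_add] at h2
  rw [plusProd_comm, ← h2, map_zero]
  rfl

theorem plusD_generator_iff (x : M) (v : Tan E x) :
    plusD H F g D (Xp, c) x v = 0 ↔
      D Xp x v = -(1 / 2 : ℝ) • H.vec g x (Xp x) v + c x • F.vec g x v ∧
        dirDeriv c x v = F x (Xp x) v := by
  rw [Prod.ext_iff]
  refine and_congr ?_ ?_
  · simp only [plusD, Prod.fst_zero]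
    rw [H.vec_swap g x v, sub_sub, sub_eq_zero]
    simp
  · simp only [plusD, Prod.snd_zero]
    rw [F.swap x v, ← sub_eq_add_neg, sub_eq_zero]

theorem plusD_Xm_of_eq (x : M) (v : Tan E x)
    (h : D Xm x v = -(1 / 2 : ℝ) • H.vec g x (Xm x) v - Jp x (F.vec g x v)) :
    plusD H F g D (Xm, 0) x v = (-Jp x (F.vec g x v), F x v (Xm x)) := by
  rw [plusD_vec, h, H.vec_swap g x v]
  refine Prod.ext ?_ rfl
  dsimp only
  module

theorem plusD_Xm_iff (x : M) (v : Tan E x) :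
    D Xm x v = -(1 / 2 : ℝ) • H.vec g x (Xm x) v - Jp x (F.vec g x v) ↔
      plusD H F g D (Xm, 0) x v = kap g Jp Xm x (plusD H F g D plusOne x v) := by
  constructor
  · intro h
    rw [plusD_Xm_of_eq x v h, plusD_plusOne]
    simp [kap, F.apply_vec_right]
  · intro h
    rw [plusD_vec, plusD_plusOne] at h
    have h1 := congrArg Prod.fst h
    simp only [kap, LinearMap.coe_mk, AddHom.coe_mk, zero_smul, add_zero, map_neg] at h1
    rw [H.vec_swap g x v, sub_eq_iff_eq_add] at h1
    rw [h1]
    module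

/-- Parallelism is available only orthogonally to u₀, so it is applied to 1 - c₊u₀, whose image
under κ is X₋. As u₀ is parallel, the remaining Leibniz term is a multiple of u₀ and is killed by κ.
-/
theorem PlusParallel.nabla_Xm [T2Space M] (hD : IsLeviCivita g D)
    (hc : ∀ x, IsComponentsAt (g x) (Jp x) (Jm x) (Xp x) (Xm x) (c x))
    (hA : PlusParallel H F g D Jp Xp Xm c) (x : M) (v : Tan E x) :
    plusD H F g D (Xm, 0) x v = kap g Jp Xm x (plusD H F g D plusOne x v) := by
  have h1 := hA (plusOne + smulPlus (-c) (Xp, c)) (fun y => by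
    rw [plusVal_add, plusVal_smulPlus, map_add, map_smul, LinearMap.add_apply,
      LinearMap.smul_apply, plusProd_self hc]
    simp [plusProd, plusVal_mk]) x v
  rw [kapSec_add, kapSec_smulPlus, kapSec_plusOne, kapSec_generator hc, plusD_add, plusD_add,
    plusD_smul, plusD_smul, hA.plusD_generator hD hc, map_add, map_add, map_smul, map_smul,
    kap_generator hc, plusD_zero] at h1
  simpa using h1

theorem kapSec_vec
    (hc : ∀ x, IsComponentsAt (g x) (Jp x) (Jm x) (Xp x) (Xm x) (c x))
    (hX : ∀ x, 1 - c x ^ 2 ≠ 0) {Y : VField E M} (hY : ∀ x, Jp x (Jp x (Y x)) = -Y x) :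
    kapSec g Jp Xm (Y, 0) = (Jp.app Y, 0) := plusVal_ext fun x => by
  rw [plusVal_kapSec]
  simp [kap, plusVal, (((hc x).mem_sqNegOne (hX x)).1 (hY x)).2]

theorem Dplus_eq (Y : VField E M) (x : M) (v : Tan E x) :
    Dplus H F g Jp Xp Xm c D Y x v = (plusD H F g D (Y, 0) x v).1
      + (c x / (1 - c x ^ 2) * F x v (Y x)) • Xp x
      - (1 / (1 - c x ^ 2) * g x (Jp x (F.vec g x v)) (Y x)) • Xm x := by
  rw [plusD_vec, Dplus, F.apply_vec]

/-- The terms in X₊ and X₋ of D⁺ replace the X₋ term that κ produces from the ℝ-component F(v, Y) of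
the derivative. Their coefficients work because J₊ exchanges X₊ and X₋ up to ±c₊. -/
theorem Dplus_app_eq_iff
    (hc : ∀ x, IsComponentsAt (g x) (Jp x) (Jm x) (Xp x) (Xm x) (c x))
    (hX : ∀ x, 1 - c x ^ 2 ≠ 0) {Y : VField E M} (hY : ∀ x, Jp x (Jp x (Y x)) = -Y x)
    (x : M) (v : Tan E x) :
    Dplus H F g Jp Xp Xm c D (Jp.app Y) x v = Jp x (Dplus H F g Jp Xp Xm c D Y x v) ↔
      (plusD H F g D (Jp.app Y, 0) x v).1 = (kap g Jp Xm x (plusD H F g D (Y, 0) x v)).1 := by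
  have h := hc x
  have e1 : (plusD H F g D (Y, 0) x v).2 = F x v (Y x) := by rw [plusD_vec]
  have e2 : g x (Jp x (F.vec g x v)) (Jp x (Y x)) = F x v (Y x) := by
    rw [h.Jp_skew, hY, map_neg, neg_neg, F.apply_vec]
  have e3 : g x (Jp x (F.vec g x v)) (Y x) = -F x v (Jp x (Y x)) := by
    rw [h.Jp_skew, F.apply_vec]
  rw [Dplus_eq, Dplus_eq, ← sub_eq_zero, ← sub_eq_zero (a := (plusD H F g D _ x v).1)]
  simp only [kap, LinearMap.coe_mk, AddHom.coe_mk, e1, EndField.app_apply, e2, e3, map_add,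
    map_sub, map_smul, h.Jp_Xp, h.Jp_Xm]
  -- This identity makes the total coefficient of X₋ equal to the one in κ.
  have e4 : (1 / (1 - c x ^ 2)) - c x / (1 - c x ^ 2) * c x = 1 := by
    have := hX x
    field_simp
  have e5 : ∀ (a b d e : Tan E x) (r s : ℝ),
      a + (c x / (1 - c x ^ 2) * r) • d - (1 / (1 - c x ^ 2) * s) • e
        - (b + (c x / (1 - c x ^ 2) * s) • -c x • e - (1 / (1 - c x ^ 2) * -r) • c x • d) =
      a - (b + (((1 / (1 - c x ^ 2)) - c x / (1 - c x ^ 2) * c x) * s) • e) := by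
    intro a b d e r s
    match_scalars <;> ring
  rw [e5, e4, one_mul]

/-- The covariant derivative of κ is tensorial, so in the converse direction it suffices to kill it
on u₀, on 1, on X₋ and on sections of W, which together span E₊. -/
theorem plusParallel_iff [T2Space M] (hD : IsLeviCivita g D)
    (hc : ∀ x, IsComponentsAt (g x) (Jp x) (Jm x) (Xp x) (Xm x) (c x))
    (hX : ∀ x, 1 - c x ^ 2 ≠ 0) :
    PlusParallel H F g D Jp Xp Xm c ↔
      PreservesT10 (Dplus H F g Jp Xp Xm c D) Jp ∧
      (∀ x (v : Tan E x),
        D Xp x v = -(1 / 2 : ℝ) • H.vec g x (Xp x) v + c x • F.vec g x v) ∧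
      (∀ x (v : Tan E x),
        D Xm x v = -(1 / 2 : ℝ) • H.vec g x (Xm x) v - Jp x (F.vec g x v)) ∧
      (∀ x (v : Tan E x), dirDeriv c x v = F x (Xp x) v) := by
  have hneg : ∀ (Y : VField E M) x v, Dplus H F g Jp Xp Xm c D (⇑(-Y)) x v =
      -Dplus H F g Jp Xp Xm c D Y x v := by
    intro Y x v
    have h : ((-Y, 0) : VField E M × SmoothFun E M) = -(Y, 0) := by simp
    rw [Dplus_eq, Dplus_eq, h, plusD_neg, ContMDiffSection.coe_neg]
    simp only [Pi.neg_apply, map_neg, Prod.fst_neg]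
    module
  rw [preservesT10_iff hneg]
  constructor
  · intro hA
    refine ⟨fun Y hY x v => ?_, fun x v => ((plusD_generator_iff x v).1
      (hA.plusD_generator hD hc x v)).1, fun x v => (plusD_Xm_iff x v).2 (hA.nabla_Xm hD hc x v),
      fun x v => ((plusD_generator_iff x v).1 (hA.plusD_generator hD hc x v)).2⟩
    have h := hA (Y, 0) (fun y => by
      simp [plusProd, plusVal, g.symm y (Y y), (((hc y).mem_sqNegOne (hX y)).1 (hY y)).1]) x v
    rw [kapSec_vec hc hX hY] at h
    rw [Dplus_app_eq_iff hc hX hY, h]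
  · rintro ⟨hP, hXp, hXm, hdc⟩
    have hu₀ : ∀ x v, plusD H F g D (Xp, c) x v = 0 := fun x v =>
      (plusD_generator_iff x v).2 ⟨hXp x v, hdc x v⟩
    have k₀ : KapParallel H F g D Jp Xm (Xp, c) := fun x v => by
      rw [kapSec_generator hc, plusD_zero, hu₀, map_zero]
    have k₁ : KapParallel H F g D Jp Xm plusOne := fun x v => by
      rw [kapSec_plusOne]
      exact (plusD_Xm_iff x v).1 (hXm x v)
    have k₂ : KapParallel H F g D Jp Xm (Xm, 0) := fun x v => by
      have h := hc x
      -- X₋ = κ1, so κX₋ = κ²1 = -1 + c₊u₀; the derivative of the right-hand side is then known from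
      -- `hu₀` and `hdc`.
      have e : kapSec g Jp Xm (Xm, 0) = smulPlus c (Xp, c) + -plusOne := plusVal_ext fun y => by
        rw [plusVal_kapSec]
        simp [kap, plusVal_mk, (hc y).Jp_Xm, (hc y).Xm_Xm]
        ring
      have e1 : F x v (Xp x) = g x (Xp x) (F.vec g x v) := (F.apply_vec_right g x v _).symm
      have e2 : F x v (Xm x) = g x (Xm x) (F.vec g x v) := (F.apply_vec_right g x v _).symm
      have e3 : g x (Xm x) (Jp x (F.vec g x v)) = -(c x * g x (Xp x) (F.vec g x v)) := by
        have := h.Jp_skew (Xm x) (F.vec g x v)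
        rw [h.Jp_Xm, map_smul, smul_apply, smul_eq_mul] at this
        linarith
      rw [e, plusD_add, plusD_smul, plusD_neg, plusD_plusOne, hu₀, plusD_Xm_of_eq x v (hXm x v),
        hdc, F.swap x (Xp x), e1, e2]
      refine Prod.ext ?_ ?_
      · simp only [kap, plusVal, LinearMap.coe_mk, AddHom.coe_mk, Prod.fst_add, Prod.smul_fst,
          Prod.fst_neg, Prod.fst_zero, map_neg, h.Jp_sq]
        module
      · simp only [kap, plusVal, LinearMap.coe_mk, AddHom.coe_mk, Prod.snd_add, Prod.smul_snd,
          Prod.snd_neg, Prod.snd_zero, map_neg, e3, smul_eq_mul]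
        ring
    have k₃ : ∀ Y : VField E M, (∀ x, Jp x (Jp x (Y x)) = -Y x) →
        KapParallel H F g D Jp Xm (Y, 0) := by
      intro Y hY x v
      have h0 := hD.dirDeriv_plusProd (H := H) (F := F) (Xm, 0) (Y, 0) x v
      -- D⁺ controls only the TM-component. The ℝ-component follows by differentiating g(X₋, Y) = 0.
      have h1 : ∀ y, plusProd g y (plusVal (Xm, 0) y) (plusVal (Y, 0) y) = 0 := fun y => by
        simp [plusProd, plusVal, (((hc y).mem_sqNegOne (hX y)).1 (hY y)).2]
      simp only [h1] at h0
      rw [dirDeriv_const, plusD_Xm_of_eq x v (hXm x v)] at h0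
      simp only [plusProd, plusVal, LinearMap.mk₂_apply, map_neg, neg_apply, (hc x).Jp_skew,
        F.apply_vec] at h0
      rw [kapSec_vec hc hX hY]
      refine Prod.ext ((Dplus_app_eq_iff hc hX hY x v).1 (hP Y hY x v)) ?_
      simp only [kap, LinearMap.coe_mk, AddHom.coe_mk]
      rw [plusD_vec (Jp.app Y)]
      simp only [EndField.app_apply]
      simp at h0
      linarith
    intro U _
    let f : SmoothFun E M := 1 - c * c
    have hf : ∀ x, f x = 1 - c x ^ 2 := fun x => by
      simp only [f, sq]
      rfl
    -- This is 1 - c₊² times the projection of the vector part of U onto W. The factor avoids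
    -- dividing smooth functions and is removed by `KapParallel.of_smulPlus`.
    let Y : VField E M := smulField f U.1 + -smulField (g.inner Xp U.1) Xp
      + -smulField (g.inner Xm U.1) Xm
    have hYx : ∀ x, Y x = (1 - c x ^ 2) • U.1 x - g x (Xp x) (U.1 x) • Xp x
        - g x (Xm x) (U.1 x) • Xm x := fun x => by
      rw [← hf]
      simp only [Y, sub_eq_add_neg]
      rfl
    have hY : ∀ x, Jp x (Jp x (Y x)) = -Y x := fun x => by
      rw [(hc x).mem_sqNegOne (hX x), hYx]
      simp only [map_sub, map_smul, smul_eq_mul, (hc x).Xp_Xp, (hc x).Xm_Xm, (hc x).Xm_Xp,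
        (hc x).symm (Xp x) (Xm x)]
      constructor <;> ring
    refine KapParallel.of_smulPlus (f := f) (fun x => by rw [hf]; exact hX x) ?_
    have e : smulPlus f U = (Y, 0) + smulPlus (g.inner Xp U.1) (Xp, c)
        + smulPlus (g.inner Xm U.1) (Xm, 0)
        + smulPlus (f * U.2 - g.inner Xp U.1 * c) plusOne := plusVal_ext fun x => by
      have h0 : plusVal (Y, (0 : SmoothFun E M)) x = (Y x, 0) := rfl
      have h1 : (f * U.2 - g.inner Xp U.1 * c) x =
        (1 - c x ^ 2) * U.2 x - g x (Xp x) (U.1 x) * c x := by rw [← hf]; rfl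
      simp only [plusVal_add, plusVal_smulPlus, h0, h1, hYx, hf, plusVal_plusOne,
        PseudoRiemMetric.inner_apply]
      refine Prod.ext ?_ ?_
      · simp only [plusVal, Prod.fst_add, Prod.smul_fst]
        module
      · simp [plusVal]
    rw [e]
    exact (((k₃ Y hY).add (k₀.smulPlus _)).add (k₂.smulPlus _)).add (k₁.smulPlus _)

end
end BnGeometry

namespace BnGeometry

noncomputable section

variable {E : Type*} [NormedAddCommGroup E] [NormedSpace ℝ E] [FiniteDimensional ℝ E]
  {M : Type*} [TopologicalSpace M] [ChartedSpace E M] [IsManifold 𝓘(ℝ, E) ∞ M]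
  {H : ThreeForm E M} {F : TwoForm E M} {g : PseudoRiemMetric E M} {D : Conn E M}
  {Jp Jm : EndField E M} {Xp Xm : VField E M} {c : SmoothFun E M}

/-! ### The type of the torsion on `E₊` -/

theorem plusTor_add (x : M) (u u' v w : Tan E x × ℝ) :
    plusTor H F (u + u') v w = plusTor H F u v w + plusTor H F u' v w := by
  simp only [plusTor, Prod.fst_add, Prod.snd_add, map_add, LinearMap.add_apply]
  ring

theorem plusTor_smul (x : M) (r : ℝ) (u v w : Tan E x × ℝ) :
    plusTor H F (r • u) v w = r * plusTor H F u v w := by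
  simp only [plusTor, Prod.smul_fst, Prod.smul_snd, map_smul, LinearMap.smul_apply, smul_eq_mul]
  ring

theorem plusTor_swap_left (x : M) (u v w : Tan E x × ℝ) :
    plusTor H F u v w = -plusTor H F v u w := by
  simp only [plusTor]
  rw [H.swap_left, F.swap x u.1 v.1, F.swap x v.1 w.1, F.swap x w.1 u.1]
  ring

theorem plusTor_swap_right (x : M) (u v w : Tan E x × ℝ) :
    plusTor H F u v w = -plusTor H F u w v := by
  simp only [plusTor]
  rw [H.swap_right, F.swap x u.1 v.1, F.swap x v.1 w.1, F.swap x w.1 u.1]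
  ring

theorem plusType_add (x : M) (u u' v w : Tan E x × ℝ) :
    plusType H F g Jp Xm (u + u') v w =
      plusType H F g Jp Xm u v w + plusType H F g Jp Xm u' v w := by
  simp only [plusType, map_add, plusTor_add]
  ring

theorem plusType_smul (x : M) (r : ℝ) (u v w : Tan E x × ℝ) :
    plusType H F g Jp Xm (r • u) v w = r * plusType H F g Jp Xm u v w := by
  simp only [plusType, map_smul, plusTor_smul]
  ring

theorem plusType_swap_left (x : M) (u v w : Tan E x × ℝ) :
    plusType H F g Jp Xm u v w = -plusType H F g Jp Xm v u w := by
  simp only [plusType]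
  rw [plusTor_swap_left x u v, plusTor_swap_left x (kap g Jp Xm x u) (kap g Jp Xm x v),
    plusTor_swap_left x (kap g Jp Xm x u) v, plusTor_swap_left x u (kap g Jp Xm x v)]
  ring

theorem plusType_swap_right (x : M) (u v w : Tan E x × ℝ) :
    plusType H F g Jp Xm u v w = -plusType H F g Jp Xm u w v := by
  simp only [plusType]
  rw [plusTor_swap_right x u v, plusTor_swap_right x _ (kap g Jp Xm x v) (kap g Jp Xm x w),
    plusTor_swap_right x _ v w, plusTor_swap_right x _ _ w]
  ring

/-- `plusType` is, up to sign, the imaginary part of a complex trilinear form at the vectors u -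
iκu, and applying κ to u multiplies such a vector by i. -/
theorem plusType_kap_left
    (hc : ∀ x, IsComponentsAt (g x) (Jp x) (Jm x) (Xp x) (Xm x) (c x)) (x : M)
    {u v : Tan E x × ℝ} (w : Tan E x × ℝ)
    (hu : plusProd g x u (plusVal (Xp, c) x) = 0) (hv : plusProd g x v (plusVal (Xp, c) x) = 0) :
    plusType H F g Jp Xm (kap g Jp Xm x u) v w = plusType H F g Jp Xm u (kap g Jp Xm x v) w := by
  have e1 : ∀ w, plusTor H F (-u) v w = -plusTor H F u v w := fun w => by
    have := plusTor_smul (H := H) (F := F) x (-1) u v w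
    simpa using this
  have e2 : ∀ u w, plusTor H F u (-v) w = -plusTor H F u v w := fun u w => by
    have := plusTor_smul (H := H) (F := F) x (-1) v u w
    rw [plusTor_swap_left x v u, plusTor_swap_left x _ u, neg_one_smul] at this
    linarith
  have e3 : ∀ v w, plusTor H F (-u) v w = -plusTor H F u v w := fun v w => by
    have := plusTor_smul (H := H) (F := F) x (-1) u v w
    simpa using this
  simp only [plusType, kap_kap hc, hu, hv, zero_smul, add_zero, e2, e3]
  ring

theorem plusType_kap_right
    (hc : ∀ x, IsComponentsAt (g x) (Jp x) (Jm x) (Xp x) (Xm x) (c x)) (x : M)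
    (u : Tan E x × ℝ) {v w : Tan E x × ℝ}
    (hv : plusProd g x v (plusVal (Xp, c) x) = 0) (hw : plusProd g x w (plusVal (Xp, c) x) = 0) :
    plusType H F g Jp Xm u v (kap g Jp Xm x w) = plusType H F g Jp Xm u (kap g Jp Xm x v) w := by
  rw [plusType_swap_left x u, plusType_swap_left x u, plusType_swap_right x v,
    plusType_swap_right x _ u, plusType_swap_left x v, plusType_swap_left x _ w,
    plusType_kap_left hc x u hw hv]

/-- The vector `1 - c₊ (X₊ + g X₊ + c₊)` of `E₊`. -/
def plusV (Xp : VField E M) (c : SmoothFun E M) (x : M) : Tan E x × ℝ :=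
  (-c x • Xp x, 1 - c x ^ 2)

theorem kap_plusV
    (hc : ∀ x, IsComponentsAt (g x) (Jp x) (Jm x) (Xp x) (Xm x) (c x)) (x : M) :
    kap g Jp Xm x (plusV Xp c x) = (Xm x, 0) := by
  refine Prod.ext ?_ ?_
  · simp only [kap, plusV, LinearMap.coe_mk, AddHom.coe_mk, map_smul, (hc x).Jp_Xp]
    module
  · simp [kap, plusV, (hc x).Xm_Xp]

theorem plusV_orthogonal
    (hc : ∀ x, IsComponentsAt (g x) (Jp x) (Jm x) (Xp x) (Xm x) (c x)) (x : M) :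
    plusProd g x (plusV Xp c x) (plusVal (Xp, c) x) = 0 := by
  simp only [plusProd, plusV, plusVal, LinearMap.mk₂_apply, map_smul, smul_apply, (hc x).Xp_Xp,
    smul_eq_mul]
  ring

theorem plusProd_Xm_generator
    (hc : ∀ x, IsComponentsAt (g x) (Jp x) (Jm x) (Xp x) (Xm x) (c x)) (x : M) :
    plusProd g x (Xm x, 0) (plusVal (Xp, c) x) = 0 := by
  simp [plusProd, plusVal, (hc x).Xm_Xp]

theorem plusProd_vec_generator
    (hc : ∀ x, IsComponentsAt (g x) (Jp x) (Jm x) (Xp x) (Xm x) (c x))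
    (hX : ∀ x, 1 - c x ^ 2 ≠ 0) {x : M} {y : Tan E x} (hy : Jp x (Jp x y) = -y) :
    plusProd g x (y, 0) (plusVal (Xp, c) x) = 0 := by
  simp [plusProd, plusVal, (hc x).symm y, (((hc x).mem_sqNegOne (hX x)).1 hy).1]

theorem kap_vec
    (hc : ∀ x, IsComponentsAt (g x) (Jp x) (Jm x) (Xp x) (Xm x) (c x))
    (hX : ∀ x, 1 - c x ^ 2 ≠ 0) {x : M} {y : Tan E x} (hy : Jp x (Jp x y) = -y) :
    kap g Jp Xm x (y, 0) = (Jp x y, 0) := by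
  simp [kap, (((hc x).mem_sqNegOne (hX x)).1 hy).2]

/-- The complement of u₀ in E₊ is spanned by W, `plusV` and X₋; non-nullity of X₊ and X₋ is what
allows the coefficients to be divided by 1 - c₊². -/
theorem orthogonal_induction
    (hc : ∀ x, IsComponentsAt (g x) (Jp x) (Jm x) (Xp x) (Xm x) (c x))
    (hX : ∀ x, 1 - c x ^ 2 ≠ 0) {x : M} {P : Tan E x × ℝ → Prop}
    (hadd : ∀ u w, P u → P w → P (u + w)) (hsmul : ∀ (r : ℝ) u, P u → P (r • u))
    (hW : ∀ y : Tan E x, Jp x (Jp x y) = -y → P (y, 0)) (hV : P (plusV Xp c x))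
    (hXm : P (Xm x, 0)) {u : Tan E x × ℝ} (hu : plusProd g x u (plusVal (Xp, c) x) = 0) :
    P u := by
  have h := hc x
  have hX := hX x
  simp only [plusProd, plusVal, LinearMap.mk₂_apply] at hu
  rw [h.symm] at hu
  set y : Tan E x := u.1 - (g x (Xp x) u.1 / (1 - c x ^ 2)) • Xp x
    - (g x (Xm x) u.1 / (1 - c x ^ 2)) • Xm x with hy
  have hyW : Jp x (Jp x y) = -y := by
    rw [h.mem_sqNegOne hX, hy]
    simp only [map_sub, map_smul, smul_eq_mul, h.Xp_Xp, h.Xm_Xm, h.Xm_Xp, h.symm (Xp x) (Xm x)]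
    constructor <;> field_simp <;> ring
  have e : u = (y, 0) + (u.2 / (1 - c x ^ 2)) • plusV Xp c x
      + (g x (Xm x) u.1 / (1 - c x ^ 2)) • (Xm x, (0 : ℝ)) := by
    have h1 : g x (Xp x) u.1 = -(u.2 * c x) := by linarith
    refine Prod.ext ?_ ?_
    · simp only [hy, h1, plusV, Prod.fst_add, Prod.smul_fst]
      match_scalars <;> ring
    · simp only [plusV, Prod.snd_add, Prod.smul_snd, smul_eq_mul]
      field_simp
      ring
  rw [e]
  exact hadd _ _ (hadd _ _ (hW y hyW) (hsmul _ _ hV)) (hsmul _ _ hXm)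

theorem plusType_vec
    (hc : ∀ x, IsComponentsAt (g x) (Jp x) (Jm x) (Xp x) (Xm x) (c x))
    (hX : ∀ x, 1 - c x ^ 2 ≠ 0) {x : M} {p q r : Tan E x} (hp : Jp x (Jp x p) = -p)
    (hq : Jp x (Jp x q) = -q) (hr : Jp x (Jp x r) = -r) :
    plusType H F g Jp Xm (p, 0) (q, 0) (r, 0) = formType H Jp p q r := by
  simp [plusType, plusTor, formType, kap_vec hc hX hp, kap_vec hc hX hq, kap_vec hc hX hr]

theorem plusType_plusV
    (hc : ∀ x, IsComponentsAt (g x) (Jp x) (Jm x) (Xp x) (Xm x) (c x))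
    (hX : ∀ x, 1 - c x ^ 2 ≠ 0) {x : M} {p q : Tan E x} (hp : Jp x (Jp x p) = -p)
    (hq : Jp x (Jp x q) = -q) :
    plusType H F g Jp Xm (p, 0) (q, 0) (plusV Xp c x) =
      H x (Xm x) p q - H x (Xm x) (Jp x p) (Jp x q)
        - c x * (H x (Xp x) p (Jp x q) + H x (Xp x) (Jp x p) q)
        - (1 - c x ^ 2) * (F x p (Jp x q) + F x (Jp x p) q) := by
  simp only [plusType, kap_vec hc hX hp, kap_vec hc hX hq, kap_plusV hc]
  simp only [plusTor, plusV, map_smul, smul_eq_mul, ← H.rotate x (Xm x), ← H.rotate x (Xp x)]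
  ring

theorem plusType_generator
    (hc : ∀ x, IsComponentsAt (g x) (Jp x) (Jm x) (Xp x) (Xm x) (c x))
    (hX : ∀ x, 1 - c x ^ 2 ≠ 0) {x : M} {p q : Tan E x} (hp : Jp x (Jp x p) = -p)
    (hq : Jp x (Jp x q) = -q) :
    plusType H F g Jp Xm (p, 0) (q, 0) (plusVal (Xp, c) x) =
      H x (Xp x) p (Jp x q) + H x (Xp x) (Jp x p) q
        - c x * (F x p (Jp x q) + F x (Jp x p) q) := by
  have h0 : ∀ u v : Tan E x × ℝ, plusTor H F u v 0 = 0 := fun u v => by simp [plusTor]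
  simp only [plusType, kap_generator hc, h0]
  simp only [plusTor, kap_vec hc hX hp, kap_vec hc hX hq, plusVal, ← H.rotate x (Xp x)]
  ring

/-- The value of `[X₊, X₋]` in terms of `H` and `F`. -/
def commVec (H : ThreeForm E M) (F : TwoForm E M) (g : PseudoRiemMetric E M)
    (Jp : EndField E M) (Xp Xm : VField E M) (c : SmoothFun E M) (x : M) : Tan E x :=
  H.vec g x (Xp x) (Xm x) - Jp x (F.vec g x (Xp x)) - c x • F.vec g x (Xm x)

/-- This component of the torsion is the source of the condition [X₊, X₋] = 0. -/
theorem plusType_plusV_generator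
    (hc : ∀ x, IsComponentsAt (g x) (Jp x) (Jm x) (Xp x) (Xm x) (c x))
    (hX : ∀ x, 1 - c x ^ 2 ≠ 0) {x : M} {p : Tan E x} (hp : Jp x (Jp x p) = -p) :
    plusType H F g Jp Xm (p, 0) (plusV Xp c x) (plusVal (Xp, c) x) =
      -g x (commVec H F g Jp Xp Xm c x) p := by
  have h0 : ∀ u v : Tan E x × ℝ, plusTor H F u v 0 = 0 := fun u v => by simp [plusTor]
  have h1 : H x p (Xm x) (Xp x) = -H x (Xp x) (Xm x) p := by
    rw [H.swap_left, H.swap_right, H.swap_left, neg_neg]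
  simp only [plusType, kap_generator hc, h0, kap_plusV hc, kap_vec hc hX hp]
  simp only [commVec, map_sub, map_smul, sub_apply, smul_apply, (hc x).Jp_skew, H.apply_vec,
    F.apply_vec, plusTor, plusV, plusVal, smul_eq_mul, H.alternating_right, h1,
    F.swap x p (Xm x), F.swap x (Jp x p) (Xp x), LinearMap.smul_apply]
  ring

/-- The vector is automatically orthogonal to X₊ and X₋, by antisymmetry of H and F and the values
of J₊ on X₊ and X₋, so only its pairing with W is a condition. -/
theorem commVec_eq_zero_iff
    (hc : ∀ x, IsComponentsAt (g x) (Jp x) (Jm x) (Xp x) (Xm x) (c x))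
    (hX : ∀ x, 1 - c x ^ 2 ≠ 0) (x : M) :
    commVec H F g Jp Xp Xm c x = 0 ↔
      ∀ p, Jp x (Jp x p) = -p → g x (commVec H F g Jp Xp Xm c x) p = 0 := by
  have h := hc x
  constructor
  · intro h0 p _
    rw [h0, map_zero]
    rfl
  · intro h0
    have e1 : g x (commVec H F g Jp Xp Xm c x) (Xp x) = 0 := by
      simp only [commVec, map_sub, map_smul, sub_apply, smul_apply, h.Jp_skew, H.apply_vec,
        F.apply_vec, smul_eq_mul, h.Jp_Xp]
      rw [H.swap_left, H.alternating_right, F.swap x (Xm x)]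
      ring
    have e2 : g x (commVec H F g Jp Xp Xm c x) (Xm x) = 0 := by
      simp only [commVec, map_sub, map_smul, sub_apply, smul_apply, h.Jp_skew, H.apply_vec,
        F.apply_vec, smul_eq_mul, h.Jp_Xm, H.alternating_right, F.alternating]
      ring
    refine g.nondegenerate x _ fun w => ?_
    have e3 := h0 ((1 - c x ^ 2) • w - g x (Xp x) w • Xp x - g x (Xm x) w • Xm x) (by
      rw [h.mem_sqNegOne (hX x)]
      simp only [map_sub, map_smul, smul_eq_mul, h.Xp_Xp, h.Xm_Xm, h.Xm_Xp,
        h.symm (Xp x) (Xm x)]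
      constructor <;> ring)
    rw [map_sub, map_sub, map_smul, map_smul, map_smul, e1, e2, smul_zero, smul_zero, sub_zero,
      sub_zero, smul_eq_mul] at e3
    exact (mul_eq_zero.1 e3).resolve_left (hX x)

/-- By alternation and compatibility with κ, the type of T is determined on the triples (W, W, W),
(W, W, V), (W, W, u₀) and (W, V, u₀). All others vanish or reduce to these: V and X₋ = κV span one
complex line. -/
theorem plusType_eq_zero_iff
    (hc : ∀ x, IsComponentsAt (g x) (Jp x) (Jm x) (Xp x) (Xm x) (c x))
    (hX : ∀ x, 1 - c x ^ 2 ≠ 0) (x : M) :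
    (∀ u₁ u₂ u₃ : Tan E x × ℝ, plusProd g x u₁ (plusVal (Xp, c) x) = 0 →
        plusProd g x u₂ (plusVal (Xp, c) x) = 0 → plusType H F g Jp Xm u₁ u₂ u₃ = 0) ↔
      commVec H F g Jp Xp Xm c x = 0 ∧
      (∀ p : Tan E x, Jp x (Jp x p) = -p → ∀ q, Jp x (Jp x q) = -q → ∀ r, Jp x (Jp x r) = -r →
        formType H Jp p q r = 0) ∧
      (∀ p : Tan E x, Jp x (Jp x p) = -p → ∀ q, Jp x (Jp x q) = -q →
        H x (Xp x) p (Jp x q) + H x (Xp x) (Jp x p) q =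
          c x * (H x (Xm x) p q - H x (Xm x) (Jp x p) (Jp x q))) ∧
      (∀ p : Tan E x, Jp x (Jp x p) = -p → ∀ q, Jp x (Jp x q) = -q →
        F x p (Jp x q) + F x (Jp x p) q = H x (Xm x) p q - H x (Xm x) (Jp x p) (Jp x q)) := by
  have hv := plusV_orthogonal hc x
  have hm := plusProd_Xm_generator hc x
  have hW : ∀ p : Tan E x, Jp x (Jp x p) = -p → plusProd g x (p, 0) (plusVal (Xp, c) x) = 0 :=
    fun p hp => plusProd_vec_generator hc hX hp
  have hJ : ∀ p : Tan E x, Jp x (Jp x p) = -p → Jp x (Jp x (Jp x p)) = -Jp x p := fun p hp => by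
    rw [hp, map_neg]
  rw [commVec_eq_zero_iff hc hX]
  constructor
  · intro h
    have h1 : ∀ p : Tan E x, Jp x (Jp x p) = -p → ∀ q, Jp x (Jp x q) = -q →
        F x p (Jp x q) + F x (Jp x p) q = H x (Xm x) p q - H x (Xm x) (Jp x p) (Jp x q) ∧
        H x (Xp x) p (Jp x q) + H x (Xp x) (Jp x p) q =
          c x * (H x (Xm x) p q - H x (Xm x) (Jp x p) (Jp x q)) := by
      intro p hp q hq
      have e1 := h _ _ (plusV Xp c x) (hW p hp) (hW q hq)
      have e2 := h _ _ (plusVal (Xp, c) x) (hW p hp) (hW q hq)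
      rw [plusType_plusV hc hX hp hq] at e1
      rw [plusType_generator hc hX hp hq] at e2
      have e3 : F x p (Jp x q) + F x (Jp x p) q =
          H x (Xm x) p q - H x (Xm x) (Jp x p) (Jp x q) := by
        -- Eliminating the X₊ term between the V and u₀ equations makes the coefficient of F equal
        -- to (1 - c₊²) + c₊² = 1.
        linear_combination -e1 - c x * e2
      exact ⟨e3, by rw [← e3]; linarith⟩
    refine ⟨fun p hp => ?_, fun p hp q hq r hr => ?_, fun p hp q hq => (h1 p hp q hq).2,
      fun p hp q hq => (h1 p hp q hq).1⟩
    · have := h _ _ (plusVal (Xp, c) x) (hW p hp) hv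
      rwa [plusType_plusV_generator hc hX hp, neg_eq_zero] at this
    · rw [← plusType_vec (F := F) hc hX hp hq hr]
      exact h _ _ _ (hW p hp) (hW q hq)
  · rintro ⟨hβ, hT, hA, hB⟩
    have ind : ∀ v w : Tan E x × ℝ,
        (∀ y : Tan E x, Jp x (Jp x y) = -y → plusType H F g Jp Xm (y, 0) v w = 0) →
        plusType H F g Jp Xm (plusV Xp c x) v w = 0 → plusType H F g Jp Xm (Xm x, 0) v w = 0 →
        ∀ u, plusProd g x u (plusVal (Xp, c) x) = 0 → plusType H F g Jp Xm u v w = 0 := by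
      intro v w h1 h2 h3 u hu
      exact orthogonal_induction hc hX (P := fun u => plusType H F g Jp Xm u v w = 0)
        (fun u u' h h' => by rw [plusType_add, h, h', add_zero])
        (fun r u h => by rw [plusType_smul, h, mul_zero]) h1 h2 h3 hu
    have self : ∀ u v : Tan E x × ℝ, plusType H F g Jp Xm u v v = 0 := fun u v => by
      have := plusType_swap_right (H := H) (F := F) (g := g) (Jp := Jp) (Xm := Xm) x u v v
      linarith
    have rot : ∀ u v w : Tan E x × ℝ,
        plusType H F g Jp Xm u v w = plusType H F g Jp Xm v w u := fun u v w => by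
      rw [plusType_swap_left, plusType_swap_right, neg_neg]
    -- Letters in the names record the arguments: y in W, v for `plusV`, m for X₋, s for any vector
    -- orthogonal to u₀, and 0 for u₀. The letters s are filled in one at a time by `ind`.
    have yyv : ∀ p : Tan E x, Jp x (Jp x p) = -p → ∀ q, Jp x (Jp x q) = -q →
        plusType H F g Jp Xm (p, 0) (q, 0) (plusV Xp c x) = 0 := fun p hp q hq => by
      rw [plusType_plusV hc hX hp hq, hA p hp q hq, hB p hp q hq]
      ring
    have yym : ∀ p : Tan E x, Jp x (Jp x p) = -p → ∀ q, Jp x (Jp x q) = -q →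
        plusType H F g Jp Xm (p, 0) (q, 0) (Xm x, 0) = 0 := fun p hp q hq => by
      rw [← kap_plusV hc, plusType_kap_right hc x _ (hW q hq) hv, kap_vec hc hX hq]
      exact yyv p hp _ (hJ q hq)
    have yvm : ∀ p : Tan E x, Jp x (Jp x p) = -p →
        plusType H F g Jp Xm (p, 0) (plusV Xp c x) (Xm x, 0) = 0 := fun p hp => by
      rw [← kap_plusV hc, plusType_kap_right hc x _ hv hv, ← plusType_kap_left hc x _ (hW p hp) hv,
        self]
    have yys : ∀ p : Tan E x, Jp x (Jp x p) = -p → ∀ q, Jp x (Jp x q) = -q →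
        ∀ u, plusProd g x u (plusVal (Xp, c) x) = 0 →
        plusType H F g Jp Xm u (p, 0) (q, 0) = 0 := fun p hp q hq => by
      refine ind _ _ (fun y hy => ?_) ?_ ?_
      · rw [plusType_vec hc hX hy hp hq]
        exact hT y hy p hp q hq
      · rw [rot, yyv p hp q hq]
      · rw [rot, yym p hp q hq]
    have kap_orth : ∀ u, plusProd g x (kap g Jp Xm x u) (plusVal (Xp, c) x) = 0 := fun u => by
      rw [plusProd_kap hc, kap_generator hc, map_zero, neg_zero]
    have ysv : ∀ p : Tan E x, Jp x (Jp x p) = -p → ∀ u,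
        plusProd g x u (plusVal (Xp, c) x) = 0 →
        plusType H F g Jp Xm u (p, 0) (plusV Xp c x) = 0 := fun p hp => by
      refine ind _ _ (fun y hy => yyv y hy p hp) ?_ ?_
      · rw [rot, self]
      · rw [rot, yvm p hp]
    have ysm : ∀ p : Tan E x, Jp x (Jp x p) = -p → ∀ u,
        plusProd g x u (plusVal (Xp, c) x) = 0 →
        plusType H F g Jp Xm u (p, 0) (Xm x, 0) = 0 := fun p hp => by
      refine ind _ _ (fun y hy => yym y hy p hp) ?_ ?_
      · rw [plusType_swap_left, yvm p hp, neg_zero]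
      · rw [rot, self]
    have yss : ∀ p : Tan E x, Jp x (Jp x p) = -p → ∀ u w,
        plusProd g x u (plusVal (Xp, c) x) = 0 → plusProd g x w (plusVal (Xp, c) x) = 0 →
        plusType H F g Jp Xm u w (p, 0) = 0 := fun p hp u w hu hw => by
      refine ind _ _ (fun y hy => ?_) ?_ ?_ u hu
      · rw [rot, yys p hp y hy w hw]
      · rw [rot, ysv p hp w hw]
      · rw [rot, ysm p hp w hw]
    have vss : ∀ u w, plusProd g x u (plusVal (Xp, c) x) = 0 →
        plusProd g x w (plusVal (Xp, c) x) = 0 →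
        plusType H F g Jp Xm u w (plusV Xp c x) = 0 := fun u w hu hw => by
      refine ind _ _ (fun y hy => ?_) ?_ ?_ u hu
      · rw [rot, yss y hy _ _ hw hv]
      · rw [rot, self]
      · rw [rot]
        refine ind _ _ (fun y hy => yvm y hy) ?_ ?_ w hw
        · rw [rot, rot, self]
        · rw [rot, self]
    have sss : ∀ u v w, plusProd g x u (plusVal (Xp, c) x) = 0 →
        plusProd g x v (plusVal (Xp, c) x) = 0 → plusProd g x w (plusVal (Xp, c) x) = 0 →
        plusType H F g Jp Xm u v w = 0 := fun u v w hu hv' hw => by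
      refine ind _ _ (fun y hy => ?_) ?_ ?_ u hu
      · rw [rot, yss y hy _ _ hv' hw]
      · rw [rot, vss _ _ hv' hw]
      · rw [← kap_plusV hc, plusType_kap_left hc x _ hv hv', rot, vss _ _ (kap_orth v) hw]
    have yv0 : ∀ p : Tan E x, Jp x (Jp x p) = -p →
        plusType H F g Jp Xm (p, 0) (plusV Xp c x) (plusVal (Xp, c) x) = 0 := fun p hp => by
      rw [plusType_plusV_generator hc hX hp, hβ p hp, neg_zero]
    have vm0 : plusType H F g Jp Xm (plusV Xp c x) (Xm x, 0) (plusVal (Xp, c) x) = 0 := by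
      -- Moving κ from one copy of V to the other compares the value at (X₋, V, u₀) with that at (V,
      -- X₋, u₀), which differ by a sign.
      have e1 := plusType_kap_left (H := H) (F := F) hc x (plusVal (Xp, c) x) hv hv
      rw [kap_plusV hc, plusType_swap_left] at e1
      linarith
    have ys0 : ∀ p : Tan E x, Jp x (Jp x p) = -p → ∀ u,
        plusProd g x u (plusVal (Xp, c) x) = 0 →
        plusType H F g Jp Xm u (plusVal (Xp, c) x) (p, 0) = 0 := fun p hp => by
      refine ind _ _ (fun y hy => ?_) ?_ ?_
      · rw [rot, rot, plusType_generator hc hX hp hy, hA p hp y hy, hB p hp y hy, sub_self]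
      · rw [rot, rot, yv0 p hp]
      · rw [rot, rot, ← kap_plusV hc, ← plusType_kap_left hc x _ (hW p hp) hv, kap_vec hc hX hp,
          yv0 _ (hJ p hp)]
    have vs0 : ∀ u, plusProd g x u (plusVal (Xp, c) x) = 0 →
        plusType H F g Jp Xm u (plusVal (Xp, c) x) (plusV Xp c x) = 0 := by
      refine ind _ _ (fun y hy => ?_) ?_ ?_
      · rw [plusType_swap_right, yv0 y hy, neg_zero]
      · rw [rot, self]
      · rw [rot, rot, vm0]
    have ss0 : ∀ u v, plusProd g x u (plusVal (Xp, c) x) = 0 →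
        plusProd g x v (plusVal (Xp, c) x) = 0 →
        plusType H F g Jp Xm u v (plusVal (Xp, c) x) = 0 := fun u v hu hv' => by
      refine ind _ _ (fun y hy => ?_) ?_ ?_ u hu
      · rw [rot, ys0 y hy v hv']
      · rw [rot, vs0 v hv']
      · rw [← kap_plusV hc, plusType_kap_left hc x _ hv hv', rot, vs0 _ (kap_orth v)]
    intro u₁ u₂ u₃ h₁ h₂
    -- Split u₃ into its part orthogonal to u₀ and its multiple of u₀.
    have e : u₃ = (u₃ - plusProd g x u₃ (plusVal (Xp, c) x) • plusVal (Xp, c) x)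
        + plusProd g x u₃ (plusVal (Xp, c) x) • plusVal (Xp, c) x := by simp
    have h₃ := sss (u₃ - plusProd g x u₃ (plusVal (Xp, c) x) • plusVal (Xp, c) x) u₁ u₂
      (by simp [plusProd_self hc]) h₁ h₂
    rw [← rot, e, plusType_add, plusType_smul, h₃, rot, ss0 _ _ h₁ h₂]
    ring

/-- The formulas for ∇X₊ and ∇X₋ are needed because they turn [X₊, X₋] = ∇_{X₊}X₋ - ∇_{X₋}X₊ into
`commVec`. The other conditions are real forms of the complex ones. -/
theorem kahlerConditions_iff
    (hc : ∀ x, IsComponentsAt (g x) (Jp x) (Jm x) (Xp x) (Xm x) (c x))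
    (hX : ∀ x, 1 - c x ^ 2 ≠ 0) (hD : IsLeviCivita g D)
    (hXp : ∀ x (v : Tan E x),
      D Xp x v = -(1 / 2 : ℝ) • H.vec g x (Xp x) v + c x • F.vec g x v)
    (hXm : ∀ x (v : Tan E x),
      D Xm x v = -(1 / 2 : ℝ) • H.vec g x (Xm x) v - Jp x (F.vec g x v)) :
    (∀ x (u₁ u₂ u₃ : Tan E x × ℝ), plusProd g x u₁ (plusVal (Xp, c) x) = 0 →
        plusProd g x u₂ (plusVal (Xp, c) x) = 0 → plusType H F g Jp Xm u₁ u₂ u₃ = 0) ↔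
      (∀ x, lieB Xp Xm x = 0) ∧
      (∀ x, ∀ Z ∈ T10 Jp x, ∀ W ∈ T10 Jp x, ∀ V ∈ T10 Jp x, Cx.trilin (H x) Z W V = 0) ∧
      (∀ x, ∀ Z ∈ T10 Jp x, ∀ W ∈ T10 Jp x,
        Cx.trilin (H x) (Cx.mk (Xp x) (c x • Xm x)) Z W = 0) ∧
      (∀ x, ∀ Z ∈ T10 Jp x, ∀ W ∈ T10 Jp x,
        Cx.bilin (F x) Z W = -Complex.I * Cx.trilin (H x) (Cx.ofReal (Xm x)) Z W) := by
  have hlie : ∀ x, lieB Xp Xm x = commVec H F g Jp Xp Xm c x := fun x => by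
    rw [hD.lieB_eq, hXp, hXm, H.vec_swap g x (Xm x), commVec]
    module
  have hmem : ∀ x (p : Tan E x), p ∈ Cx.sqNegOne (Jp x : Tan E x →ₗ[ℝ] Tan E x) ↔
      Jp x (Jp x p) = -p := fun x p => Cx.mem_sqNegOne
  simp only [plusType_eq_zero_iff hc hX, forall_and, hlie, T10, Cx.trilin_eq_zero_iff,
    Cx.trilin_mk_left, Cx.trilin_ofReal_left, Cx.bilin_add_I_mul_bilin_eq_zero_iff,
    neg_mul, eq_neg_iff_add_eq_zero, hmem, map_smul, LinearMap.smul_apply, smul_eq_mul, mul_sub,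
    formType, ContinuousLinearMap.coe_coe]

end
end BnGeometry

theorem mainTheorem3 {E : Type*} [NormedAddCommGroup E] [NormedSpace ℝ E] [FiniteDimensional ℝ E]
    {M : Type*} [TopologicalSpace M] [T2Space M] [SecondCountableTopology M]
    [ChartedSpace E M] [IsManifold 𝓘(ℝ, E) ∞ M]
    (hn : Even (Module.finrank ℝ E))
    (H : ThreeForm E M) (F : TwoForm E M) (hHF : IsTwist H F)
    (G : GenMetric E M) (𝓕 : Π x : M, Fib E x →ₗ[ℝ] Fib E x)
    (hG𝓕 : IsGenAlmostPseudoHermitian G 𝓕)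
    (g : PseudoRiemMetric E M) (Jp Jm : EndField E M) (Xp Xm : VField E M) (c : SmoothFun E M)
    (hcomp : IsComponents G 𝓕 g Jp Jm Xp Xm c)
    (hXp : ∀ x, g x (Xp x) (Xp x) ≠ 0) (hXm : ∀ x, g x (Xm x) (Xm x) ≠ 0)
    (D : Conn E M) (hD : IsLeviCivita g D) :
    IsGenPseudoKahler H F G 𝓕 ↔
      ((PreservesT10 (Dplus H F g Jp Xp Xm c D) Jp ∧
        PreservesT10 (Dminus H g D) Jm ∧
        (∀ x, lieB Xp Xm x = 0) ∧
        (∀ x (v : Tan E x),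
          D Xp x v = -(1 / 2 : ℝ) • H.vec g x (Xp x) v + c x • F.vec g x v) ∧
        (∀ x (v : Tan E x),
          D Xm x v = -(1 / 2 : ℝ) • H.vec g x (Xm x) v - Jp x (F.vec g x v))) ∧
      ((∀ x, ∀ Z ∈ T10 Jm x, ∀ W ∈ T10 Jm x, Cx.bilin (F x) Z W = 0) ∧
        (∀ x, ∀ Z ∈ T10 Jp x, ∀ W ∈ T10 Jp x, ∀ V ∈ T10 Jp x, Cx.trilin (H x) Z W V = 0) ∧
        (∀ x, ∀ Z ∈ T10 Jm x, ∀ W ∈ T10 Jm x, ∀ V ∈ T10 Jm x, Cx.trilin (H x) Z W V = 0) ∧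
        (∀ x, ∀ Z ∈ T10 Jp x, ∀ W ∈ T10 Jp x,
          Cx.trilin (H x) (Cx.mk (Xp x) (c x • Xm x)) Z W = 0) ∧
        (∀ x, ∀ Z ∈ T10 Jp x, ∀ W ∈ T10 Jp x,
          Cx.bilin (F x) Z W = -Complex.I * Cx.trilin (H x) (Cx.ofReal (Xm x)) Z W)) ∧
      (∀ x (v : Tan E x), dirDeriv c x v = F x (Xp x) v)) := by
  have hc := hcomp.isComponentsAt hG𝓕
  have hX : ∀ x, 1 - c x ^ 2 ≠ 0 := fun x => by
    rw [← (hc x).Xp_Xp]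
    exact hXp x
  rw [pseudoKahler_iff hD hG𝓕 hcomp, plusParallel_iff hD hc hX, minusParallel_iff hc,
    formType_eq_zero_iff hc]
  -- The torsion conditions match those on H, F and [X₊, X₋] only in the presence of the formulas
  -- for ∇X₊ and ∇X₋, so `kahlerConditions_iff` is applied within each direction.
  constructor
  · rintro ⟨⟨h1, h2, h3, h4⟩, ⟨h5, h6⟩, h7, h8⟩
    obtain ⟨h9, h10, h11, h12⟩ := (kahlerConditions_iff hc hX hD h2 h3).1 h7
    exact ⟨⟨h1, h5, h9, h2, h3⟩, ⟨h6, h10, h8, h11, h12⟩, h4⟩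
  · rintro ⟨⟨h1, h5, h9, h2, h3⟩, ⟨h6, h10, h8, h11, h12⟩, h4⟩
    exact ⟨⟨h1, h2, h3, h4⟩, ⟨h5, h6⟩,
      (kahlerConditions_iff hc hX hD h2 h3).2 ⟨h9, h10, h11, h12⟩, h8⟩
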